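/- Let $p$ be a prime, let $x \ge 1$, and put $d_x = (p-1)p^{x-1}$. Let $K = \mathbb{Z}_p^{p-1}$ and let $M$ be the automorphism of $K$ given by the companion matrix of $y^{p-1} + y^{p-2} + \dots + y + 1$. Let $T = \bigoplus_{j=1}^{p^{x-1}} K$, which has rank $d_x$ over $\mathbb{Z}_p$, and let $\theta$ be the automorphism of $T$ given by $$\theta(k_1, k_2, \dots, k_{p^{x-1}}) = (M k_{p^{x-1}}, k_1, \dots, k_{p^{x-1}-1}).$$ Let $P = \langle \theta \rangle \cong C_{p^x}$ and let $R = T \rtimes P$, the uniserial $p$-adic space group with translation group $T$ and point group $P$. Then for every $i \ge 0$ there is exactly one subgroup $N_i \le T$ with $\theta(N_i) = N_i$ and $|T : N_i| = p^{i+d_x}$. Put $R_i = R/N_i$. For every $i \ge 0$ there is an isomorphism $$H^*(R_i; \mathbb{F}_p) \cong H^*(R_0; \mathbb{F}_p)$$ of graded $\mathbb{F}_p$-modules, where $\mathbb{F}_p$ has the trivial action. -/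

import Mathlib

open scoped Matrix

noncomputable section

namespace PAdicSpaceGroup

/-- The companion matrix of `y ^ (p - 1) + y ^ (p - 2) + ⋯ + y + 1` over `ℤ_[p]`: it sends
`e_j` to `e_{j+1}` for `j + 1 < p - 1`, and the last basis vector to `-(e_0 + ⋯ + e_{p-2})`. -/
def companion (p : ℕ) [Fact p.Prime] : Matrix (Fin (p - 1)) (Fin (p - 1)) ℤ_[p] :=
  fun i j => if (j : ℕ) + 1 = p - 1 then -1 else if (i : ℕ) = j + 1 then 1 else 0

/-- The inverse of `companion p`. -/
def companionInv (p : ℕ) [Fact p.Prime] : Matrix (Fin (p - 1)) (Fin (p - 1)) ℤ_[p] :=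
  fun i j => if (j : ℕ) = 0 then -1 else if (i : ℕ) + 1 = j then 1 else 0

theorem companion_mul_companionInv (p : ℕ) [Fact p.Prime] :
    companion p * companionInv p = 1 := by
  ext ⟨i, hi⟩ ⟨k, hk⟩
  rw [Matrix.mul_apply]
  simp only [companion, companionInv, Matrix.one_apply, Fin.mk.injEq]
  by_cases h0 : k = 0
  · by_cases hi0 : i = 0
    · rw [Finset.sum_eq_single (⟨p - 2, by omega⟩ : Fin (p - 1))]
      · grind
      · rintro ⟨j, hj⟩ - hne
        simp only [ne_eq, Fin.mk.injEq] at hne ⊢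
        grind
      · simp
    · rw [Finset.sum_eq_add (⟨i - 1, by omega⟩ : Fin (p - 1)) ⟨p - 2, by omega⟩
        (by simp only [ne_eq, Fin.mk.injEq]; omega)]
      · grind
      · rintro ⟨j, hj⟩ - hne
        simp only [ne_eq, Fin.mk.injEq] at hne ⊢
        grind
      · simp
      · simp
  · rw [Finset.sum_eq_single (⟨k - 1, by omega⟩ : Fin (p - 1))]
    · grind
    · rintro ⟨j, hj⟩ - hne
      simp only [ne_eq, Fin.mk.injEq] at hne ⊢
      grind
    · simp

theorem companionInv_mul_companion (p : ℕ) [Fact p.Prime] :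
    companionInv p * companion p = 1 :=
  mul_eq_one_comm.mp (companion_mul_companionInv p)

/-- The lattice `K = ℤ_p ^ (p - 1)`. -/
abbrev K (p : ℕ) [Fact p.Prime] : Type := Fin (p - 1) → ℤ_[p]

/-- The automorphism of `K` given by the companion matrix. -/
def companionAut (p : ℕ) [Fact p.Prime] : K p ≃+ K p where
  toFun v := companion p *ᵥ v
  invFun v := companionInv p *ᵥ v
  left_inv v := by simp [companionInv_mul_companion]
  right_inv v := by simp [companion_mul_companionInv]
  map_add' v w := Matrix.mulVec_add _ v w

/-- The translation group `T`, the direct sum of `p ^ (x - 1)` copies of `K`. -/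
abbrev T (p x : ℕ) [Fact p.Prime] : Type := Fin (p ^ (x - 1)) → K p

/-- The rank `d_x = (p - 1) p ^ (x - 1)` of the translation group. -/
def dim (p x : ℕ) : ℕ := (p - 1) * p ^ (x - 1)

/-- The automorphism `θ` of `T`, which moves the copies of `K` cyclically and applies the companion
matrix when it passes from the last copy to the first one:
`θ (k_0, …, k_{q-1}) = (M k_{q-1}, k_0, …, k_{q-2})` with `q = p ^ (x - 1)`.
The indices `j - 1` and `j + 1` in `Fin q` are taken modulo `q`. -/
def theta (p x : ℕ) [Fact p.Prime] : T p x ≃+ T p x where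
  toFun t j := if j = 0 then companionAut p (t (j - 1)) else t (j - 1)
  invFun t j := if j + 1 = 0 then (companionAut p).symm (t (j + 1)) else t (j + 1)
  left_inv t := by
    funext j
    by_cases h : j + 1 = 0
    · simp only [h, if_true, AddEquiv.symm_apply_apply]
      rw [← h, add_sub_cancel_right]
    · simp [h]
  right_inv t := by
    funext j
    by_cases h : j = 0 <;> simp [h]
  map_add' s t := by
    funext j
    by_cases h : j = 0 <;> simp [h]

/-- `θ` as an automorphism of the translation group written multiplicatively. -/
def thetaMul (p x : ℕ) [Fact p.Prime] : MulAut (Multiplicative (T p x)) :=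
  AddEquiv.toMultiplicative (theta p x)

/-- The point group `P = ⟨θ⟩`, a cyclic group of order `p ^ x` when `1 ≤ x`. -/
abbrev P (p x : ℕ) [Fact p.Prime] : Subgroup (MulAut (Multiplicative (T p x))) :=
  Subgroup.zpowers (thetaMul p x)

/-- The space group `R = T ⋊ P`. -/
abbrev R (p x : ℕ) [Fact p.Prime] : Type :=
  Multiplicative (T p x) ⋊[(P p x).subtype] P p x

/-- The `θ`-invariant subgroups of `T`. -/
def InvariantSubgroup (p x : ℕ) [Fact p.Prime] : Type :=
  {N : AddSubgroup (T p x) // N.map (theta p x).toAddMonoidHom = N}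

namespace InvariantSubgroup

variable {p x : ℕ} [Fact p.Prime]

/-- An invariant subgroup of `T`, seen as a subgroup of `R`. -/
def inSpaceGroup (N : InvariantSubgroup p x) : Subgroup (R p x) :=
  (AddSubgroup.toSubgroup N.1).map SemidirectProduct.inl

instance normal_inSpaceGroup (N : InvariantSubgroup p x) : N.inSpaceGroup.Normal := by
  have hθ : ∀ t : T p x, t ∈ N.1 ↔ theta p x t ∈ N.1 := by
    intro t
    constructor
    · intro ht
      rw [← N.2]
      exact AddSubgroup.mem_map_of_mem _ ht
    · intro ht
      rw [← N.2] at ht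
      obtain ⟨s, hs, hst⟩ := ht
      rwa [← (theta p x).injective hst]
  let S : Subgroup (Multiplicative (T p x)) := AddSubgroup.toSubgroup N.1
  have hS : ∀ t : Multiplicative (T p x), t ∈ S ↔ thetaMul p x t ∈ S :=
    fun t => hθ (Multiplicative.toAdd t)
  have hP : ∀ g : P p x, ∀ t ∈ S, g.1 t ∈ S := by
    rintro ⟨g, k, rfl⟩
    induction k using Int.induction_on with
    | zero => intro t ht; simpa using ht
    | succ k ih =>
      intro t ht
      have h := ih (thetaMul p x t) ((hS t).1 ht)
      simpa [zpow_add_one] using h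
    | pred k ih =>
      intro t ht
      have h := ih ((thetaMul p x)⁻¹ t) ((hS _).2 (by simpa using ht))
      simpa [zpow_sub_one] using h
  constructor
  rintro _ ⟨n, hn, rfl⟩ g
  refine ⟨g.left * g.right.1 n * g.left⁻¹, ?_, ?_⟩
  · have : g.left * g.right.1 n * g.left⁻¹ = g.right.1 n := by
      rw [mul_comm, inv_mul_cancel_left]
    rw [this]
    exact hP g.right n hn
  · apply SemidirectProduct.ext <;> simp

/-- The quotient group `R / N`. -/
abbrev Quotient (N : InvariantSubgroup p x) : Type := R p x ⧸ N.inSpaceGroup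

end InvariantSubgroup

/-- The cohomology group `H^n(G; 𝔽_p)` with trivial coefficients. -/
abbrev H (p : ℕ) (G : Type) [Group G] (n : ℕ) : ModuleCat (ZMod p) :=
  groupCohomology (Rep.trivial (ZMod p) G (ZMod p)) n

end PAdicSpaceGroup

end

/-! Write ψ = θ^(p^(x-1)) and V = Hom(T, 𝔽_p), and let (Sym V ⊗ ΛV)_m be the part of degree m, where
V has degree 2 in Sym V and degree 1 in ΛV. The proof shows, for N = pδT with δ ∈ ℤ[θ] dividing a
power of p, that dim H^n(R/N; 𝔽_p) = Σ_{j ≤ n} dim H^(n-j)(P; (Sym V ⊗ ΛV)_j). The right-hand side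
does not involve δ. Since pT = (θ-1)^d T and the invariant subgroups of p-power index are the images
of powers of θ-1 (`eq_piPow`), N_i = p(θ-1)^i T, so all R_i have cohomology of the same finite
dimension in each degree.

For the formula put α = pδ(ψ-1) and U = T/αT. Multiplication by ψ-1 embeds R/N in U ⋊ P as A ⋊ P
with A = (ψ-1)T/αT (`quotientEquiv`). By Shapiro's lemma H^*(R/N) is the cohomology of U ⋊ P in the
functions on the cosets of A ⋊ P. This module is coresolved by the representations C_m coinduced
from (Sym V ⊗ ΛV)_m on the complement P. The differential is convolution with D = Σ_h z_h ⊗ (e_h ∧)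
+ Σ_{h,g} c_{h,g} ⊗ e_h · ι(ev_{hg}), an element of 𝔽_p[U] ⊗ End(Sym V ⊗ ΛV); z_h is the group
element of h·`origin`, e_h the translate by h of the first coordinate modulo p, and ι(ev_h)
contraction with evaluation at h·`origin`.

Exactness comes from lifting D to 𝔽_p[L], where L is the lattice of integer vectors. With w_h the
group element of h·pδ·`origin`, the coefficients c are chosen so that Σ_g c_{h,g}(z_{hg} - z_{hgψ})
= w_h - 1. Then D² = Σ_i γ_i X_i, where X_i multiplies by the i-th basis vector in Sym V and the γ_i
are differences of the w_h. These form a regular sequence generating the kernel of 𝔽_p[L] → 𝔽_p[U],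
and a matrix factorization of a regular sequence is exact in positive degrees modulo the sequence
(`exists_sub_mem_coeffIn`).

The dimensions add up because every connecting map is injective. The coefficients of D at the
elements of U sum to zero, so D kills the functions constant on U, and these already carry all of
H^*(U ⋊ P; C_m) ≅ H^*(P; (Sym V ⊗ ΛV)_m), as restriction to P is split by inflation
(`map_constants_surjective`). The vanishing of that sum is where the factor p in N is used: a
character of L with values in 𝔽_p vanishes at pδ·`origin`. -/

noncomputable section

open CategoryTheory

/-! ### Long exact sequences with injective connecting maps -/

namespace groupCohomology

variable {k : Type} [Field k] {G : Type} [Group G]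

/-- The group cohomology of a finite group with finite-dimensional coefficients is
finite-dimensional. -/
theorem finite_of_finite [Finite G] (A : Rep k G) [Module.Finite k A] (n : ℕ) :
    Module.Finite k (groupCohomology A n) := by
  have h1 : Module.Finite k ((inhomogeneousCochains A).X n) :=
    inferInstanceAs (Module.Finite k ((Fin n → G) → A))
  have h2 : Module.Finite k (cocycles A n) :=
    Module.Finite.of_injective (iCocycles A n).hom
      ((ModuleCat.mono_iff_injective (iCocycles A n)).1 inferInstance)
  exact Module.Finite.of_surjective (groupCohomology.π A n).hom
      ((ModuleCat.epi_iff_surjective (groupCohomology.π A n)).1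
        (inferInstanceAs (Epi ((inhomogeneousCochains A).homologyπ n))))

section LongExact

variable {X : ShortComplex (Rep k G)} (hX : X.ShortExact) {K : Rep k G} (κ : K ⟶ X.X₂)
  (hκ : κ ≫ X.g = 0)
  (hs : ∀ n, Function.Surjective (map (MonoidHom.id G) κ n).hom)

include hX hκ hs

/-- Since `κ` is killed by `X.g`, it factors through `X.X₁`; classes coming from `K` therefore come
from `X.X₁`. -/
theorem map_surjective_of_kernel (n : ℕ) :
    Function.Surjective (map (MonoidHom.id G) X.f n).hom := by
  have := hX.mono_f
  have e : hX.exact.lift κ hκ ≫ X.f = κ := hX.exact.lift_f κ hκ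
  intro y
  obtain ⟨z, rfl⟩ := hs n y
  refine ⟨(map (MonoidHom.id G) (hX.exact.lift κ hκ) n).hom z, ?_⟩
  conv_rhs => rw [← e, map_id_comp]
  rfl

theorem finrank_zero_of_kernel :
    Module.finrank k (groupCohomology X.X₁ 0) = Module.finrank k (groupCohomology X.X₂ 0) := by
  have := hX.mono_f
  have hi : Function.Injective (map (MonoidHom.id G) X.f 0).hom :=
    (ModuleCat.mono_iff_injective _).1 inferInstance
  exact (LinearEquiv.ofBijective _ ⟨hi, map_surjective_of_kernel hX κ hκ hs 0⟩).finrank_eq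

/-- Surjectivity of H^n(X₁) → H^n(X₂) makes the connecting map on H^n(X₃) injective. With
surjectivity in degree n+1, the long exact sequence breaks into 0 → H^n(X₃) → H^(n+1)(X₁) →
H^(n+1)(X₂) → 0. -/
theorem finrank_succ_of_kernel [Finite G] [Module.Finite k X.X₁] (n : ℕ) :
    Module.finrank k (groupCohomology X.X₁ (n + 1)) =
      Module.finrank k (groupCohomology X.X₃ n) +
        Module.finrank k (groupCohomology X.X₂ (n + 1)) := by
  have := finite_of_finite X.X₁ (n + 1)
  have h1 : Function.Surjective (map (MonoidHom.id G) X.f (n + 1)).hom :=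
    map_surjective_of_kernel hX κ hκ hs (n + 1)
  have e1 := (mapShortComplex₁_exact hX (i := n) rfl).moduleCat_range_eq_ker
  have e3 := (mapShortComplex₃_exact hX (i := n) rfl).moduleCat_range_eq_ker
  have e2 := (mapShortComplex₂_exact hX n).moduleCat_range_eq_ker
  have h2 := map_surjective_of_kernel hX κ hκ hs n
  have hδ : Function.Injective (δ hX n (n + 1) rfl).hom := by
    refine (injective_iff_map_eq_zero _).2 fun z hz => ?_
    obtain ⟨y, rfl⟩ := e3.ge hz
    obtain ⟨w, rfl⟩ := h2 y
    exact e2.le ⟨w, rfl⟩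
  rw [← LinearMap.finrank_range_add_finrank_ker (map (MonoidHom.id G) X.f (n + 1)).hom,
    LinearMap.range_eq_top.2 h1, finrank_top, add_comm]
  congr 1
  rw [← LinearMap.finrank_range_of_inj hδ]
  exact congrArg (fun S : Submodule k (groupCohomology X.X₁ (n + 1)) => Module.finrank k S) e1.symm

end LongExact

end groupCohomology
end

/-! ### Representations of U ⋊ P coinduced from the complement P -/

noncomputable section

open CategoryTheory

namespace SemidirectProduct

variable {k : Type} [Field k] {U P : Type} [Group U] [Group P] (φ : P →* MulAut U)

/-- The complement `P` of `U` in `U ⋊ P`. -/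
abbrev complement : Subgroup (U ⋊[φ] P) := (inr : P →* U ⋊[φ] P).range

/-- A representation of `P`, seen as a representation of the complement in `U ⋊ P`. -/
abbrev resComplement (N : Rep k P) : Rep k (complement φ) :=
  Rep.res (rightHom.comp (complement φ).subtype) N

/-- The representation of `U ⋊ P` coinduced from a representation of `P`. -/
abbrev coindComplement (N : Rep k P) : Rep k (U ⋊[φ] P) :=
  Rep.coind (complement φ).subtype (resComplement φ N)

/-- The inclusion of the inflation of `N` in the coinduced representation as the functions which
are constant on `U`. -/
def constants (N : Rep k P) : Rep.res rightHom N ⟶ coindComplement φ N :=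
  Rep.resCoindToHom (complement φ).subtype (Rep.res rightHom N) (resComplement φ N) (𝟙 _)

theorem constants_apply (N : Rep k P) (v : N) (x : U ⋊[φ] P) :
    ((constants φ N).hom v).1 x = N.ρ x.right v := rfl

/-- Evaluation at `1` of the coinduced representation. -/
def evalOne (N : Rep k P) : Rep.res inr (coindComplement φ N) ⟶ N :=
  Rep.ofHom ⟨LinearMap.proj 1 ∘ₗ (Submodule.subtype _), fun g => by
    ext f
    have := f.2 ⟨inr g, g, rfl⟩ 1
    change f.1 (1 * inr g) = N.ρ g (f.1 1)
    simpa using this⟩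

/-- The isomorphism of `P` with the complement. -/
def complementEquiv : complement φ ≃* P :=
  (MonoidHom.ofInjective (f := (inr : P →* U ⋊[φ] P)) inr_injective).symm

theorem complementEquiv_apply (s : complement φ) : complementEquiv φ s = s.1.right := by
  obtain ⟨_, g, rfl⟩ := s
  rw [complementEquiv, MulEquiv.symm_apply_eq]
  rfl

/-- Shapiro's lemma, followed by the identification of the complement with `P`. -/
theorem finrank_groupCohomology_coindComplement (N : Rep k P) (n : ℕ) :
    Module.finrank k (groupCohomology (coindComplement φ N) n) =
      Module.finrank k (groupCohomology N n) :=
  ((groupCohomology.coindIso (resComplement φ N) n).toLinearEquiv.trans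
    (groupCohomology.mapIso (complementEquiv φ) (LinearEquiv.refl k N) (fun g => by
      rw [complementEquiv_apply]; rfl) n).toLinearEquiv).finrank_eq

/-- The map H^n(P; N) → H^n(U ⋊ P; coind N) given by inflation and `constants` is split by
restriction to `P` and evaluation at 1, hence injective. Both sides have the same finite dimension,
so it is also surjective, and it factors through the map in question. -/
theorem map_constants_surjective [Finite P] (N : Rep k P) [Module.Finite k N] [Finite U] (n : ℕ) :
    Function.Surjective (groupCohomology.map (A := Rep.res rightHom N) (MonoidHom.id (U ⋊[φ] P))
      (constants φ N) n).hom := by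
  have : Finite (U ⋊[φ] P) := Finite.of_equiv _ SemidirectProduct.equivProd.symm
  have hf : Module.Finite k (coindComplement φ N) :=
    inferInstanceAs (Module.Finite k (Representation.coindV _ _))
  have := groupCohomology.finite_of_finite (coindComplement φ N) n
  have := groupCohomology.finite_of_finite N n
  let s := groupCohomology.map (rightHom : U ⋊[φ] P →* P) (constants φ N) n
  let r := groupCohomology.map (inr : P →* U ⋊[φ] P) (evalOne φ N) n
  have hrs : s ≫ r = 𝟙 _ := by
    rw [← groupCohomology.map_comp, ← groupCohomology.map_id]
    refine groupCohomology.map_congr (by ext; simp) ?_ n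
    ext v
    change ((constants φ N).hom v).1 1 = v
    rw [constants_apply]
    simp
  have hinj : Function.Injective s.hom := by
    refine Function.LeftInverse.injective (g := r.hom) fun z => ?_
    exact congrArg (fun f : groupCohomology N n ⟶ _ => f.hom z) hrs
  have hsurj : Function.Surjective s.hom :=
    (LinearMap.injective_iff_surjective_of_finrank_eq_finrank
      (finrank_groupCohomology_coindComplement φ N n).symm).1 hinj
  have hfac : s = groupCohomology.map (rightHom : U ⋊[φ] P →* P) (𝟙 (Rep.res rightHom N)) n ≫
      groupCohomology.map (A := Rep.res rightHom N) (MonoidHom.id (U ⋊[φ] P))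
        (constants φ N) n := by
    rw [← groupCohomology.map_comp]
    exact groupCohomology.map_congr rfl rfl n
  intro y
  obtain ⟨z, hz⟩ := hsurj y
  rw [hfac] at hz
  exact ⟨_, hz⟩

end SemidirectProduct
end

/-! ### Dimension count along a coresolution -/

noncomputable section

open CategoryTheory Limits

namespace groupCohomology

variable {k : Type} [Field k] {G : Type} [Group G] [Finite G]

/-- The dimensions obtained by adding up the diagonals of a double sequence of cohomology
groups. -/
def diagonalDim (h : ℕ → ℕ → ℕ) : ℕ → ℕ → ℕ
  | 0, m => h 0 m
  | n + 1, m => diagonalDim h n (m + 1) + h (n + 1) m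

/-- Let `B → C m → C (m + 1) → ⋯` be a coresolution such that, in cohomology, every class of `C j`
comes from a representation that maps into the kernel of the differential. Then the cohomology of
`B` is, additively, the sum of the cohomologies of the `C j`. -/
theorem finrank_of_coresolution (C : ℕ → Rep k G) [∀ m, Module.Finite k (C m)]
    (D : ∀ m, C m ⟶ C (m + 1)) (hD : ∀ m, D m ≫ D (m + 1) = 0)
    (hex : ∀ m, (ShortComplex.mk (D m) (D (m + 1)) (hD m)).Exact)
    (K : ℕ → Rep k G) (κ : ∀ m, K m ⟶ C m) (hκ : ∀ m, κ m ≫ D m = 0)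
    (hs : ∀ m n, Function.Surjective (map (MonoidHom.id G) (κ m) n).hom) (n : ℕ) :
    ∀ (m : ℕ) (B : Rep k G) (i : B ⟶ C m) (_ : Mono i) (hi : i ≫ D m = 0)
      (_ : (ShortComplex.mk i (D m) hi).Exact),
      Module.finrank k (groupCohomology B n) =
        diagonalDim (fun n m => Module.finrank k (groupCohomology (C m) n)) n m := by
  -- Corestricting `D m` to the kernel of `D (m + 1)` gives a short exact sequence with quotient
  -- that kernel. The kernel takes the role of `B` at the next stage, with the cohomological degree
  -- lowered by one.
  have key : ∀ (m : ℕ) (B : Rep k G) (i : B ⟶ C m) (_ : Mono i) (hi : i ≫ D m = 0)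
      (_ : (ShortComplex.mk i (D m) hi).Exact),
      (ShortComplex.mk i (kernel.lift (D (m + 1)) (D m) (hD m))
        (by rw [← cancel_mono (kernel.ι (D (m + 1)))]; simpa using hi)).ShortExact := by
    intro m B i _ hi hB
    refine @ShortComplex.ShortExact.mk _ _ _ _ ?_ inferInstance
      ((ShortComplex.exact_iff_epi_kernel_lift _).1 (hex m))
    let f : ShortComplex.mk i (kernel.lift (D (m + 1)) (D m) (hD m))
        (by rw [← cancel_mono (kernel.ι (D (m + 1)))]; simpa using hi) ⟶
          ShortComplex.mk i (D m) hi :=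
      { τ₁ := 𝟙 _
        τ₂ := 𝟙 _
        τ₃ := kernel.ι (D (m + 1)) }
    have h1 : Epi f.τ₁ := inferInstanceAs (Epi (𝟙 _))
    have h2 : IsIso f.τ₂ := inferInstanceAs (IsIso (𝟙 _))
    have h3 : Mono f.τ₃ := inferInstanceAs (Mono (kernel.ι _))
    exact (ShortComplex.exact_iff_of_epi_of_isIso_of_mono f).2 hB
  have hκ' : ∀ m, κ m ≫ kernel.lift (D (m + 1)) (D m) (hD m) = 0 := by
    intro m
    rw [← cancel_mono (kernel.ι (D (m + 1)))]
    simpa using hκ m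
  induction n with
  | zero =>
    intro m B i hi1 hi hB
    refine (finrank_zero_of_kernel (key m B i hi1 hi hB) (κ m) (hκ' m) (hs m)).trans ?_
    rw [diagonalDim]
  | succ n ih =>
    intro m B i hi1 hi hB
    have hfin : Module.Finite k B :=
      Module.Finite.of_injective i.hom.toLinearMap ((Rep.mono_iff_injective i).1 hi1)
    refine (@finrank_succ_of_kernel _ _ _ _ _ (key m B i hi1 hi hB) _ (κ m) (hκ' m) (hs m) _
      hfin n).trans ?_
    rw [diagonalDim]
    congr 1
    exact ih (m + 1) _ (kernel.ι _) inferInstance (kernel.condition _)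
      (ShortComplex.exact_kernel _)

end groupCohomology

/-- A complex of representations is exact if it is exact as a complex of modules. -/
theorem Rep.exact_of_forall {k : Type} [Field k] {G : Type} [Group G] {A B C : Rep k G}
    (f : A ⟶ B) (g : B ⟶ C) (h : f ≫ g = 0) (hex : ∀ b : B, g.hom b = 0 → ∃ a, f.hom a = b) :
    (ShortComplex.mk f g h).Exact := by
  refine (forget₂ (Rep k G) (ModuleCat k)).reflects_exact_of_faithful _ ?_
  rw [ShortComplex.moduleCat_exact_iff]
  exact hex

/-! ### Convolutions between coinduced representations -/

namespace SemidirectProduct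

variable {k : Type} [Field k] {U P : Type} [Group U] [Group P] (φ : P →* MulAut U)
  {M N : Rep k P} (A : U → M →ₗ[k] N)
  (hA : ∀ g u, N.ρ g ∘ₗ A u = A (φ g u) ∘ₗ M.ρ g)

theorem inl_inv_mul_inr_mul (u : U) (g : P) (x : U ⋊[φ] P) :
    (inl u)⁻¹ * (inr g * x) = inr g * ((inl (φ g⁻¹ u))⁻¹ * x) := by
  apply SemidirectProduct.ext <;> simp

/-- Convolution with an equivariant family of linear maps, as a morphism of coinduced
representations. -/
def convolution [Fintype U] : coindComplement φ M ⟶ coindComplement φ N :=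
  Rep.ofHom
    { toFun f := ⟨fun x => ∑ u, A u (f.1 ((inl u)⁻¹ * x)), by
        rintro ⟨_, g, rfl⟩ x
        change ∑ u, A u (f.1 ((inl u)⁻¹ * (inr g * x))) = N.ρ g (∑ u, A u (f.1 ((inl u)⁻¹ * x)))
        rw [map_sum, ← Equiv.sum_comp (φ g).toEquiv]
        refine Finset.sum_congr rfl fun u _ => ?_
        have h1 := f.2 ⟨inr g, g, rfl⟩ ((inl u)⁻¹ * x)
        have h2 := LinearMap.congr_fun (hA g u) (f.1 ((inl u)⁻¹ * x))
        change f.1 (inr g * ((inl u)⁻¹ * x)) = M.ρ g _ at h1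
        change N.ρ g (A u _) = A (φ g u) (M.ρ g _) at h2
        rw [h2, ← h1, inl_inv_mul_inr_mul]
        simp⟩
      map_add' f f' := by
        ext x
        change ∑ u, A u (f.1 _ + f'.1 _) = ∑ u, A u (f.1 _) + ∑ u, A u (f'.1 _)
        simp [Finset.sum_add_distrib]
      map_smul' c f := by
        ext x
        change ∑ u, A u (c • f.1 _) = c • ∑ u, A u (f.1 _)
        simp [Finset.smul_sum]
      isIntertwining' g := by
        ext f x
        change ∑ u, A u (f.1 ((inl u)⁻¹ * x * g)) = ∑ u, A u (f.1 ((inl u)⁻¹ * (x * g)))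
        simp [mul_assoc] }

theorem convolution_apply [Fintype U] (f : coindComplement φ M) (x : U ⋊[φ] P) :
    ((convolution φ A hA).hom f).1 x = ∑ u, A u (f.1 ((inl u)⁻¹ * x)) := rfl

/-- On a function constant along `U`, convolution acts through the total mass of the kernel. -/
theorem constants_comp_convolution [Fintype U] (h0 : ∑ u, A u = 0) :
    constants φ M ≫ convolution φ A hA = 0 := by
  refine Rep.hom_ext (DFunLike.ext _ _ fun v => ?_)
  refine Subtype.ext (funext fun x => ?_)
  change ∑ u, A u (M.ρ ((inl u)⁻¹ * x).right v) = 0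
  simpa using LinearMap.congr_fun h0 (M.ρ x.right v)

/-- The element of the coinduced representation with given restriction to `U`. -/
def extend (F : U → M) : coindComplement φ M :=
  ⟨fun x => M.ρ x.right (F (φ x.right⁻¹ x.left)), by
    rintro ⟨_, g, rfl⟩ x
    change M.ρ (inr g * x).right (F (φ (inr g * x).right⁻¹ (inr g * x).left)) =
      M.ρ g (M.ρ x.right (F (φ x.right⁻¹ x.left)))
    simp⟩

theorem extend_inl (F : U → M) (u : U) : (extend φ F).1 (inl u) = F u := by
  change M.ρ 1 (F (φ (1 : P)⁻¹ u)) = F u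
  simp

theorem coindComplement_ext {f f' : coindComplement φ M} (h : ∀ u, f.1 (inl u) = f'.1 (inl u)) :
    f = f' := by
  refine Subtype.ext (funext fun x => ?_)
  have e : x = inr x.right * inl (φ x.right⁻¹ x.left) := by
    apply SemidirectProduct.ext <;> simp
  have h1 := f.2 ⟨inr x.right, x.right, rfl⟩ (inl (φ x.right⁻¹ x.left))
  have h2 := f'.2 ⟨inr x.right, x.right, rfl⟩ (inl (φ x.right⁻¹ x.left))
  change f.1 (inr x.right * _) = _ at h1
  change f'.1 (inr x.right * _) = _ at h2
  rw [e, h1, h2, h]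

/-- The cohomology of a representation of `U ⋊ P` that is coresolved by coinduced representations
whose differentials are convolutions killing the functions constant on `U`. -/
theorem finrank_groupCohomology_of_convolution [Fintype U] [Finite P] (N : ℕ → Rep k P)
    [∀ m, Module.Finite k (N m)] (A : ∀ m, U → N m →ₗ[k] N (m + 1))
    (hA : ∀ m g u, (N (m + 1)).ρ g ∘ₗ A m u = A m (φ g u) ∘ₗ (N m).ρ g)
    (h0 : ∀ m, ∑ u, A m u = 0)
    (hsq : ∀ m (F : U → N m) (u : U),
      ∑ v, A (m + 1) v (∑ w, A m w (F (w⁻¹ * (v⁻¹ * u)))) = 0)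
    (hex : ∀ m (F : U → N (m + 1)), (∀ u, ∑ v, A (m + 1) v (F (v⁻¹ * u)) = 0) →
      ∃ F' : U → N m, ∀ u, ∑ v, A m v (F' (v⁻¹ * u)) = F u)
    (B : Rep k (U ⋊[φ] P)) (i : B ⟶ coindComplement φ (N 0))
    (hi : Function.Injective i.hom)
    (hB : ∀ f, (∃ b, i.hom b = f) ↔ ∀ u, ∑ v, A 0 v (f.1 (inl (v⁻¹ * u))) = 0) (n : ℕ) :
    Module.finrank k (groupCohomology B n) =
      groupCohomology.diagonalDim
        (fun n m => Module.finrank k (groupCohomology (N m) n)) n 0 := by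
  have : Finite (U ⋊[φ] P) := Finite.of_equiv _ SemidirectProduct.equivProd.symm
  have hf (m) : Module.Finite k (coindComplement φ (N m)) :=
    inferInstanceAs (Module.Finite k (Representation.coindV _ _))
  have hconv (m) (f : coindComplement φ (N m)) (u : U) :
      ((convolution φ (A m) (hA m)).hom f).1 (inl u) = ∑ v, A m v (f.1 (inl (v⁻¹ * u))) := by
    rw [convolution_apply]
    simp
  have hD (m) : convolution φ (A m) (hA m) ≫ convolution φ (A (m + 1)) (hA (m + 1)) = 0 := by
    refine Rep.hom_ext (DFunLike.ext _ _ fun f => ?_)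
    refine coindComplement_ext φ fun u => ?_
    refine (hconv (m + 1) ((convolution φ (A m) (hA m)).hom f) u).trans ?_
    simp only [hconv]
    exact hsq m (fun u => f.1 (inl u)) u
  have hzero (m) (f : coindComplement φ (N m)) : (convolution φ (A m) (hA m)).hom f = 0 ↔
      ∀ u, ∑ v, A m v (f.1 (inl (v⁻¹ * u))) = 0 := by
    constructor
    · intro h u
      rw [← hconv, h]
      rfl
    · intro h
      refine coindComplement_ext φ fun u => ?_
      rw [hconv, h]
      rfl
  have hi0 : i ≫ convolution φ (A 0) (hA 0) = 0 := by
    refine Rep.hom_ext (DFunLike.ext _ _ fun b => ?_)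
    exact (hzero 0 _).2 ((hB _).1 ⟨b, rfl⟩)
  have := groupCohomology.finrank_of_coresolution (fun m => coindComplement φ (N m))
    (fun m => convolution φ (A m) (hA m)) hD
    (fun m => Rep.exact_of_forall _ _ _ fun f hf => by
      obtain ⟨F', hF'⟩ := hex m (fun u => f.1 (inl u)) ((hzero _ _).1 hf)
      refine ⟨extend φ F', coindComplement_ext φ fun u => ?_⟩
      rw [hconv, ← hF']
      simp only [extend_inl])
    (fun m => Rep.res rightHom (N m)) (fun m => constants φ (N m))
    (fun m => constants_comp_convolution φ (A m) (hA m) (h0 m))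
    (fun m n => map_constants_surjective φ (N m) n) n 0 B i ((Rep.mono_iff_injective i).2 hi) hi0
    (Rep.exact_of_forall _ _ _ fun f hf => (hB f).2 ((hzero _ _).1 hf))
  rw [this]
  simp only [finrank_groupCohomology_coindComplement]

end SemidirectProduct
end

/-! ### Matrix factorizations of regular sequences -/

noncomputable section


namespace MatrixFactorization

open Finsupp

variable {Q M σ C : Type} [CommRing Q] [AddCommGroup M] [Module Q M]

/-- The elements of `M` which only involve basis vectors of degree `m`. -/
def homogeneous {J : Type} (B : Module.Basis J Q M) (δ : J → ℕ) (m : ℕ) : Submodule Q M :=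
  (Finsupp.supported Q Q {j | δ j = m}).comap B.repr.toLinearMap

theorem mem_homogeneous {J : Type} {B : Module.Basis J Q M} {δ : J → ℕ} {m : ℕ} {w : M} :
    w ∈ homogeneous B δ m ↔ ∀ j, B.repr w j ≠ 0 → δ j = m := by
  rw [homogeneous, Submodule.mem_comap, Finsupp.mem_supported]
  simp [Set.subset_def]

theorem homogeneous_eq_span {J : Type} (B : Module.Basis J Q M) (δ : J → ℕ) (m : ℕ) :
    homogeneous B δ m = Submodule.span Q (B '' {j | δ j = m}) := by
  ext w
  rw [Module.Basis.mem_span_image, homogeneous, Submodule.mem_comap, Finsupp.mem_supported]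
  rfl

variable (B : Module.Basis ((σ →₀ ℕ) × C) Q M)

/-- The elements of `M` whose coefficients at monomials in the variables of `t` are in `I`. -/
def coeffIn (I : Ideal Q) (t : Finset σ) : Submodule Q M where
  carrier := {w | ∀ j, j.1.support ⊆ t → B.repr w j ∈ I}
  add_mem' ha hb j hj := by simpa using I.add_mem (ha j hj) (hb j hj)
  zero_mem' j _ := by simp
  smul_mem' c w hw j hj := by simpa using I.mul_mem_left c (hw j hj)

variable {B}

theorem mem_coeffIn {I : Ideal Q} {t : Finset σ} {w : M} :
    w ∈ coeffIn B I t ↔ ∀ j, j.1.support ⊆ t → B.repr w j ∈ I := Iff.rfl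

/-- Multiplication of a monomial by a variable. -/
def shift (i : σ) (j : (σ →₀ ℕ) × C) : (σ →₀ ℕ) × C := (j.1 + single i 1, j.2)

theorem shift_injective (i : σ) : Function.Injective (shift i : (σ →₀ ℕ) × C → _) := by
  rintro ⟨a, c⟩ ⟨b, e⟩ h
  simpa [shift] using h

theorem mem_range_shift {i : σ} {j : (σ →₀ ℕ) × C} (h : j.1 i ≠ 0) : ∃ j', shift i j' = j := by
  refine ⟨(j.1 - single i 1, j.2), Prod.ext ?_ rfl⟩
  exact tsub_add_cancel_of_le (Finsupp.single_le_iff.2 (Nat.one_le_iff_ne_zero.2 h))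

section variables_action

variable {X : σ → Module.End Q M} (hX : ∀ i j, X i (B j) = B (shift i j))
include hX

theorem repr_variable (i : σ) (w : M) : B.repr (X i w) = Finsupp.mapDomain (shift i) (B.repr w) := by
  have : B.repr.toLinearMap ∘ₗ X i = Finsupp.lmapDomain Q Q (shift i) ∘ₗ B.repr.toLinearMap := by
    refine B.ext fun j => ?_
    simp [hX]
  exact LinearMap.congr_fun this w

theorem repr_variable_shift (i : σ) (w : M) (j) : B.repr (X i w) (shift i j) = B.repr w j := by
  rw [repr_variable hX, Finsupp.mapDomain_apply (shift_injective i)]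

theorem repr_variable_of_eq_zero (i : σ) (w : M) (j) (h : j.1 i = 0) : B.repr (X i w) j = 0 := by
  rw [repr_variable hX, Finsupp.mapDomain_of_notMem_range]
  rintro ⟨j', rfl⟩
  simp [shift] at h

/-- `coeffIn B I t` plays the role of the submodule I·M + Σ_{l ∉ t} X_l M: working modulo it means
reducing `Q` modulo `I` and setting the variables outside `t` to zero. -/
theorem variable_mem_coeffIn (I : Ideal Q) {t : Finset σ} {i : σ} (hi : i ∉ t) (w : M) :
    X i w ∈ coeffIn B I t := by
  intro j hj
  rw [repr_variable_of_eq_zero hX]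
  · exact I.zero_mem
  · by_contra h
    exact hi (hj (Finsupp.mem_support_iff.2 h))

theorem mem_coeffIn_of_variable_mem {I : Ideal Q} {t : Finset σ} {i : σ} (hi : i ∈ t) {w : M}
    (h : X i w ∈ coeffIn B I t) : w ∈ coeffIn B I t := by
  classical
  intro j hj
  rw [← repr_variable_shift hX i]
  refine h _ fun l hl => ?_
  rcases Finset.mem_union.1 (Finsupp.support_add hl) with h | h
  · exact hj h
  · rw [Finsupp.support_single _ one_ne_zero, Finset.mem_singleton] at h
    exact h ▸ hi

/-- An operator which commutes with the variables does not lower monomials. -/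
theorem repr_eq_zero_of_commute {D : Module.End Q M} (hD : ∀ i, Commute D (X i)) (j j')
    (h : B.repr (D (B j)) j' ≠ 0) : j.1 ≤ j'.1 := by
  obtain ⟨n, hn⟩ : ∃ n, j.1.degree = n := ⟨_, rfl⟩
  induction n generalizing j j' with
  | zero =>
    rw [Finsupp.degree_eq_zero_iff] at hn
    simp [hn]
  | succ n ih =>
    obtain ⟨i, hi⟩ : ∃ i, j.1 i ≠ 0 := by
      by_contra! h0
      rw [(Finsupp.ext h0 : j.1 = 0)] at hn
      simp at hn
    obtain ⟨j₁, rfl⟩ := mem_range_shift hi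
    have hc : D (X i (B j₁)) = X i (D (B j₁)) := LinearMap.congr_fun (hD i).eq _
    rw [← hX, hc] at h
    by_cases h0 : j'.1 i = 0
    · exact (h (repr_variable_of_eq_zero hX _ _ _ h0)).elim
    obtain ⟨j₂, rfl⟩ := mem_range_shift h0
    rw [repr_variable_shift hX] at h
    simp only [shift, map_add, Finsupp.degree_single] at hn
    exact add_le_add_left (ih j₁ j₂ h (by omega)) _

theorem apply_mem_coeffIn {D : Module.End Q M} (hD : ∀ i, Commute D (X i)) {I : Ideal Q}
    {t : Finset σ} {w : M} (hw : w ∈ coeffIn B I t) : D w ∈ coeffIn B I t := by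
  intro j' hj'
  rw [← B.linearCombination_repr w, Finsupp.linearCombination_apply, Finsupp.sum, map_sum,
    map_sum, Finsupp.finsetSum_apply]
  refine I.sum_mem fun j _ => ?_
  rw [map_smul, map_smul, Finsupp.smul_apply, smul_eq_mul]
  by_cases h : B.repr (D (B j)) j' = 0
  · simp [h]
  · exact I.mul_mem_right _ (hw j ((Finsupp.support_mono
      (repr_eq_zero_of_commute hX hD j j' h)).trans hj'))

/-- An element whose coefficients at monomials in the variables of `t` are in `I` is the sum of a
multiple of `X i` and an element with coefficients in `I` at monomials in `insert i t`. -/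
theorem exists_variable_add [DecidableEq σ] {I : Ideal Q} {t : Finset σ} {w : M}
    (hw : w ∈ coeffIn B I t) (i : σ) :
    ∃ u, w - X i u ∈ coeffIn B I (insert i t) ∧
      ∀ j, B.repr u j = B.repr w (shift i j) := by
  refine ⟨B.repr.symm (Finsupp.comapDomain (shift i) (B.repr w) (shift_injective i).injOn),
    fun j hj => ?_, fun j => by simp⟩
  rw [map_sub, Finsupp.sub_apply]
  by_cases hji : j.1 i = 0
  · rw [repr_variable_of_eq_zero hX _ _ _ hji, sub_zero]
    refine hw j fun l hl => (Finset.mem_insert.1 (hj hl)).resolve_left ?_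
    rintro rfl
    exact Finsupp.mem_support_iff.1 hl hji
  · obtain ⟨j', rfl⟩ := mem_range_shift hji
    rw [repr_variable_shift hX]
    simp

end variables_action

theorem mem_coeffIn_of_smul_mem {I : Ideal Q} {t : Finset σ} {g : Q}
    (hg : ∀ q, g * q ∈ I → q ∈ I) {w : M} (h : g • w ∈ coeffIn B I t) : w ∈ coeffIn B I t :=
  fun j hj => hg _ (by simpa using h j hj)

/-- Division of coefficients by `g` modulo `I`. -/
theorem exists_smul_add {I : Ideal Q} {t : Finset σ} {g : Q} {w : M}
    (hw : w ∈ coeffIn B (I ⊔ Ideal.span {g}) t) :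
    ∃ u, w - g • u ∈ coeffIn B I t ∧ ∀ j, B.repr w j = 0 → B.repr u j = 0 := by
  classical
  have h : ∀ j, ∃ q : Q, (B.repr w j = 0 → q = 0) ∧
      (j.1.support ⊆ t → B.repr w j - g * q ∈ I) := by
    intro j
    by_cases h0 : B.repr w j = 0
    · exact ⟨0, fun _ => rfl, fun _ => by simp [h0]⟩
    by_cases hj : j.1.support ⊆ t
    · obtain ⟨a, ha, b, hb, hab⟩ := Submodule.mem_sup.1 (hw j hj)
      obtain ⟨q, rfl⟩ := Ideal.mem_span_singleton'.1 hb
      refine ⟨q, fun h => (h0 h).elim, fun _ => ?_⟩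
      rw [← hab, mul_comm g q, add_sub_cancel_right]
      exact ha
    · exact ⟨0, fun _ => rfl, fun h => (hj h).elim⟩
  choose q hq0 hq using h
  refine ⟨B.repr.symm (Finsupp.onFinset (B.repr w).support q fun j hj => ?_), fun j hj => ?_,
    fun j hj => ?_⟩
  · exact Finsupp.mem_support_iff.2 fun h => hj (hq0 j h)
  · simpa using hq j hj
  · simpa using hq0 j hj

/-- If `D ^ 2 = ∑ g i X i`, where the `g i` form a regular sequence, then `D` is exact in positive
degrees modulo the ideal generated by the `g i`. -/
theorem exists_sub_mem_coeffIn [Fintype σ] [DecidableEq σ] (deg : C → ℕ)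
    (hdeg : ∀ c, deg c ≤ Fintype.card σ)
    {X : σ → Module.End Q M} (hX : ∀ i j, X i (B j) = B (shift i j)) {D : Module.End Q M}
    (hD : ∀ i, Commute D (X i)) {g : σ → Q} (hsq : D * D = ∑ i, g i • X i)
    (hreg : ∀ (s : Finset σ) (i), i ∉ s → ∀ q, g i * q ∈ Ideal.span (g '' s) →
      q ∈ Ideal.span (g '' s))
    (hhom : ∀ m, ∀ w ∈ homogeneous B (fun j => 2 * j.1.degree + deg j.2) m,
      D w ∈ homogeneous B (fun j => 2 * j.1.degree + deg j.2) (m + 1)) (m : ℕ) (w : M)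
    (hw : w ∈ homogeneous B (fun j => 2 * j.1.degree + deg j.2) (m + 1))
    (hDw : D w ∈ coeffIn B (Ideal.span (Set.range g)) Finset.univ) :
    ∃ u ∈ homogeneous B (fun j => 2 * j.1.degree + deg j.2) m,
      w - D u ∈ coeffIn B (Ideal.span (Set.range g)) Finset.univ := by
  -- Induction on the set `s` of variables that are kept; only their `g i` are divided out. Adding a
  -- variable to `s` costs one degree, which the bound records; for `s = univ` the bound holds for
  -- every `m`.
  suffices H : ∀ (s : Finset σ) (m : ℕ), Fintype.card σ ≤ m + s.card → ∀ w ∈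
      homogeneous B (fun j => 2 * j.1.degree + deg j.2) (m + 1),
      D w ∈ coeffIn B (Ideal.span (g '' s)) s →
      ∃ u ∈ homogeneous B (fun j => 2 * j.1.degree + deg j.2) m,
        w - D u ∈ coeffIn B (Ideal.span (g '' s)) s by
    have := H Finset.univ m (by simp) w hw
    rw [Finset.coe_univ, Set.image_univ] at this
    exact this hDw
  intro s
  induction s using Finset.induction_on with
  | empty =>
    -- Without variables only degrees at most `card σ ≤ m` occur, so an element of degree `m + 1`
    -- vanishes in the quotient and 0 is a preimage.
    intro m hm w hw _
    refine ⟨0, zero_mem _, fun j hj => ?_⟩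
    by_contra h
    simp only [map_zero, sub_zero] at h
    have h0 : B.repr w j ≠ 0 := fun h' => h (h' ▸ zero_mem _)
    have h1 := mem_homogeneous.1 hw j h0
    have h2 : j.1 = 0 := Finsupp.support_eq_empty.1 (Finset.subset_empty.1 hj)
    have h3 := hdeg j.2
    simp only [h2, map_zero] at h1
    simp at hm
    omega
  | insert i s hi ih =>
    intro m hm v hv hDv
    rw [Finset.card_insert_of_notMem hi] at hm
    set I := Ideal.span (g '' s) with hI
    have hIi : Ideal.span (g '' (insert i s : Finset σ)) = I ⊔ Ideal.span {g i} := by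
      rw [Finset.coe_insert, Set.image_insert_eq, Ideal.span_insert, sup_comm]
    have hmono : ∀ {u : M}, u ∈ coeffIn B I (insert i s) →
        u ∈ coeffIn B (I ⊔ Ideal.span {g i}) (insert i s) :=
      fun hu j hj => Ideal.mem_sup_left (hu j hj)
    have hsq' : ∀ u, D (D u) - g i • X i u ∈ coeffIn B I (insert i s) := by
      intro u
      have h1 : D (D u) = ∑ l, g l • X l u := by
        simpa using LinearMap.congr_fun hsq u
      rw [h1, ← Finset.add_sum_erase _ _ (Finset.mem_univ i), add_sub_cancel_left]
      refine Submodule.sum_mem _ fun l hl => ?_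
      by_cases hls : l ∈ s
      · intro j hj
        rw [map_smul, Finsupp.smul_apply, smul_eq_mul]
        exact I.mul_mem_right _ (Ideal.subset_span ⟨l, hls, rfl⟩)
      · refine Submodule.smul_mem _ _ (variable_mem_coeffIn hX _ ?_ _)
        simp [Finset.ne_of_mem_erase hl, hls]
    rw [hIi] at hDv ⊢
    -- Here D v ≡ g_i w modulo I. Applying D and using D²v ≡ g_i X_i v gives g_i (X_i v - D w) ≡ 0,
    -- and regularity cancels g_i. Hence D w ≡ X_i v, which vanishes once X_i is set to zero, and
    -- the induction hypothesis applies to `w`, one degree higher than `v`.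
    obtain ⟨w, hw1, hw2⟩ := exists_smul_add hDv
    have hwh : w ∈ homogeneous B (fun j => 2 * j.1.degree + deg j.2) (m + 1 + 1) :=
      mem_homogeneous.2 fun j hj =>
        mem_homogeneous.1 (hhom _ v hv) j fun h => hj (hw2 j h)
    have h1 : X i v - D w ∈ coeffIn B I (insert i s) := by
      refine mem_coeffIn_of_smul_mem (hreg s i hi) ?_
      have e : g i • (X i v - D w) = D (D v - g i • w) - (D (D v) - g i • X i v) := by
        simp only [map_sub, map_smul, smul_sub]
        abel
      rw [e]
      exact Submodule.sub_mem _ (apply_mem_coeffIn hX hD hw1) (hsq' v)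
    have h2 : D w ∈ coeffIn B I s := by
      have h3 : X i v - D w ∈ coeffIn B I s :=
        fun j hj => h1 j (hj.trans (Finset.subset_insert i s))
      simpa using Submodule.sub_mem _ (variable_mem_coeffIn hX I hi v) h3
    obtain ⟨u, hu, hwu⟩ := ih (m + 1) (by omega) w hwh h2
    -- Now w ≡ D u + X_i t modulo I, so X_i (v - D t - g_i u) ≡ 0. Cancelling X_i shows v ≡ D t
    -- modulo I and g_i.
    obtain ⟨t, ht1, ht2⟩ := exists_variable_add hX hwu i
    refine ⟨t, mem_homogeneous.2 fun j hj => ?_, ?_⟩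
    · rw [ht2] at hj
      have h4 : w - D u ∈ homogeneous B (fun j => 2 * j.1.degree + deg j.2) (m + 1 + 1) :=
        Submodule.sub_mem _ hwh (hhom _ u hu)
      have h5 := mem_homogeneous.1 h4 _ hj
      simp only [shift, map_add, Finsupp.degree_single] at h5
      omega
    · have h6 : v - D t - g i • u ∈ coeffIn B I (insert i s) := by
        refine mem_coeffIn_of_variable_mem hX (Finset.mem_insert_self i s) ?_
        have hc : X i (D t) = D (X i t) := (LinearMap.congr_fun (hD i).eq t).symm
        have e : X i (v - D t - g i • u) =
            (X i v - D w) + D (w - D u - X i t) + (D (D u) - g i • X i u) := by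
          simp only [map_sub, map_smul, hc]
          abel
        rw [e]
        exact Submodule.add_mem _ (Submodule.add_mem _ h1 (apply_mem_coeffIn hX hD ht1)) (hsq' u)
      have h7 : v - D t = (v - D t - g i • u) + g i • u := by abel
      rw [h7]
      refine Submodule.add_mem _ (hmono h6) fun j _ => ?_
      rw [map_smul, Finsupp.smul_apply, smul_eq_mul]
      exact Ideal.mem_sup_right (Ideal.mul_mem_right _ _ (Ideal.mem_span_singleton_self _))

end MatrixFactorization
end

/-! ### Regular sequences in group rings of abelian groups -/

noncomputable section


namespace MonoidAlgebra

variable {k L U σ : Type} [Field k] [CommGroup L] [CommGroup U]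

/-- The elements a with a - 1 ∈ I form a subgroup, by ab - 1 = a(b - 1) + (a - 1). -/
theorem single_sub_one_mem_of_mem_closure {I : Ideal (MonoidAlgebra k L)} {S : Set L}
    (hI : ∀ a ∈ S, single a (1 : k) - 1 ∈ I) {a : L} (ha : a ∈ Subgroup.closure S) :
    single a (1 : k) - 1 ∈ I := by
  induction ha using Subgroup.closure_induction with
  | mem a ha => exact hI a ha
  | one => simp [← one_def]
  | mul a b _ _ ha hb =>
    have e : single (a * b) (1 : k) - 1 =
        single a 1 * (single b 1 - 1) + (single a 1 - 1) := by
      rw [mul_sub, single_mul_single]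
      simp
    rw [e]
    exact I.add_mem (I.mul_mem_left _ hb) ha
  | inv a _ ha =>
    have e : single a⁻¹ (1 : k) - 1 = -single a⁻¹ 1 * (single a 1 - 1) := by
      rw [neg_mul, mul_sub, single_mul_single]
      simp [← one_def]
    rw [e]
    exact I.mul_mem_left _ ha

/-- The kernel of the homomorphism of group rings defined by a homomorphism of groups is generated
by the elements `a - 1`, where `a` runs through generators of the kernel. -/
theorem mem_of_mapDomain_eq_zero {I : Ideal (MonoidAlgebra k L)} {S : Set L}
    (hI : ∀ a ∈ S, single a (1 : k) - 1 ∈ I) (r : L →* U) (hr : r.ker ≤ Subgroup.closure S)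
    {f : MonoidAlgebra k L} (hf : mapDomain r f = 0) : f ∈ I := by
  -- `τ` picks one representative in each fibre of `r`. Modulo `I` an element equals its
  -- push-forward along `τ`, and that push-forward depends only on the image under `r`.
  let τ : L → L := fun a => Function.invFun r (r a)
  have hτ : ∀ a, single a (1 : k) - single (τ a) 1 ∈ I := by
    intro a
    have h1 : a / τ a ∈ r.ker := by
      have h2 : r (τ a) = r a := Function.invFun_eq (f := r) ⟨a, rfl⟩
      rw [MonoidHom.mem_ker, map_div, h2, div_self']
    have e : single a (1 : k) - single (τ a) 1 = single (τ a) 1 * (single (a / τ a) 1 - 1) := by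
      rw [mul_sub, single_mul_single]
      simp
    rw [e]
    exact I.mul_mem_left _ (single_sub_one_mem_of_mem_closure hI (hr h1))
  have key : ∀ f : MonoidAlgebra k L, f - mapDomain τ f ∈ I := by
    intro f
    induction f using MonoidAlgebra.induction_linear with
    | zero => simp
    | add f g hf hg =>
      rw [mapDomain_add, add_sub_add_comm]
      exact I.add_mem hf hg
    | single a c =>
      have e : single a c - mapDomain τ (single a c) =
          single 1 c * (single a 1 - single (τ a) 1) := by
        rw [mul_sub, single_mul_single, single_mul_single, mapDomain_single]
        simp
      rw [e]
      exact I.mul_mem_left _ (hτ a)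
  have h0 : mapDomain τ f = mapDomain (Function.invFun r) (mapDomain r f) := by
    ext a
    simp only [coeff_mapDomain, τ, ← Finsupp.mapDomain_comp]
    rfl
  have := key f
  rwa [h0, hf, mapDomain_zero, sub_zero] at this

/-- The coefficients of such an `f` are invariant under translation by an element of infinite order,
which contradicts finite support unless f = 0. -/
theorem eq_zero_of_single_sub_one_mul_eq_zero {a : U} (ha : ∀ m : ℤ, a ^ m = 1 → m = 0)
    {f : MonoidAlgebra k U} (h : (single a (1 : k) - 1) * f = 0) : f = 0 := by
  have h1 : ∀ b, f.coeff (a⁻¹ * b) = f.coeff b := by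
    intro b
    have := congrArg (fun f : MonoidAlgebra k U => f.coeff b) h
    simpa [sub_mul, coeff_single_mul_apply, sub_eq_zero] using this
  have h2 : ∀ (m : ℕ) b, f.coeff (a ^ m * b) = f.coeff b := by
    intro m
    induction m with
    | zero => simp
    | succ m ih =>
      intro b
      rw [← ih b, ← h1 (a ^ (m + 1) * b)]
      congr 1
      group
  by_contra hf
  obtain ⟨b, hb⟩ : ∃ b, f.coeff b ≠ 0 := by
    by_contra! h
    exact hf (by ext b; simpa using h b)
  have hinj : Function.Injective fun m : ℕ => a ^ m * b := by
    intro m m' hm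
    have hm : a ^ m = a ^ m' := mul_right_cancel hm
    have := ha (m - m') (by rw [zpow_sub, zpow_natCast, zpow_natCast, hm, mul_inv_cancel])
    omega
  refine Set.infinite_range_of_injective hinj (f.coeff.support.finite_toSet.subset ?_)
  rintro _ ⟨m, rfl⟩
  simpa [h2] using hb

/-- The differences of the group elements `a i` and `b i` form a regular sequence if the quotients
`a i / b i` are independent. -/
theorem mem_span_of_mul_mem_span (a b : σ → L)
    (hn : ∀ (s : Finset σ) (i), i ∉ s → ∀ m : ℤ,
      (a i / b i) ^ m ∈ Subgroup.closure ((fun l => a l / b l) '' s) → m = 0)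
    (s : Finset σ) (i : σ) (hi : i ∉ s) (f : MonoidAlgebra k L)
    (hf : (single (a i) (1 : k) - single (b i) 1) * f ∈
      Ideal.span ((fun l => single (a l) (1 : k) - single (b l) 1) '' s)) :
    f ∈ Ideal.span ((fun l => single (a l) (1 : k) - single (b l) 1) '' s) := by
  set S := (fun l => a l / b l) '' s with hS
  set I := Ideal.span ((fun l => single (a l) (1 : k) - single (b l) 1) '' s) with hI
  let r : L →* L ⧸ Subgroup.closure S := QuotientGroup.mk' _
  let ρ : MonoidAlgebra k L →+* MonoidAlgebra k (L ⧸ Subgroup.closure S) := mapDomainRingHom k r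
  have hρ : ∀ f, ρ f = mapDomain r f := fun f => rfl
  have e : ∀ l, single (a l) (1 : k) - single (b l) 1 =
      single (b l) 1 * (single (a l / b l) 1 - 1) := by
    intro l
    rw [mul_sub, single_mul_single]
    simp
  have h1 : ∀ c ∈ S, single c (1 : k) - 1 ∈ I := by
    rintro _ ⟨l, hl, rfl⟩
    have h2 : single (a l / b l) (1 : k) - 1 =
        single (b l)⁻¹ 1 * (single (a l) 1 - single (b l) 1) := by
      rw [e, ← mul_assoc, single_mul_single]
      simp [← one_def]
    simp only [h2]
    exact I.mul_mem_left _ (Ideal.subset_span ⟨l, hl, rfl⟩)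
  have h2 : I ≤ RingHom.ker ρ := by
    rw [hI, Ideal.span_le]
    rintro _ ⟨l, hl, rfl⟩
    have hl' : r (a l) = r (b l) := by
      rw [← div_eq_one, ← map_div]
      exact (QuotientGroup.eq_one_iff _).2 (Subgroup.subset_closure ⟨l, hl, rfl⟩)
    change ρ (single (a l) (1 : k) - single (b l) 1) = 0
    rw [map_sub, hρ, hρ, mapDomain_single, mapDomain_single, hl', sub_self]
  -- The ideal `I` is the kernel of the passage to the group ring of L modulo the quotients indexed
  -- by `s`. In that group a_i / b_i still has infinite order, so a_i - b_i is a non-zero-divisor.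
  refine mem_of_mapDomain_eq_zero h1 r (by simp [r]) ?_
  rw [← hρ]
  have h3 : (single (r (a i / b i)) (1 : k) - 1) * ρ f = 0 := by
    have h4 : ρ ((single (a i) (1 : k) - single (b i) 1) * f) = 0 := h2 hf
    rw [e, map_mul, map_mul, map_sub, map_one, hρ, hρ, mapDomain_single, mapDomain_single] at h4
    have h5 := congrArg (fun f => single (r (b i))⁻¹ (1 : k) * f) h4
    simp only [← mul_assoc, single_mul_single] at h5
    simpa [← one_def] using h5
  refine eq_zero_of_single_sub_one_mul_eq_zero (fun m hm => hn s i hi m ?_) h3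
  rw [← map_zpow] at hm
  exact (QuotientGroup.eq_one_iff _).1 hm

end MonoidAlgebra
end

/-! ### Operators on Sym V ⊗ ΛV and its grading -/

noncomputable section

open scoped TensorProduct

/-- The tensor product of the symmetric and the exterior algebra of `V`. -/
abbrev SymExt (k V : Type) [Field k] [AddCommGroup V] [Module k V] : Type :=
  SymmetricAlgebra k V ⊗[k] ExteriorAlgebra k V

namespace SymExt

variable {k V : Type} [Field k] [AddCommGroup V] [Module k V]

/-- Multiplication by a vector in the exterior algebra. -/
def wedge : V →ₗ[k] Module.End k (SymExt k V) :=
  LinearMap.lTensorHom _ ∘ₗ LinearMap.mul k (ExteriorAlgebra k V) ∘ₗ ExteriorAlgebra.ι k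

/-- Multiplication by a vector in the symmetric algebra. -/
def times : V →ₗ[k] Module.End k (SymExt k V) :=
  LinearMap.rTensorHom _ ∘ₗ LinearMap.mul k (SymmetricAlgebra k V) ∘ₗ SymmetricAlgebra.ι k V

/-- Contraction with a linear form in the exterior algebra. -/
def contract : Module.Dual k V →ₗ[k] Module.End k (SymExt k V) :=
  LinearMap.lTensorHom _ ∘ₗ CliffordAlgebra.contractLeft (Q := (0 : QuadraticForm k V))

theorem wedge_tmul (v : V) (a : SymmetricAlgebra k V) (b : ExteriorAlgebra k V) :
    wedge v (a ⊗ₜ b) = a ⊗ₜ (ExteriorAlgebra.ι k v * b) := rfl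

theorem times_tmul (v : V) (a : SymmetricAlgebra k V) (b : ExteriorAlgebra k V) :
    times v (a ⊗ₜ b) = (SymmetricAlgebra.ι k V v * a) ⊗ₜ b := rfl

theorem contract_tmul (ξ : Module.Dual k V) (a : SymmetricAlgebra k V)
    (b : ExteriorAlgebra k V) :
    contract ξ (a ⊗ₜ b) = a ⊗ₜ CliffordAlgebra.contractLeft (Q := (0 : QuadraticForm k V)) ξ b :=
  rfl

theorem wedge_mul_wedge_add (v w : V) : wedge (k := k) v * wedge w + wedge w * wedge v = 0 := by
  refine TensorProduct.ext' fun a b => ?_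
  simp only [LinearMap.add_apply, Module.End.mul_apply, wedge_tmul, LinearMap.zero_apply]
  rw [← TensorProduct.tmul_add, ← mul_assoc, ← mul_assoc, ← add_mul,
    ExteriorAlgebra.ι_add_mul_swap, zero_mul, TensorProduct.tmul_zero]

theorem wedge_mul_self (v : V) : wedge (k := k) v * wedge v = 0 := by
  refine TensorProduct.ext' fun a b => ?_
  simp only [Module.End.mul_apply, wedge_tmul, LinearMap.zero_apply]
  rw [← mul_assoc, ExteriorAlgebra.ι_sq_zero, zero_mul, TensorProduct.tmul_zero]

theorem contract_mul_contract_add (ξ η : Module.Dual k V) :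
    contract ξ * contract η + contract η * contract ξ = 0 := by
  refine TensorProduct.ext' fun a b => ?_
  simp only [LinearMap.add_apply, Module.End.mul_apply, contract_tmul, LinearMap.zero_apply]
  rw [← TensorProduct.tmul_add, CliffordAlgebra.contractLeft_comm, neg_add_cancel,
    TensorProduct.tmul_zero]

theorem contract_mul_self (ξ : Module.Dual k V) : contract ξ * contract ξ = 0 := by
  refine TensorProduct.ext' fun a b => ?_
  simp only [Module.End.mul_apply, contract_tmul, LinearMap.zero_apply]
  rw [CliffordAlgebra.contractLeft_contractLeft, TensorProduct.tmul_zero]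

theorem contract_mul_wedge_add (ξ : Module.Dual k V) (v : V) :
    contract ξ * wedge v + wedge v * contract ξ = ξ v • 1 := by
  refine TensorProduct.ext' fun a b => ?_
  simp only [LinearMap.add_apply, Module.End.mul_apply, contract_tmul, wedge_tmul,
    LinearMap.smul_apply, Module.End.one_apply]
  have h := CliffordAlgebra.contractLeft_ι_mul (Q := (0 : QuadraticForm k V)) (d := ξ) v b
  rw [← TensorProduct.tmul_add, ← TensorProduct.tmul_smul]
  congr 1
  refine (congrArg (· + _) h).trans ?_
  exact sub_add_cancel _ _

theorem commute_times_wedge (v w : V) : Commute (times (k := k) v) (wedge w) := by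
  refine TensorProduct.ext' fun a b => ?_
  simp only [Module.End.mul_apply, times_tmul, wedge_tmul]

theorem commute_times_contract (v : V) (ξ : Module.Dual k V) :
    Commute (times v) (contract ξ) := by
  refine TensorProduct.ext' fun a b => ?_
  simp only [Module.End.mul_apply, times_tmul, contract_tmul]

theorem commute_times_times (v w : V) : Commute (times (k := k) v) (times w) := by
  refine TensorProduct.ext' fun a b => ?_
  simp only [Module.End.mul_apply, times_tmul, mul_left_comm]

/-- The functoriality of `SymExt k V`. -/
def map (f : V →ₗ[k] V) : Module.End k (SymExt k V) :=
  TensorProduct.map (SymmetricAlgebra.lift (SymmetricAlgebra.ι k V ∘ₗ f)).toLinearMap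
    (ExteriorAlgebra.map f).toLinearMap

theorem map_tmul (f : V →ₗ[k] V) (a : SymmetricAlgebra k V) (b : ExteriorAlgebra k V) :
    map f (a ⊗ₜ b) =
      SymmetricAlgebra.lift (SymmetricAlgebra.ι k V ∘ₗ f) a ⊗ₜ ExteriorAlgebra.map f b := rfl

theorem map_one (f : V →ₗ[k] V) : map f 1 = 1 := by
  rw [Algebra.TensorProduct.one_def, map_tmul, _root_.map_one, _root_.map_one]

theorem map_id : map (LinearMap.id : V →ₗ[k] V) = 1 := by
  refine TensorProduct.ext' fun a b => ?_
  rw [map_tmul, ExteriorAlgebra.map_id, LinearMap.comp_id, SymmetricAlgebra.lift_ι]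
  rfl

theorem map_comp (f g : V →ₗ[k] V) : map (f ∘ₗ g) = map f * map g := by
  refine TensorProduct.ext' fun a b => ?_
  rw [Module.End.mul_apply, map_tmul, map_tmul, map_tmul, ← ExteriorAlgebra.map_comp_map]
  congr 1
  have : SymmetricAlgebra.lift (SymmetricAlgebra.ι k V ∘ₗ f ∘ₗ g) =
      (SymmetricAlgebra.lift (SymmetricAlgebra.ι k V ∘ₗ f)).comp
        (SymmetricAlgebra.lift (SymmetricAlgebra.ι k V ∘ₗ g)) := by
    refine SymmetricAlgebra.algHom_ext (LinearMap.ext fun v => ?_)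
    simp
  rw [this]
  rfl

theorem map_mul_wedge (f : V →ₗ[k] V) (v : V) : map f * wedge v = wedge (f v) * map f := by
  refine TensorProduct.ext' fun a b => ?_
  rw [Module.End.mul_apply, Module.End.mul_apply, wedge_tmul, map_tmul, map_tmul, wedge_tmul,
    map_mul, ExteriorAlgebra.map_apply_ι]

theorem map_mul_times (f : V →ₗ[k] V) (v : V) : map f * times v = times (f v) * map f := by
  refine TensorProduct.ext' fun a b => ?_
  rw [Module.End.mul_apply, Module.End.mul_apply, times_tmul, map_tmul, map_tmul, times_tmul,
    map_mul, SymmetricAlgebra.lift_ι_apply]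
  rfl

/-- Both sides satisfy the same recursion when a vector is multiplied on the left in the exterior
algebra, since f transposes to ξ ∘ f. -/
theorem map_mul_contract (f : V →ₗ[k] V) (ξ : Module.Dual k V) :
    map f * contract (ξ ∘ₗ f) = contract ξ * map f := by
  refine TensorProduct.ext' fun a b => ?_
  rw [Module.End.mul_apply, Module.End.mul_apply, contract_tmul, map_tmul, map_tmul, contract_tmul]
  congr 1
  induction b using CliffordAlgebra.left_induction with
  | algebraMap r =>
    rw [CliffordAlgebra.contractLeft_algebraMap, map_zero]
    have := (ExteriorAlgebra.map f).commutes r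
    exact ((congrArg _ this).trans (CliffordAlgebra.contractLeft_algebraMap (Q := (0 : QuadraticForm k V))
      ξ r)).symm
  | add x y hx hy =>
    exact (congrArg _ (_root_.map_add _ x y)).trans ((_root_.map_add _ _ _).trans
      ((congrArg₂ _ hx hy).trans ((_root_.map_add _ _ _).symm.trans
        (congrArg _ (_root_.map_add (ExteriorAlgebra.map f) x y).symm))))
  | ι_mul x m hx =>
    rw [CliffordAlgebra.contractLeft_ι_mul]
    have h1 : ExteriorAlgebra.map f (CliffordAlgebra.ι 0 m * x) =
        CliffordAlgebra.ι 0 (f m) * ExteriorAlgebra.map f x :=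
      (map_mul _ _ _).trans (congrArg (· * _) (ExteriorAlgebra.map_apply_ι f m))
    have h2 : ∀ y, ExteriorAlgebra.map f (CliffordAlgebra.ι 0 m * y) =
        CliffordAlgebra.ι 0 (f m) * ExteriorAlgebra.map f y := fun y =>
      (map_mul _ _ _).trans (congrArg (· * _) (ExteriorAlgebra.map_apply_ι f m))
    rw [h1, CliffordAlgebra.contractLeft_ι_mul, ← hx, ← h2]
    exact (_root_.map_sub (ExteriorAlgebra.map f) _ _).trans (congrArg₂ _ (_root_.map_smul _ _ _) rfl)

/-- Monomials in elements of `V`, of degree one in the exterior algebra and of degree two in the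
symmetric algebra. -/
inductive IsMonomial : ℕ → SymExt k V → Prop
  | one : IsMonomial 0 1
  | wedge {m w} (v : V) : IsMonomial m w → IsMonomial (m + 1) (SymExt.wedge v w)
  | times {m w} (v : V) : IsMonomial m w → IsMonomial (m + 2) (SymExt.times v w)

variable (k V) in
/-- The homogeneous elements of degree `m`. -/
def graded (m : ℕ) : Submodule k (SymExt k V) := Submodule.span k {w | IsMonomial m w}

theorem mem_graded_of_forall {m n : ℕ} (T : Module.End k (SymExt k V))
    (h : ∀ w, IsMonomial m w → T w ∈ graded k V n) {w : SymExt k V} (hw : w ∈ graded k V m) :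
    T w ∈ graded k V n := by
  have : graded k V m ≤ (graded k V n).comap T := Submodule.span_le.2 h
  exact this hw

theorem one_mem_graded : (1 : SymExt k V) ∈ graded k V 0 := Submodule.subset_span .one

theorem graded_zero : graded k V 0 = Submodule.span k {1} := by
  rw [graded]
  congr 1
  ext w
  refine ⟨fun h => ?_, ?_⟩
  · change IsMonomial 0 w at h
    generalize hm : 0 = m at h
    cases h <;> first | rfl | omega
  · rintro rfl
    exact .one

theorem wedge_mem_graded (v : V) {m : ℕ} {w : SymExt k V} (hw : w ∈ graded k V m) :
    wedge v w ∈ graded k V (m + 1) :=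
  mem_graded_of_forall _ (fun _ h => Submodule.subset_span (.wedge v h)) hw

theorem times_mem_graded (v : V) {m : ℕ} {w : SymExt k V} (hw : w ∈ graded k V m) :
    times v w ∈ graded k V (m + 2) :=
  mem_graded_of_forall _ (fun _ h => Submodule.subset_span (.times v h)) hw

theorem contract_one (ξ : Module.Dual k V) : contract ξ 1 = 0 := by
  rw [Algebra.TensorProduct.one_def, contract_tmul]
  refine (congrArg _ (CliffordAlgebra.contractLeft_one (Q := (0 : QuadraticForm k V)) ξ)).trans ?_
  exact TensorProduct.tmul_zero _ _

theorem contract_eq_zero (ξ : Module.Dual k V) {w : SymExt k V} (hw : w ∈ graded k V 0) :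
    contract ξ w = 0 := by
  rw [graded_zero, Submodule.mem_span_singleton] at hw
  obtain ⟨c, rfl⟩ := hw
  rw [map_smul, contract_one, smul_zero]

theorem contract_wedge (ξ : Module.Dual k V) (v : V) (w : SymExt k V) :
    contract ξ (wedge v w) = ξ v • w - wedge v (contract ξ w) := by
  rw [eq_sub_iff_add_eq]
  simpa using LinearMap.congr_fun (contract_mul_wedge_add ξ v) w

theorem contract_times (ξ : Module.Dual k V) (v : V) (w : SymExt k V) :
    contract ξ (times v w) = times v (contract ξ w) :=
  (LinearMap.congr_fun (commute_times_contract v ξ).eq w).symm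

/-- Contraction lowers the degree by one and the symmetric multiplication raises it by two. As
degrees are natural numbers, the case where the contraction is zero, in particular degree 0, is
treated apart. -/
theorem times_contract_mem_graded (v : V) (ξ : Module.Dual k V) {m : ℕ} {w : SymExt k V}
    (hw : w ∈ graded k V m) : times v (contract ξ w) ∈ graded k V (m + 1) := by
  have key : ∀ m w, IsMonomial m w → contract ξ w = 0 ∨ ∃ n, n + 1 = m ∧
      contract ξ w ∈ graded k V n := by
    intro m w h
    induction h with
    | one => exact .inl (contract_one ξ)
    | @wedge m w u h ih =>
      refine .inr ⟨m, rfl, ?_⟩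
      rw [contract_wedge]
      refine Submodule.sub_mem _ (Submodule.smul_mem _ _ (Submodule.subset_span h)) ?_
      rcases ih with ih | ⟨n, rfl, hn⟩
      · simp [ih]
      · exact wedge_mem_graded u hn
    | @times m w u h ih =>
      refine .inr ⟨m + 1, rfl, ?_⟩
      rw [contract_times]
      rcases ih with ih | ⟨n, rfl, hn⟩
      · simp [ih]
      · exact times_mem_graded u hn
  refine mem_graded_of_forall (times v * contract ξ) (fun w hw => ?_) hw
  rw [Module.End.mul_apply]
  rcases key m w hw with h | ⟨n, rfl, hn⟩
  · simp [h]
  · exact times_mem_graded v hn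

theorem map_mem_graded (f : V →ₗ[k] V) {m : ℕ} {w : SymExt k V} (hw : w ∈ graded k V m) :
    map f w ∈ graded k V m := by
  refine mem_graded_of_forall _ (fun w hw => Submodule.subset_span ?_) hw
  clear * - hw
  change IsMonomial m (map f w)
  induction hw with
  | one => rw [map_one]; exact .one
  | @wedge m w v _ ih =>
    rw [← Module.End.mul_apply, map_mul_wedge]
    exact .wedge _ ih
  | @times m w v _ ih =>
    rw [← Module.End.mul_apply, map_mul_times]
    exact .times _ ih

theorem symmetricAlgebra_zero {σ : Type} (b : Module.Basis σ k V) :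
    b.symmetricAlgebra (0 : σ →₀ ℕ) = 1 := by
  simp only [Module.Basis.symmetricAlgebra, Module.Basis.map_apply,
    MvPolynomial.coe_basisMonomials, AlgEquiv.toLinearEquiv_apply]
  exact _root_.map_one _

theorem symmetricAlgebra_add_single {σ : Type} (b : Module.Basis σ k V) (i : σ) (α : σ →₀ ℕ) :
    b.symmetricAlgebra (α + Finsupp.single i 1) =
      SymmetricAlgebra.ι k V (b i) * b.symmetricAlgebra α := by
  simp only [Module.Basis.symmetricAlgebra, Module.Basis.map_apply,
    MvPolynomial.coe_basisMonomials, AlgEquiv.toLinearEquiv_apply]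
  rw [← SymmetricAlgebra.equivMvPolynomial_symm_X, ← map_mul]
  congr 1
  rw [MvPolynomial.X, MvPolynomial.monomial_mul, one_mul, add_comm]

section basis

variable {σ : Type} [LinearOrder σ] (b : Module.Basis σ k V)

/-- The basis of `SymExt k V` formed by monomials in the vectors of a basis of `V`. -/
def basis : Module.Basis ((σ →₀ ℕ) × Finset σ) k (SymExt k V) :=
  b.symmetricAlgebra.tensorProduct b.ExteriorAlgebra

theorem basis_apply (α : σ →₀ ℕ) (c : Finset σ) :
    basis b (α, c) = b.symmetricAlgebra α ⊗ₜ b.ExteriorAlgebra c := by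
  simp [basis]

theorem times_basis (i : σ) (j : (σ →₀ ℕ) × Finset σ) :
    times (b i) (basis b j) = basis b (MatrixFactorization.shift i j) := by
  obtain ⟨α, c⟩ := j
  rw [basis_apply, MatrixFactorization.shift, basis_apply, times_tmul, symmetricAlgebra_add_single]

theorem exteriorAlgebra_mem (c : Finset σ) : b.ExteriorAlgebra c ∈ ⋀[k]^(c.card) V := by
  rw [ExteriorAlgebra.basis_eq_coe_basis b (⟨c, rfl⟩ : Set.powersetCard σ c.card)]
  exact Subtype.property _

theorem tmul_mem_homogeneous (α : σ →₀ ℕ) {n : ℕ} {x : ExteriorAlgebra k V}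
    (hx : x ∈ ⋀[k]^n V) : b.symmetricAlgebra α ⊗ₜ x ∈ MatrixFactorization.homogeneous (basis b)
      (fun j => 2 * j.1.degree + j.2.card) (2 * α.degree + n) := by
  have h := (b.exteriorPower n).linearCombination_repr ⟨x, hx⟩
  have h1 := congrArg (fun y : ⋀[k]^n V => (y : ExteriorAlgebra k V)) h
  simp only [Finsupp.linearCombination_apply, Finsupp.sum, AddSubmonoidClass.coe_finsetSum,
    Submodule.coe_smul, ← ExteriorAlgebra.basis_eq_coe_basis] at h1
  rw [← h1, TensorProduct.tmul_sum]
  refine Submodule.sum_mem _ fun s _ => ?_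
  rw [TensorProduct.tmul_smul, ← basis_apply, MatrixFactorization.homogeneous_eq_span]
  refine Submodule.smul_mem _ _ (Submodule.subset_span ⟨_, ?_, rfl⟩)
  simp

theorem basis_mem_graded (j : (σ →₀ ℕ) × Finset σ) :
    basis b j ∈ graded k V (2 * j.1.degree + j.2.card) := by
  obtain ⟨n, hn⟩ : ∃ n, j.1.degree = n := ⟨_, rfl⟩
  induction n generalizing j with
  | zero =>
    obtain ⟨α, c⟩ := j
    rw [Finsupp.degree_eq_zero_iff] at hn
    subst hn
    have h1 : ∀ (n : ℕ), ∀ x ∈ ⋀[k]^n V, (1 : SymmetricAlgebra k V) ⊗ₜ x ∈ graded k V n := by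
      intro n x hx
      induction hx using Submodule.pow_induction_on_left' with
      | algebraMap r =>
        rw [Algebra.algebraMap_eq_smul_one, TensorProduct.tmul_smul]
        exact Submodule.smul_mem _ _ one_mem_graded
      | add x y i hx hy ihx ihy =>
        rw [TensorProduct.tmul_add]
        exact Submodule.add_mem _ ihx ihy
      | mem_mul m hm i x hx ihx =>
        obtain ⟨v, rfl⟩ := hm
        exact wedge_mem_graded v ihx
    rw [basis_apply, symmetricAlgebra_zero]
    simp only [map_zero, mul_zero, zero_add]
    exact h1 _ _ (exteriorAlgebra_mem b c)
  | succ n ih =>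
    obtain ⟨i, hi⟩ : ∃ i, j.1 i ≠ 0 := by
      by_contra! h0
      rw [(Finsupp.ext h0 : j.1 = 0)] at hn
      simp at hn
    obtain ⟨j₁, rfl⟩ := MatrixFactorization.mem_range_shift hi
    rw [← times_basis]
    simp only [MatrixFactorization.shift, _root_.map_add, Finsupp.degree_single] at hn ⊢
    convert times_mem_graded (b i) (ih j₁ (by omega)) using 2
    omega

/-- The spanning set of `graded` makes stability under linear maps of V evident, while the matrix
factorization argument needs a grading by a monomial basis; this identifies the two. -/
theorem graded_eq_homogeneous (m : ℕ) :
    graded k V m = MatrixFactorization.homogeneous (basis b)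
      (fun j => 2 * j.1.degree + j.2.card) m := by
  refine le_antisymm (Submodule.span_le.2 fun w hw => ?_) ?_
  · have key : ∀ (T : Module.End k (SymExt k V)) (a : ℕ),
        (∀ j, T (basis b j) ∈ MatrixFactorization.homogeneous (basis b)
          (fun j => 2 * j.1.degree + j.2.card) (2 * j.1.degree + j.2.card + a)) →
        ∀ m w, w ∈ MatrixFactorization.homogeneous (basis b)
          (fun j => 2 * j.1.degree + j.2.card) m →
        T w ∈ MatrixFactorization.homogeneous (basis b)
          (fun j => 2 * j.1.degree + j.2.card) (m + a) := by
      intro T a h m w hw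
      rw [MatrixFactorization.homogeneous_eq_span] at hw
      have hle : Submodule.span k (basis b '' {j | 2 * j.1.degree + j.2.card = m}) ≤
          (MatrixFactorization.homogeneous (basis b)
            (fun j => 2 * j.1.degree + j.2.card) (m + a)).comap T := by
        rw [Submodule.span_le]
        rintro _ ⟨j, rfl, rfl⟩
        exact h j
      exact hle hw
    change IsMonomial m w at hw
    change w ∈ MatrixFactorization.homogeneous (basis b) _ m
    induction hw with
    | one =>
      have h1 : (1 : ExteriorAlgebra k V) ∈ ⋀[k]^0 V := by simp
      have := tmul_mem_homogeneous b 0 h1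
      rwa [symmetricAlgebra_zero, map_zero, mul_zero, zero_add,
        ← Algebra.TensorProduct.one_def] at this
    | @wedge m w v _ ih =>
      refine key (wedge v) 1 (fun j => ?_) m w ih
      rw [show j = (j.1, j.2) from rfl, basis_apply, wedge_tmul, add_assoc]
      refine tmul_mem_homogeneous b _ ?_
      rw [add_comm, ExteriorAlgebra.exteriorPower, pow_add, pow_one]
      exact Submodule.mul_mem_mul ⟨v, rfl⟩ (exteriorAlgebra_mem b _)
    | @times m w v _ ih =>
      refine key (times v) 2 (fun j => ?_) m w ih
      rw [← b.linearCombination_repr v, Finsupp.linearCombination_apply, Finsupp.sum, map_sum,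
        LinearMap.sum_apply]
      refine Submodule.sum_mem _ fun i _ => ?_
      rw [map_smul, LinearMap.smul_apply, times_basis, MatrixFactorization.homogeneous_eq_span]
      refine Submodule.smul_mem _ _ (Submodule.subset_span ⟨_, ?_, rfl⟩)
      simp [MatrixFactorization.shift]
      ring
  · rw [MatrixFactorization.homogeneous_eq_span, Submodule.span_le]
    rintro _ ⟨j, rfl, rfl⟩
    exact basis_mem_graded b j

include b in
theorem finite_graded [Finite σ] (m : ℕ) : Module.Finite k (graded k V m) := by
  rw [graded_eq_homogeneous b, MatrixFactorization.homogeneous_eq_span]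
  refine Module.Finite.span_of_finite k (Set.Finite.image _ ?_)
  refine ((Finsupp.finite_of_degree_le m).prod (Set.toFinite (Set.univ : Set (Finset σ)))).subset ?_
  rintro ⟨α, c⟩ h
  simp only [Set.mem_ofPred_eq] at h
  simp only [Set.mem_prod, Set.mem_ofPred_eq, Set.mem_univ, and_true]
  omega

end basis

end SymExt
end

/-! ### The twisted Koszul differential and its square -/

noncomputable section

open scoped TensorProduct

/-- The square of a sum of anticommuting elements of square zero is zero. -/
theorem sum_mul_sum_eq_zero_of_anticommute {ι A : Type} [Fintype ι] [Ring A] (a : ι → A)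
    (h0 : ∀ i, a i * a i = 0) (h : ∀ i j, a i * a j + a j * a i = 0) :
    (∑ i, a i) * ∑ i, a i = 0 := by
  classical
  have : ∀ s : Finset ι, (∑ i ∈ s, a i) * ∑ i ∈ s, a i = 0 := by
    intro s
    induction s using Finset.induction_on with
    | empty => simp
    | insert i s hi ih =>
      have h1 : a i * ∑ j ∈ s, a j + (∑ j ∈ s, a j) * a i = 0 := by
        rw [Finset.mul_sum, Finset.sum_mul, ← Finset.sum_add_distrib]
        exact Finset.sum_eq_zero fun j _ => h i j
      rw [Finset.sum_insert hi, add_mul, mul_add, mul_add, h0, ih, zero_add, add_zero, h1]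
  exact this _

theorem SymExt.times_contract_mul {k V : Type} [Field k] [AddCommGroup V] [Module k V] (v w : V)
    (ξ η : Module.Dual k V) : times v * contract ξ * (times w * contract η) =
      times v * times w * (contract ξ * contract η) := by
  rw [mul_assoc, ← mul_assoc (contract ξ), ← (commute_times_contract w ξ).eq]
  simp only [mul_assoc]

/-- A representation `V` of `P` with a family of vectors `e h` and a family of linear forms `ev h`,
both permuted by `P`, such that `ev x (e h)` is the difference of the Kronecker symbols of `h` and
`x` and of `h` and `x ψ`. The forms `ev (l i)` are the coordinates of a basis. -/
structure DifferenceSystem (k P V σ : Type) [Field k] [CommGroup P] [DecidableEq P]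
    [AddCommGroup V] [Module k V] where
  ρ : Representation k P V
  ψ : P
  e : P → V
  ev : P → Module.Dual k V
  l : σ → P
  basis : Module.Basis σ k V
  ρ_e : ∀ g h, ρ g (e h) = e (g * h)
  ev_ρ : ∀ g h, ev (g * h) ∘ₗ ρ g = ev h
  ev_e : ∀ x h, ev x (e h) = (if h = x then 1 else 0) - (if h = x * ψ then 1 else 0)
  basis_repr : ∀ i v, basis.repr v i = ev (l i) v

namespace DifferenceSystem

open SymExt

variable {k P V σ : Type} [Field k] [CommGroup P] [DecidableEq P]
    [AddCommGroup V] [Module k V] [Fintype P] [Fintype σ] (𝒟 : DifferenceSystem k P V σ)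

omit [Fintype σ] in
theorem sum_ev_e_smul {W : Type} [AddCommGroup W] [Module k W] (q : P → W) (x : P) :
    ∑ h, 𝒟.ev x (𝒟.e h) • q h = q x - q (x * 𝒟.ψ) := by
  simp [𝒟.ev_e, sub_smul, Finset.sum_sub_distrib]

/-- Expand each `e h` in the basis: its coordinates are the pairings with `ev (l i)`, so the
coefficient of the i-th basis vector collapses to a single difference of values of `q`. -/
theorem sum_tmul_e {W : Type} [AddCommGroup W] [Module k W] (q : P → W) :
    ∑ h, q h ⊗ₜ[k] 𝒟.e h =
      ∑ i, (q (𝒟.l i) - q (𝒟.l i * 𝒟.ψ)) ⊗ₜ[k] 𝒟.basis i := by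
  simp only [← 𝒟.sum_ev_e_smul, TensorProduct.sum_tmul, TensorProduct.smul_tmul]
  rw [Finset.sum_comm]
  refine Finset.sum_congr rfl fun h _ => ?_
  rw [← TensorProduct.tmul_sum]
  congr 1
  conv_lhs => rw [← 𝒟.basis.sum_repr (𝒟.e h)]
  simp only [𝒟.basis_repr]

theorem sum_e : ∑ h, 𝒟.e h = 0 := by
  have := 𝒟.sum_tmul_e (fun _ => (1 : k))
  simp only [sub_self, TensorProduct.zero_tmul, Finset.sum_const_zero] at this
  simpa using congrArg (TensorProduct.lid k V) this

section total

variable {Q Q' : Type} [CommRing Q] [Algebra k Q] [CommRing Q'] [Algebra k Q']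

/-- The differential of the twisted Koszul complex. -/
def total (z : P → Q) (c : P → P → Q) : Q ⊗[k] Module.End k (SymExt k V) :=
  ∑ h, z h ⊗ₜ wedge (𝒟.e h) +
    ∑ y : P × P, c y.1 y.2 ⊗ₜ (times (𝒟.e y.1) * contract (𝒟.ev (y.1 * y.2)))

omit [Fintype σ] in
theorem map_total (f : Q →ₐ[k] Q') (z : P → Q) (c : P → P → Q) :
    Algebra.TensorProduct.map f (AlgHom.id k _) (𝒟.total z c) =
      𝒟.total (fun h => f (z h)) (fun h g => f (c h g)) := by
  simp [total]

omit [Fintype σ] in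
-- The wedge terms anticommute and square to zero, and so do the contraction terms. Only the mixed
-- anticommutators survive; they are the scalars ev_{hg}(e_{h'}), and summing them against z_{h'}
-- leaves z_{hg} - z_{hgψ}.
theorem total_mul_total (z : P → Q) (c : P → P → Q) :
    𝒟.total z c * 𝒟.total z c =
      ∑ h, (∑ g, c h g * (z (h * g) - z (h * g * 𝒟.ψ))) ⊗ₜ times (𝒟.e h) := by
  rw [total, add_mul, mul_add, mul_add, sum_mul_sum_eq_zero_of_anticommute,
    sum_mul_sum_eq_zero_of_anticommute, zero_add, add_zero]
  · rw [Finset.sum_mul_sum, Finset.sum_comm, Finset.sum_mul_sum, ← Finset.sum_add_distrib,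
      Fintype.sum_prod_type]
    refine Finset.sum_congr rfl fun h _ => ?_
    rw [TensorProduct.sum_tmul]
    refine Finset.sum_congr rfl fun g _ => ?_
    rw [← Finset.sum_add_distrib, ← 𝒟.sum_ev_e_smul z, Finset.mul_sum, TensorProduct.sum_tmul]
    refine Finset.sum_congr rfl fun h' _ => ?_
    rw [Algebra.TensorProduct.tmul_mul_tmul, Algebra.TensorProduct.tmul_mul_tmul,
      mul_comm (z h'), ← TensorProduct.tmul_add, mul_smul_comm, TensorProduct.smul_tmul]
    congr 1
    rw [← mul_assoc, ← (commute_times_wedge (𝒟.e h) (𝒟.e h')).eq, mul_assoc, mul_assoc, ← mul_add,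
      add_comm, contract_mul_wedge_add, mul_smul_comm, mul_one]
  · rintro ⟨h, g⟩
    rw [Algebra.TensorProduct.tmul_mul_tmul, times_contract_mul, contract_mul_self, mul_zero,
      TensorProduct.tmul_zero]
  · rintro ⟨h, g⟩ ⟨h', g'⟩
    rw [Algebra.TensorProduct.tmul_mul_tmul, Algebra.TensorProduct.tmul_mul_tmul,
      mul_comm (c _ _), ← TensorProduct.tmul_add, times_contract_mul, times_contract_mul,
      (commute_times_times (𝒟.e h') (𝒟.e h)).eq, ← mul_add, contract_mul_contract_add, mul_zero,
      TensorProduct.tmul_zero]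
  · intro h
    rw [Algebra.TensorProduct.tmul_mul_tmul, wedge_mul_self, TensorProduct.tmul_zero]
  · intro h h'
    rw [Algebra.TensorProduct.tmul_mul_tmul, Algebra.TensorProduct.tmul_mul_tmul,
      mul_comm (z h'), ← TensorProduct.tmul_add, wedge_mul_wedge_add, TensorProduct.tmul_zero]

/-- In basis coordinates the constant -1 cancels in the differences, so D² is a linear form in the
variables whose coefficients are differences of the `w h`. -/
theorem total_mul_total_of_sum_eq {z : P → Q} {c : P → P → Q} {w : P → Q}
    (hw : ∀ h, ∑ g, c h g * (z (h * g) - z (h * g * 𝒟.ψ)) = w h - 1) :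
    𝒟.total z c * 𝒟.total z c =
      ∑ i, (w (𝒟.l i) - w (𝒟.l i * 𝒟.ψ)) ⊗ₜ times (𝒟.basis i) := by
  rw [total_mul_total]
  have := congrArg (LinearMap.lTensor Q times) (𝒟.sum_tmul_e fun h => w h - 1)
  simpa [hw] using this

omit [Fintype σ] in
theorem commute_total_times (z : P → Q) (c : P → P → Q) (v : V) :
    Commute (𝒟.total z c) ((1 : Q) ⊗ₜ times v) := by
  refine Commute.add_left (Commute.sum_left _ _ _ fun h _ => ?_)
    (Commute.sum_left _ _ _ fun y _ => ?_)
  · change _ * _ = _ * _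
    rw [Algebra.TensorProduct.tmul_mul_tmul, Algebra.TensorProduct.tmul_mul_tmul, one_mul, mul_one,
      (commute_times_wedge _ _).eq]
  · change _ * _ = _ * _
    rw [Algebra.TensorProduct.tmul_mul_tmul, Algebra.TensorProduct.tmul_mul_tmul, one_mul, mul_one,
      ((commute_times_times v _).mul_right (commute_times_contract v _)).eq]

end total

end DifferenceSystem
end

/-! ### Exactness over the group ring of a finite quotient -/

noncomputable section

open scoped TensorProduct

theorem tensorProductEnd_tmul_tmul {k Q X : Type} [Field k] [CommRing Q] [Algebra k Q]
    [AddCommGroup X] [Module k X] (q r : Q) (t : Module.End k X) (x : X) :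
    LinearMap.tensorProductEnd k Q X (q ⊗ₜ t) (r ⊗ₜ x) = (q * r) ⊗ₜ t x := by
  change LinearMap.tensorProduct k Q X X (q ⊗ₜ t) (r ⊗ₜ x) = (q * r) ⊗ₜ t x
  simp [LinearMap.tensorProduct, TensorProduct.smul_tmul']

namespace MonoidAlgebra

variable {k U X : Type} [Field k] [AddCommGroup X] [Module k X]

/-- The coefficient at `u` of an element of the group ring with values in `X`. -/
def coeffAt (u : U) : MonoidAlgebra k U ⊗[k] X →ₗ[k] X :=
  TensorProduct.lift
    { toFun f := f.coeff u • LinearMap.id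
      map_add' f g := by simp [add_smul]
      map_smul' c f := by simp [mul_smul] }

@[simp]
theorem coeffAt_tmul (u : U) (f : MonoidAlgebra k U) (x : X) :
    coeffAt u (f ⊗ₜ x) = f.coeff u • x := rfl

variable [Fintype U]

theorem sum_coeff_smul_single (f : MonoidAlgebra k U) :
    ∑ u, f.coeff u • single u (1 : k) = f := by
  classical
  ext v
  simp [coeff_sum]

theorem sum_single_tmul_coeffAt (y : MonoidAlgebra k U ⊗[k] X) :
    ∑ u, single u (1 : k) ⊗ₜ[k] coeffAt u y = y := by
  induction y using TensorProduct.induction_on with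
  | zero => simp
  | add y z hy hz => simp [TensorProduct.tmul_add, Finset.sum_add_distrib, hy, hz]
  | tmul f x =>
    simp only [coeffAt_tmul, ← TensorProduct.smul_tmul]
    rw [← TensorProduct.sum_tmul, sum_coeff_smul_single]

theorem coeffAt_sum_single_tmul (F : U → X) (u : U) :
    coeffAt u (∑ v, single v (1 : k) ⊗ₜ[k] F v) = F u := by
  classical
  simp [Finsupp.single_apply]

theorem eq_zero_of_coeffAt_eq_zero {y : MonoidAlgebra k U ⊗[k] X} (h : ∀ u, coeffAt u y = 0) :
    y = 0 := by
  rw [← sum_single_tmul_coeffAt y]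
  simp [h]

theorem coeffAt_tensorProductEnd [CommGroup U] (a : MonoidAlgebra k U ⊗[k] Module.End k X)
    (y : MonoidAlgebra k U ⊗[k] X) (u : U) :
    coeffAt u (LinearMap.tensorProductEnd k (MonoidAlgebra k U) X a y) =
      ∑ v, coeffAt v a (coeffAt (v⁻¹ * u) y) := by
  classical
  induction a using TensorProduct.induction_on with
  | zero => simp
  | add a b ha hb => simp only [map_add, LinearMap.add_apply, ha, hb, Finset.sum_add_distrib]
  | tmul f t =>
    induction y using TensorProduct.induction_on with
    | zero => simp
    | add y z hy hz => simp only [map_add, hy, hz, Finset.sum_add_distrib]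
    | tmul g x =>
      rw [tensorProductEnd_tmul_tmul]
      simp only [coeffAt_tmul, LinearMap.smul_apply, map_smul, smul_smul]
      rw [← Finset.sum_smul]
      congr 1
      rw [coeff_mul_apply_left]
      rw [Finsupp.sum_fintype _ _ (by simp)]
      exact Finset.sum_congr rfl fun v _ => mul_comm _ _

end MonoidAlgebra

section baseChange

variable {k X J : Type} [Field k] [AddCommGroup X] [Module k X] (b : Module.Basis J k X)
  {Q Q' : Type} [CommRing Q] [Algebra k Q] [CommRing Q'] [Algebra k Q']

theorem repr_baseChange_map (f : Q →ₐ[k] Q') (y : Q ⊗[k] X) (j : J) :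
    (b.baseChange Q').repr (TensorProduct.map f.toLinearMap LinearMap.id y) j =
      f ((b.baseChange Q).repr y j) := by
  induction y using TensorProduct.induction_on with
  | zero => simp
  | add y z hy hz => simp [hy, hz]
  | tmul q x => simp

theorem map_tensorProductEnd (f : Q →ₐ[k] Q') (a : Q ⊗[k] Module.End k X) (y : Q ⊗[k] X) :
    TensorProduct.map f.toLinearMap LinearMap.id (LinearMap.tensorProductEnd k Q X a y) =
      LinearMap.tensorProductEnd k Q' X (Algebra.TensorProduct.map f (AlgHom.id k _) a)
        (TensorProduct.map f.toLinearMap LinearMap.id y) := by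
  induction a using TensorProduct.induction_on with
  | zero => simp
  | add a b ha hb => simp only [map_add, LinearMap.add_apply, ha, hb]
  | tmul q t =>
    induction y using TensorProduct.induction_on with
    | zero => simp
    | add y z hy hz => simp only [map_add, hy, hz]
    | tmul r x =>
      rw [Algebra.TensorProduct.map_tmul, tensorProductEnd_tmul_tmul]
      simp [tensorProductEnd_tmul_tmul, -LinearMap.tensorProductEnd_apply]

theorem tmul_mem_homogeneous (δ : J → ℕ) {m : ℕ} {x : X}
    (hx : x ∈ MatrixFactorization.homogeneous b δ m) (q : Q) :
    q ⊗ₜ[k] x ∈ MatrixFactorization.homogeneous (b.baseChange Q) δ m := by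
  refine MatrixFactorization.mem_homogeneous.2 fun j hj =>
    MatrixFactorization.mem_homogeneous.1 hx j fun h => hj ?_
  simp [h]

theorem tensorProductEnd_mem_homogeneous (δ : J → ℕ) {m n : ℕ} {t : Module.End k X}
    (ht : ∀ x ∈ MatrixFactorization.homogeneous b δ m,
      t x ∈ MatrixFactorization.homogeneous b δ n) (q : Q) {y : Q ⊗[k] X}
    (hy : y ∈ MatrixFactorization.homogeneous (b.baseChange Q) δ m) :
    LinearMap.tensorProductEnd k Q X (q ⊗ₜ t) y ∈
      MatrixFactorization.homogeneous (b.baseChange Q) δ n := by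
  rw [MatrixFactorization.homogeneous_eq_span] at hy
  have : Submodule.span Q (b.baseChange Q '' {j | δ j = m}) ≤
      (MatrixFactorization.homogeneous (b.baseChange Q) δ n).comap
        (LinearMap.tensorProductEnd k Q X (q ⊗ₜ t)) := by
    rw [Submodule.span_le]
    rintro _ ⟨j, hj, rfl⟩
    rw [SetLike.mem_coe, Submodule.mem_comap, Module.Basis.baseChange_apply,
      tensorProductEnd_tmul_tmul]
    refine tmul_mem_homogeneous b δ (ht _ ?_) _
    rw [MatrixFactorization.homogeneous_eq_span]
    exact Submodule.subset_span ⟨j, hj, rfl⟩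
  exact this hy

end baseChange

namespace DifferenceSystem

open SymExt MatrixFactorization

variable {k P V σ : Type} [Field k] [CommGroup P] [DecidableEq P]
    [AddCommGroup V] [Module k V] [Fintype P] [Fintype σ] [LinearOrder σ]
    (𝒟 : DifferenceSystem k P V σ)

/-- The matrix factorization theorem for Q ⊗ (Sym V ⊗ ΛV), with the basis of V acting by symmetric
multiplication as the variables. -/
theorem exists_sub_total_mem {Q : Type} [CommRing Q] [Algebra k Q] {z : P → Q} {c : P → P → Q}
    {w : P → Q} (hw : ∀ h, ∑ g, c h g * (z (h * g) - z (h * g * 𝒟.ψ)) = w h - 1)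
    {γ : σ → Q} (hγ : ∀ i, γ i = w (𝒟.l i) - w (𝒟.l i * 𝒟.ψ))
    (hreg : ∀ (s : Finset σ) (i), i ∉ s → ∀ q, γ i * q ∈ Ideal.span (γ '' s) →
      q ∈ Ideal.span (γ '' s)) (m : ℕ) (y : Q ⊗[k] SymExt k V)
    (hy : y ∈ homogeneous ((SymExt.basis 𝒟.basis).baseChange Q)
      (fun j => 2 * j.1.degree + j.2.card) (m + 1))
    (hDy : LinearMap.tensorProductEnd k Q _ (𝒟.total z c) y ∈
      coeffIn ((SymExt.basis 𝒟.basis).baseChange Q) (Ideal.span (Set.range γ)) Finset.univ) :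
    ∃ u ∈ homogeneous ((SymExt.basis 𝒟.basis).baseChange Q)
      (fun j => 2 * j.1.degree + j.2.card) m,
      y - LinearMap.tensorProductEnd k Q _ (𝒟.total z c) u ∈
        coeffIn ((SymExt.basis 𝒟.basis).baseChange Q) (Ideal.span (Set.range γ)) Finset.univ := by
  refine exists_sub_mem_coeffIn (B := (SymExt.basis 𝒟.basis).baseChange Q) Finset.card
    (fun c => Finset.card_le_univ c)
    (X := fun i => LinearMap.tensorProductEnd k Q _ (1 ⊗ₜ times (𝒟.basis i))) ?_ ?_ ?_ hreg ?_
    m y hy hDy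
  · intro i j
    rw [Module.Basis.baseChange_apply, Module.Basis.baseChange_apply, tensorProductEnd_tmul_tmul,
      times_basis, mul_one]
  · intro i
    exact (𝒟.commute_total_times z c (𝒟.basis i)).map _
  · rw [← map_mul, 𝒟.total_mul_total_of_sum_eq hw, map_sum]
    refine Finset.sum_congr rfl fun i _ => ?_
    rw [hγ, ← map_smul, TensorProduct.smul_tmul', smul_eq_mul, mul_one]
  · intro m y hy
    rw [total, map_add, map_sum, map_sum, LinearMap.add_apply, LinearMap.sum_apply,
      LinearMap.sum_apply]
    refine Submodule.add_mem _ (Submodule.sum_mem _ fun h _ => ?_)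
      (Submodule.sum_mem _ fun h _ => ?_)
    · refine tensorProductEnd_mem_homogeneous _ _ (fun x hx => ?_) _ hy
      rw [← graded_eq_homogeneous] at hx ⊢
      exact wedge_mem_graded _ hx
    · refine tensorProductEnd_mem_homogeneous _ _ (fun x hx => ?_) _ hy
      rw [← graded_eq_homogeneous] at hx ⊢
      exact times_contract_mem_graded _ _ hx

section group

open MonoidAlgebra

variable {L U : Type} [CommGroup L] [CommGroup U] [Fintype U]

/-- Exactness of the twisted Koszul complex over a finite quotient of the lattice. -/
theorem exists_sum_total_eq (r : L →* U) (hr : Function.Surjective r) {z : P → MonoidAlgebra k L}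
    {c : P → P → MonoidAlgebra k L} {w : P → L}
    (hw : ∀ h, ∑ g, c h g * (z (h * g) - z (h * g * 𝒟.ψ)) = single (w h) 1 - 1)
    (hker : r.ker = Subgroup.closure (Set.range fun i => w (𝒟.l i) / w (𝒟.l i * 𝒟.ψ)))
    (hind : ∀ (s : Finset σ) (i), i ∉ s → ∀ m : ℤ, (w (𝒟.l i) / w (𝒟.l i * 𝒟.ψ)) ^ m ∈
      Subgroup.closure ((fun i => w (𝒟.l i) / w (𝒟.l i * 𝒟.ψ)) '' s) → m = 0)
    (m : ℕ) (F : U → SymExt k V) (hF : ∀ u, F u ∈ graded k V (m + 1))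
    (hDF : ∀ u, ∑ v, coeffAt (X := Module.End k (SymExt k V)) v (𝒟.total (fun h => mapDomainAlgHom k k r (z h))
      (fun h g => mapDomainAlgHom k k r (c h g))) (F (v⁻¹ * u)) = 0) :
    ∃ F' : U → SymExt k V, (∀ u, F' u ∈ graded k V m) ∧
      ∀ u, ∑ v, coeffAt (X := Module.End k (SymExt k V)) v (𝒟.total (fun h => mapDomainAlgHom k k r (z h))
        (fun h g => mapDomainAlgHom k k r (c h g))) (F' (v⁻¹ * u)) = F u := by
  set f := mapDomainAlgHom k k r with hf
  set ℬ := SymExt.basis 𝒟.basis with hℬ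
  let γ : σ → MonoidAlgebra k L := fun i => single (w (𝒟.l i)) 1 - single (w (𝒟.l i * 𝒟.ψ)) 1
  -- Since the quotients of the group elements in γ_i generate the kernel of `r`, having
  -- coefficients in the ideal of the γ_i is the same as vanishing over the group ring of `U`.
  have hIf : ∀ q, q ∈ Ideal.span (Set.range γ) ↔ f q = 0 := by
    intro q
    constructor
    · intro hq
      have h1 : Ideal.span (Set.range γ) ≤ RingHom.ker f := by
        rw [Ideal.span_le]
        rintro _ ⟨i, rfl⟩
        have h2 : r (w (𝒟.l i)) = r (w (𝒟.l i * 𝒟.ψ)) := by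
          rw [← div_eq_one, ← map_div, ← MonoidHom.mem_ker, hker]
          exact Subgroup.subset_closure ⟨i, rfl⟩
        change f (single (w (𝒟.l i)) 1 - single (w (𝒟.l i * 𝒟.ψ)) 1) = 0
        rw [map_sub, sub_eq_zero]
        simp [hf, h2]
      exact h1 hq
    · intro hq
      refine mem_of_mapDomain_eq_zero (S := Set.range fun i => w (𝒟.l i) / w (𝒟.l i * 𝒟.ψ)) ?_ r
        hker.le hq
      rintro _ ⟨i, rfl⟩
      have h2 : single (w (𝒟.l i) / w (𝒟.l i * 𝒟.ψ)) (1 : k) - 1 =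
          single (w (𝒟.l i * 𝒟.ψ))⁻¹ 1 * γ i := by
        simp only [γ]
        rw [mul_sub, single_mul_single, single_mul_single]
        simp [← one_def, div_eq_inv_mul]
      rw [h2]
      exact Ideal.mul_mem_left _ _ (Ideal.subset_span ⟨i, rfl⟩)
  let R : MonoidAlgebra k L ⊗[k] SymExt k V →ₗ[k] MonoidAlgebra k U ⊗[k] SymExt k V :=
    TensorProduct.map f.toLinearMap LinearMap.id
  have hR : ∀ y, R y = 0 ↔ y ∈ coeffIn (ℬ.baseChange _) (Ideal.span (Set.range γ))
      Finset.univ := by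
    intro y
    simp only [mem_coeffIn, Finset.subset_univ, true_implies, hIf]
    rw [← LinearEquiv.map_eq_zero_iff (ℬ.baseChange (MonoidAlgebra k U)).repr, Finsupp.ext_iff]
    simp only [R, repr_baseChange_map]
    rfl
  have hRD : ∀ y, R (LinearMap.tensorProductEnd k _ _ (𝒟.total z c) y) =
      LinearMap.tensorProductEnd k _ _ (𝒟.total (fun h => f (z h)) (fun h g => f (c h g)))
        (R y) := by
    intro y
    simp only [R]
    rw [map_tensorProductEnd, 𝒟.map_total]
  choose s hs using hr
  -- A lift of `F` along a set-theoretic section of `r`; it is a cycle only modulo the ideal, which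
  -- is what the matrix factorization argument allows.
  let y : MonoidAlgebra k L ⊗[k] SymExt k V := ∑ u, single (s u) (1 : k) ⊗ₜ F u
  have hRy : R y = ∑ u, single u (1 : k) ⊗ₜ F u := by
    simp [R, y, hf, hs]
  have hy : y ∈ homogeneous (ℬ.baseChange _) (fun j => 2 * j.1.degree + j.2.card) (m + 1) :=
    Submodule.sum_mem _ fun u _ => tmul_mem_homogeneous _ _
      (by rw [← graded_eq_homogeneous]; exact hF u) _
  obtain ⟨u, hu, hyu⟩ := 𝒟.exists_sub_total_mem (γ := γ) hw (fun _ => rfl)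
    (fun s i hi q hq => mem_span_of_mul_mem_span (fun i => w (𝒟.l i))
      (fun i => w (𝒟.l i * 𝒟.ψ)) hind s i hi q hq) m y hy (by
      rw [← hR, hRD]
      refine eq_zero_of_coeffAt_eq_zero fun v => ?_
      rw [coeffAt_tensorProductEnd, ← hDF v]
      simp only [hRy, coeffAt_sum_single_tmul])
  refine ⟨fun v => coeffAt v (R u), fun v => ?_, fun v => ?_⟩
  · beta_reduce
    rw [← (ℬ.baseChange _).linearCombination_repr u, Finsupp.linearCombination_apply, Finsupp.sum,
      map_sum, map_sum]
    refine Submodule.sum_mem _ fun j hj => ?_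
    have h1 := mem_homogeneous.1 hu j (Finsupp.mem_support_iff.1 hj)
    simp only [R, Module.Basis.baseChange_apply, TensorProduct.smul_tmul', TensorProduct.map_tmul,
      coeffAt_tmul]
    refine Submodule.smul_mem _ _ ?_
    rw [← h1]
    exact basis_mem_graded _ j
  · rw [← coeffAt_tensorProductEnd, ← hRD]
    have h2 := (hR _).2 hyu
    rw [map_sub, sub_eq_zero] at h2
    rw [← h2, hRy, coeffAt_sum_single_tmul]

end group

end DifferenceSystem
end

/-! ### The differential as an equivariant convolution kernel -/

noncomputable section

open scoped TensorProduct

namespace MonoidAlgebra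

variable {k L U : Type} [Field k] [CommGroup L] [CommGroup U]

variable (k L) in
/-- The augmentation of the group ring. -/
def augmentation : MonoidAlgebra k L →ₐ[k] k := MonoidAlgebra.lift k k L 1

@[simp]
theorem augmentation_single (a : L) (c : k) : augmentation k L (single a c) = c := by
  simp [augmentation]

theorem augmentation_mapDomain (r : L →* U) (f : MonoidAlgebra k L) :
    augmentation k U (mapDomain r f) = augmentation k L f := by
  induction f using MonoidAlgebra.induction_linear with
  | zero => simp
  | add f g hf hg => rw [mapDomain_add, map_add, map_add, hf, hg]
  | single a c => simp

theorem sum_coeff [Fintype U] (f : MonoidAlgebra k U) : ∑ u, f.coeff u = augmentation k U f := by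
  classical
  conv_rhs => rw [← sum_coeff_smul_single f]
  simp

end MonoidAlgebra

namespace SemidirectProduct

variable {U P : Type} [Group U] [Group P] (φ : P →* MulAut U)

/-- The subgroup `A ⋊ P` of `U ⋊ P`. -/
def subgroupLeft (A : Subgroup U) (hA : ∀ g, ∀ a ∈ A, φ g a ∈ A) : Subgroup (U ⋊[φ] P) where
  carrier := {x | x.left ∈ A}
  mul_mem' hx hy := A.mul_mem hx (hA _ _ hy)
  one_mem' := A.one_mem
  inv_mem' hx := hA _ _ (A.inv_mem hx)

end SemidirectProduct

namespace DifferenceSystem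

open SymExt MonoidAlgebra SemidirectProduct

variable {k P V σ : Type} [Field k] [CommGroup P] [DecidableEq P]
    [AddCommGroup V] [Module k V] (𝒟 : DifferenceSystem k P V σ)

/-- The representation of `P` on the homogeneous elements of degree `m`. -/
def gradedRep (m : ℕ) : Rep k P :=
  Rep.of (X := graded k V m)
    { toFun g := (SymExt.map (𝒟.ρ g)).restrict fun _ h => map_mem_graded _ h
      map_one' := by
        ext w
        have : SymExt.map (𝒟.ρ 1) w.1 = w.1 := by
          rw [map_one 𝒟.ρ]
          exact LinearMap.congr_fun SymExt.map_id w.1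
        exact this
      map_mul' g h := by
        ext w
        have : SymExt.map (𝒟.ρ (g * h)) w.1 = SymExt.map (𝒟.ρ g) (SymExt.map (𝒟.ρ h) w.1) := by
          rw [map_mul 𝒟.ρ]
          exact LinearMap.congr_fun (SymExt.map_comp _ _) w.1
        exact this }

/-- The inclusion of the homogeneous elements of degree `m`. -/
def incl (m : ℕ) : 𝒟.gradedRep m →ₗ[k] SymExt k V := (graded k V m).subtype

/-- A homogeneous element of degree `m`. -/
def toGraded {m : ℕ} (w : SymExt k V) (hw : w ∈ graded k V m) : 𝒟.gradedRep m :=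
  (⟨w, hw⟩ : graded k V m)

@[simp]
theorem incl_toGraded {m : ℕ} (w : SymExt k V) (hw : w ∈ graded k V m) :
    𝒟.incl m (𝒟.toGraded w hw) = w := rfl

theorem incl_mem (m : ℕ) (w : 𝒟.gradedRep m) : 𝒟.incl m w ∈ graded k V m := Subtype.property _

theorem incl_injective (m : ℕ) : Function.Injective (𝒟.incl m) := Subtype.val_injective

theorem incl_ρ (m : ℕ) (g : P) (w : 𝒟.gradedRep m) :
    𝒟.incl m ((𝒟.gradedRep m).ρ g w) = SymExt.map (𝒟.ρ g) (𝒟.incl m w) := rfl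

/-- The restriction of an operator of degree one to homogeneous elements. -/
def restrict (m : ℕ) (t : Module.End k (SymExt k V))
    (ht : ∀ w ∈ graded k V m, t w ∈ graded k V (m + 1)) :
    𝒟.gradedRep m →ₗ[k] 𝒟.gradedRep (m + 1) :=
  LinearMap.restrict t ht

variable [Fintype P] {U : Type} [CommGroup U] (φ : P →* MulAut U)

section operator

variable (z : P → MonoidAlgebra k U) (c : P → P → MonoidAlgebra k U)

/-- The coefficients of the differential of the twisted Koszul complex over a group ring. -/
def operator (u : U) : Module.End k (SymExt k V) :=
  coeffAt (X := Module.End k (SymExt k V)) u (𝒟.total z c)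

theorem operator_eq (u : U) : 𝒟.operator z c u = ∑ h, (z h).coeff u • wedge (𝒟.e h) +
    ∑ y : P × P, (c y.1 y.2).coeff u • (times (𝒟.e y.1) * contract (𝒟.ev (y.1 * y.2))) := by
  rw [operator, total, map_add, map_sum, map_sum]
  rfl

theorem operator_mem_graded (u : U) {m : ℕ} {w : SymExt k V} (hw : w ∈ graded k V m) :
    𝒟.operator z c u w ∈ graded k V (m + 1) := by
  rw [operator_eq, LinearMap.add_apply, LinearMap.sum_apply, LinearMap.sum_apply]
  exact Submodule.add_mem _
    (Submodule.sum_mem _ fun h _ => Submodule.smul_mem _ _ (wedge_mem_graded _ hw))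
    (Submodule.sum_mem _ fun h _ => Submodule.smul_mem _ _ (times_contract_mem_graded _ _ hw))

theorem operator_apply_of_mem_graded_zero (u : U) {w : SymExt k V} (hw : w ∈ graded k V 0) :
    𝒟.operator z c u w = ∑ h, (z h).coeff u • wedge (𝒟.e h) w := by
  rw [operator_eq, LinearMap.add_apply, LinearMap.sum_apply, LinearMap.sum_apply]
  simp [contract_eq_zero _ hw]

/-- Translating the summation index by `g` moves the vectors, the forms and the group ring
coefficients simultaneously. -/
theorem map_mul_operator (hz : ∀ g h, z (g * h) = mapDomain (φ g) (z h))
    (hc : ∀ g h g', c (g * h) g' = mapDomain (φ g) (c h g')) (g : P) (u : U) :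
    SymExt.map (𝒟.ρ g) * 𝒟.operator z c u = 𝒟.operator z c (φ g u) * SymExt.map (𝒟.ρ g) := by
  have hcoeff : ∀ f : MonoidAlgebra k U, (mapDomain (φ g) f).coeff (φ g u) = f.coeff u :=
    fun f => Finsupp.mapDomain_apply (φ g).injective _ _
  rw [operator_eq, operator_eq, mul_add, add_mul, Finset.mul_sum, Finset.mul_sum, Finset.sum_mul,
    Finset.sum_mul]
  congr 1
  · refine Eq.trans (Finset.sum_congr rfl fun h _ => ?_) (Equiv.sum_comp (Equiv.mulLeft g) _)
    rw [Equiv.coe_mulLeft, hz, hcoeff, mul_smul_comm, smul_mul_assoc, map_mul_wedge, 𝒟.ρ_e]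
  · refine Eq.trans (Finset.sum_congr rfl fun y _ => ?_)
      (Equiv.sum_comp ((Equiv.mulLeft g).prodCongr (Equiv.refl P)) _)
    simp only [Equiv.prodCongr_apply, Prod.map_fst, Prod.map_snd, Equiv.coe_mulLeft,
      Equiv.refl_apply]
    rw [hc, hcoeff, mul_smul_comm, smul_mul_assoc, ← mul_assoc, map_mul_times, mul_assoc,
      ← 𝒟.ev_ρ g, map_mul_contract, 𝒟.ρ_e, mul_assoc, mul_assoc]

variable [Fintype σ] [Fintype U]

/-- Summing over U replaces group ring coefficients by their augmentations. The wedge part becomes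
multiplication by Σ e_h = 0, and `ha` makes the contraction part vanish as well. -/
theorem sum_operator (hz : ∀ h, augmentation k U (z h) = 1) {a : P → k}
    (hc : ∀ h g, augmentation k U (c h g) = a g)
    (ha : ∀ h, ∑ g, a g • 𝒟.ev (h * g) = ∑ g, a g • 𝒟.ev (h * 𝒟.ψ * g)) :
    ∑ u, 𝒟.operator z c u = 0 := by
  have e1 : ∑ h, wedge (k := k) (𝒟.e h) = 0 := by
    rw [← map_sum, 𝒟.sum_e, map_zero]
  have e2 : ∑ h, ∑ g, a g • (times (𝒟.e h) * contract (𝒟.ev (h * g))) = 0 := by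
    -- Take the form-valued function h ↦ Σ_g a_g ev_{hg}: by `ha` it is invariant under ψ, so all
    -- differences on the right of the identity are zero.
    have h1 := 𝒟.sum_tmul_e fun h => ∑ g, a g • 𝒟.ev (h * g)
    simp only [← ha, sub_self, TensorProduct.zero_tmul, Finset.sum_const_zero] at h1
    have h2 := congrArg (TensorProduct.lift ((LinearMap.mul k (Module.End k (SymExt k V))).flip.compl₁₂
      contract times)) h1
    simpa [Finset.mul_sum] using h2
  have h3 : ∀ f : MonoidAlgebra k U, ∑ u, f.coeff u = augmentation k U f := sum_coeff
  simp only [operator_eq, Finset.sum_add_distrib]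
  rw [Finset.sum_comm, Finset.sum_comm (s := (Finset.univ : Finset U))]
  simp only [← Finset.sum_smul, h3, hz, hc, one_smul, e1, zero_add, Fintype.sum_prod_type]
  exact e2

omit [Fintype σ] in
theorem sum_operator_operator (h : 𝒟.total z c * 𝒟.total z c = 0) (F : U → SymExt k V) (u : U) :
    ∑ v, 𝒟.operator z c v (∑ w, 𝒟.operator z c w (F (w⁻¹ * (v⁻¹ * u)))) = 0 := by
  have h1 := congrArg (fun t => coeffAt u (LinearMap.tensorProductEnd k _ _ t
    (∑ v, single v (1 : k) ⊗ₜ[k] F v))) h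
  simp only [map_mul, Module.End.mul_apply, coeffAt_tensorProductEnd, coeffAt_sum_single_tmul,
    map_zero, LinearMap.zero_apply] at h1
  exact h1

end operator

/-- The differences q(l_i) - q(l_i ψ) are the basis coordinates of Σ q_h e_h; contraction recovers
them from the exterior algebra. -/
theorem sum_smul_wedge_one_eq_zero_iff [Fintype σ] (q : P → k) :
    ∑ h, q h • wedge (𝒟.e h) (1 : SymExt k V) = 0 ↔ ∀ i, q (𝒟.l i) = q (𝒟.l i * 𝒟.ψ) := by
  constructor
  · intro h i
    have h1 := congrArg (contract (𝒟.ev (𝒟.l i))) h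
    simp only [map_sum, map_smul, contract_wedge, contract_one, map_zero, sub_zero, smul_smul] at h1
    rw [← Finset.sum_smul] at h1
    have h2 := (smul_eq_zero.1 h1).resolve_right one_ne_zero
    simp only [mul_comm (q _), ← smul_eq_mul] at h2
    rwa [𝒟.sum_ev_e_smul q, sub_eq_zero] at h2
  · intro h
    have h1 := 𝒟.sum_tmul_e q
    simp only [h, sub_self, TensorProduct.zero_tmul, Finset.sum_const_zero] at h1
    have h2 := congrArg (fun v => wedge v (1 : SymExt k V)) (congrArg (TensorProduct.lid k V) h1)
    simpa using h2


end DifferenceSystem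
end

/-! ### Cohomology of A ⋊ P from the coresolution -/

noncomputable section

open scoped TensorProduct
open CategoryTheory

namespace DifferenceSystem

open SymExt MonoidAlgebra SemidirectProduct

variable {k P V σ : Type} [Field k] [CommGroup P] [DecidableEq P]
    [AddCommGroup V] [Module k V] (𝒟 : DifferenceSystem k P V σ)
    {U : Type} [CommGroup U] (φ : P →* MulAut U)

/-- The unit element, as a homogeneous element of degree zero. -/
def unit : 𝒟.gradedRep 0 := 𝒟.toGraded 1 one_mem_graded

theorem unit_ne_zero : 𝒟.unit ≠ 0 := fun h => one_ne_zero (congrArg (𝒟.incl 0) h)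

theorem exists_smul_unit_eq (w : 𝒟.gradedRep 0) : ∃ c : k, c • 𝒟.unit = w := by
  have hw := 𝒟.incl_mem 0 w
  rw [graded_zero, Submodule.mem_span_singleton] at hw
  obtain ⟨c, hc⟩ := hw
  exact ⟨c, 𝒟.incl_injective 0 ((map_smul _ _ _).trans hc)⟩

theorem gradedRep_zero_apply (g : P) (w : 𝒟.gradedRep 0) : (𝒟.gradedRep 0).ρ g w = w := by
  obtain ⟨c, rfl⟩ := 𝒟.exists_smul_unit_eq w
  rw [map_smul]
  congr 1
  exact 𝒟.incl_injective 0 ((𝒟.incl_ρ _ _ _).trans (SymExt.map_one _))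

section

variable (A : Subgroup U) (hA : ∀ g, ∀ a ∈ A, φ g a ∈ A)

/-- The embedding of the functions on the cosets of `A ⋊ P` in the functions on the cosets of
`P`. -/
def cosetFunctions :
    Rep.coind (subgroupLeft φ A hA).subtype (Rep.trivial k (subgroupLeft φ A hA) k) ⟶
      coindComplement φ (𝒟.gradedRep 0) :=
  Rep.ofHom
    { toFun f := ⟨fun x => f.1 x • 𝒟.unit, by
        rintro ⟨_, g, rfl⟩ x
        have h1 := f.2 ⟨inr g, A.one_mem⟩ x
        change f.1 (inr g * x) = f.1 x at h1
        change f.1 (inr g * x) • 𝒟.unit =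
          (𝒟.gradedRep 0).ρ g (f.1 x • 𝒟.unit)
        rw [gradedRep_zero_apply, h1]⟩
      map_add' f f' := Subtype.ext (funext fun x => add_smul (f.1 x) (f'.1 x) _)
      map_smul' c f := Subtype.ext (funext fun x => mul_smul c (f.1 x) _)
      isIntertwining' g := rfl }

theorem cosetFunctions_apply
    (f : Rep.coind (subgroupLeft φ A hA).subtype (Rep.trivial k (subgroupLeft φ A hA) k))
    (x : U ⋊[φ] P) : ((𝒟.cosetFunctions φ A hA).hom f).1 x =
      f.1 x • 𝒟.unit := rfl

theorem cosetFunctions_injective : Function.Injective (𝒟.cosetFunctions φ A hA).hom := by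
  intro f f' h
  refine Subtype.ext (funext fun x => ?_)
  have h1 := congrArg (fun f : coindComplement φ (𝒟.gradedRep 0) => f.1 x) h
  change f.1 x • 𝒟.unit = f'.1 x • 𝒟.unit at h1
  exact smul_left_injective k 𝒟.unit_ne_zero h1

/-- `P` acts trivially in degree 0, so `f` is already left invariant under `P`. Only invariance
under `A` remains, and because `A` is stable under `P` it may be tested on `U`. -/
theorem exists_cosetFunctions_iff (f : coindComplement φ (𝒟.gradedRep 0)) :
    (∃ b, (𝒟.cosetFunctions φ A hA).hom b = f) ↔ ∀ a ∈ A, ∀ u, f.1 (inl (a * u)) = f.1 (inl u) := by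
  constructor
  · rintro ⟨b, rfl⟩ a ha u
    rw [cosetFunctions_apply, cosetFunctions_apply]
    have h1 := b.2 ⟨inl a, ha⟩ (inl u)
    change b.1 (inl a * inl u) = b.1 (inl u) at h1
    rw [map_mul, h1]
  · intro h
    have h1 : ∀ g x, f.1 (inr g * x) = f.1 x := by
      intro g x
      have := f.2 ⟨inr g, g, rfl⟩ x
      change f.1 (inr g * x) = (𝒟.gradedRep 0).ρ g (f.1 x) at this
      rw [this, gradedRep_zero_apply]
    have h2 : ∀ a ∈ A, ∀ x, f.1 (inl a * x) = f.1 x := by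
      intro a ha x
      have e1 : inl a * x = inr x.right * inl (φ x.right⁻¹ a * φ x.right⁻¹ x.left) := by
        apply SemidirectProduct.ext <;> simp
      have e2 : x = inr x.right * inl (φ x.right⁻¹ x.left) := by
        apply SemidirectProduct.ext <;> simp
      rw [e1, h1, h _ (hA _ _ ha)]
      conv_rhs => rw [e2, h1]
    choose c hc using 𝒟.exists_smul_unit_eq
    refine ⟨⟨fun x => c (f.1 x), ?_⟩, Subtype.ext (funext fun x => hc _)⟩
    rintro ⟨s, hs⟩ x
    change c (f.1 (s * x)) = c (f.1 x)
    have e : s * x = inl s.left * (inr s.right * x) := by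
      rw [← mul_assoc, inl_left_mul_inr_right]
    rw [e, h2 _ hs, h1]

end

variable [Fintype P] [Fintype σ] [LinearOrder σ] [Fintype U] {L : Type} [CommGroup L]

/-- The cohomology of `A ⋊ P` for suitable subgroups `A` of finite quotients of a lattice. -/
theorem finrank_groupCohomology_subgroupLeft (χ : P →* MulAut L) (r : L →* U)
    (hr : Function.Surjective r) (hχ : ∀ g a, r (χ g a) = φ g (r a)) (z₀ w₀ : L)
    (c : P → MonoidAlgebra k L)
    (hc : ∑ g, c g * (single (χ g z₀) 1 - single (χ (g * 𝒟.ψ) z₀) 1) = single w₀ 1 - 1)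
    (ha : ∀ h, ∑ g, augmentation k L (c g) • 𝒟.ev (h * g) =
      ∑ g, augmentation k L (c g) • 𝒟.ev (h * 𝒟.ψ * g))
    (hker : r.ker = Subgroup.closure (Set.range fun i => χ (𝒟.l i) w₀ / χ (𝒟.l i * 𝒟.ψ) w₀))
    (hind : ∀ (s : Finset σ) (i), i ∉ s → ∀ m : ℤ, (χ (𝒟.l i) w₀ / χ (𝒟.l i * 𝒟.ψ) w₀) ^ m ∈
      Subgroup.closure ((fun i => χ (𝒟.l i) w₀ / χ (𝒟.l i * 𝒟.ψ) w₀) '' s) → m = 0)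
    (A : Subgroup U) (hA : ∀ g, ∀ a ∈ A, φ g a ∈ A)
    (hAgen : A = Subgroup.closure
      (Set.range fun i => r (χ (𝒟.l i) z₀) / r (χ (𝒟.l i * 𝒟.ψ) z₀))) (n : ℕ) :
    Module.finrank k (groupCohomology (Rep.trivial k (subgroupLeft φ A hA) k) n) =
      groupCohomology.diagonalDim
        (fun n m => Module.finrank k (groupCohomology (𝒟.gradedRep m) n)) n 0 := by
  let zL : P → MonoidAlgebra k L := fun h => single (χ h z₀) 1
  let cL : P → P → MonoidAlgebra k L := fun h g => mapDomain (χ h) (c g)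
  let f := mapDomainAlgHom k k r
  let zU : P → MonoidAlgebra k U := fun h => f (zL h)
  let cU : P → P → MonoidAlgebra k U := fun h g => f (cL h g)
  have hf : ∀ q, f q = mapDomain r q := fun _ => rfl
  have hzU : ∀ h, zU h = single (r (χ h z₀)) 1 := fun h => by
    simp only [zU, zL, hf, mapDomain_single]
  have hw : ∀ h, ∑ g, cL h g * (zL (h * g) - zL (h * g * 𝒟.ψ)) = single (χ h w₀) 1 - 1 := by
    intro h
    have h1 := congrArg (mapDomainAlgHom k k (χ h).toMonoidHom) hc
    simp only [map_sum, map_mul, map_sub, _root_.map_one, mapDomainAlgHom_apply, mapDomain_single] at h1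
    simp only [zL, cL, mul_assoc, map_mul]
    exact h1
  have hwU : ∀ h, ∑ g, cU h g * (zU (h * g) - zU (h * g * 𝒟.ψ)) =
      single (r (χ h w₀)) 1 - 1 := by
    intro h
    have h1 := congrArg f (hw h)
    simp only [map_sum, map_mul, map_sub, _root_.map_one, hf (single _ _), mapDomain_single] at h1
    simpa only [zU, cU] using h1
  have hsq : 𝒟.total zU cU * 𝒟.total zU cU = 0 := by
    rw [𝒟.total_mul_total_of_sum_eq hwU]
    refine Finset.sum_eq_zero fun i _ => ?_
    have h2 : r (χ (𝒟.l i) w₀) = r (χ (𝒟.l i * 𝒟.ψ) w₀) := by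
      rw [← div_eq_one, ← map_div, ← MonoidHom.mem_ker, hker]
      exact Subgroup.subset_closure ⟨i, rfl⟩
    rw [h2, sub_self, TensorProduct.zero_tmul]
  have hfχ : ∀ g (q : MonoidAlgebra k L), mapDomain r (mapDomain (χ g) q) = mapDomain (φ g) (mapDomain r q) := by
    intro g q
    refine MonoidAlgebra.coeff_injective ?_
    simp only [coeff_mapDomain, ← Finsupp.mapDomain_comp]
    congr 1
    exact funext fun a => hχ g a
  let T : ∀ m, U → 𝒟.gradedRep m →ₗ[k] 𝒟.gradedRep (m + 1) := fun m u =>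
    𝒟.restrict m (𝒟.operator zU cU u) fun _ h => 𝒟.operator_mem_graded zU cU u h
  have hT : ∀ m u x, 𝒟.incl (m + 1) (T m u x) = 𝒟.operator zU cU u (𝒟.incl m x) := fun _ _ _ => rfl
  have hfin (m) : Module.Finite k (𝒟.gradedRep m) := finite_graded 𝒟.basis m
  -- Shapiro's lemma for the subgroup A ⋊ P; its coinduced module is the one that gets coresolved.
  refine ((groupCohomology.coindIso
    (Rep.trivial k (subgroupLeft φ A hA) k) n).toLinearEquiv.finrank_eq).symm.trans ?_
  refine finrank_groupCohomology_of_convolution φ (fun m => 𝒟.gradedRep m) T ?_ ?_ ?_ ?_ _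
    (𝒟.cosetFunctions φ A hA) (𝒟.cosetFunctions_injective φ A hA) ?_ n
  · intro m g u
    refine LinearMap.ext fun x => 𝒟.incl_injective _ ?_
    refine LinearMap.congr_fun (𝒟.map_mul_operator φ zU cU ?_ ?_ g u) (𝒟.incl m x)
    · intro g h
      rw [hzU, hzU, mapDomain_single, map_mul, MulAut.mul_apply, hχ]
    · intro g h g'
      simp only [cU, cL, hf]
      rw [← hfχ, map_mul]
      congr 1
      refine MonoidAlgebra.coeff_injective ?_
      simp only [coeff_mapDomain, ← Finsupp.mapDomain_comp]
      rfl
  · intro m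
    refine LinearMap.ext fun x => 𝒟.incl_injective _ ?_
    have h1 := 𝒟.sum_operator zU cU (fun h => by rw [hzU, augmentation_single])
      (a := fun g => augmentation k L (c g)) (fun h g => ?_) ha
    · have h2 := LinearMap.congr_fun h1 (𝒟.incl m x)
      rw [LinearMap.sum_apply] at h2 ⊢
      simpa only [map_sum, hT, LinearMap.zero_apply, map_zero] using h2
    · simp only [cU, cL, hf]
      rw [augmentation_mapDomain]
      exact augmentation_mapDomain (χ h).toMonoidHom (c g)
  · intro m F u
    refine 𝒟.incl_injective _ ?_
    have h1 := 𝒟.sum_operator_operator zU cU hsq (fun u => 𝒟.incl m (F u)) u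
    simpa only [map_sum, hT, map_zero] using h1
  · intro m F hF
    obtain ⟨F', hF', h1⟩ := 𝒟.exists_sum_total_eq r hr (z := zL) (c := cL) (w := fun h => χ h w₀) hw
      hker hind m (fun u => 𝒟.incl _ (F u)) (fun u => 𝒟.incl_mem _ _) (fun u => by
        have h2 := congrArg (𝒟.incl _) (hF u)
        simp only [map_sum, hT, map_zero] at h2
        exact h2)
    refine ⟨fun u => 𝒟.toGraded (F' u) (hF' u), fun u => 𝒟.incl_injective _ (Eq.trans ?_ (h1 u))⟩
    simp only [map_sum, hT, incl_toGraded]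
    rfl
  · intro b
    rw [exists_cosetFunctions_iff]
    let ζ : P → U := fun h => r (χ h z₀)
    -- Contractions vanish in degree 0, so the first differential only compares translates by ζ(l_i)
    -- and ζ(l_i ψ). The quotients of these elements generate `A`, hence its kernel consists of the
    -- A-invariant functions.
    have hiff : ∀ u, ∑ v, T 0 v (b.1 (inl (v⁻¹ * u))) = 0 ↔
        ∀ i, b.1 (inl ((ζ (𝒟.l i))⁻¹ * u)) = b.1 (inl ((ζ (𝒟.l i * 𝒟.ψ))⁻¹ * u)) := by
      intro u
      choose κ hκ using 𝒟.exists_smul_unit_eq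
      have h1 : 𝒟.incl 1 (∑ v, T 0 v (b.1 (inl (v⁻¹ * u)))) =
          ∑ h, κ (b.1 (inl ((ζ h)⁻¹ * u))) • wedge (𝒟.e h) (1 : SymExt k V) := by
        have h2 : ∀ v, 𝒟.incl 1 (T 0 v (b.1 (inl (v⁻¹ * u)))) =
            ∑ h, (zU h).coeff v • wedge (𝒟.e h) (𝒟.incl 0 (b.1 (inl (v⁻¹ * u)))) := fun v =>
          𝒟.operator_apply_of_mem_graded_zero zU cU v (𝒟.incl_mem 0 _)
        rw [map_sum, Finset.sum_congr rfl fun v _ => h2 v, Finset.sum_comm]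
        refine Finset.sum_congr rfl fun h _ => ?_
        rw [Finset.sum_eq_single (ζ h)]
        · rw [hzU, coeff_single, Finsupp.single_eq_same, one_smul, ← map_smul (wedge (𝒟.e h))]
          refine congrArg _ ?_
          conv_lhs => rw [← hκ (b.1 (inl ((ζ h)⁻¹ * u)))]
          rw [map_smul]
          rfl
        · intro v _ hv
          rw [hzU, coeff_single, Finsupp.single_eq_of_ne hv, zero_smul]
        · simp
      rw [← (𝒟.incl_injective 1).eq_iff, h1, map_zero, 𝒟.sum_smul_wedge_one_eq_zero_iff]
      refine forall_congr' fun i => ⟨fun h => ?_, fun h => by rw [h]⟩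
      rw [← hκ (b.1 (inl ((ζ (𝒟.l i))⁻¹ * u))), h]
      exact hκ _
    refine Iff.trans ?_ (forall_congr' fun u => (hiff u).symm)
    constructor
    · intro h u i
      have hm : ζ (𝒟.l i) / ζ (𝒟.l i * 𝒟.ψ) ∈ A := by
        rw [hAgen]
        exact Subgroup.subset_closure ⟨i, rfl⟩
      rw [← h _ hm]
      rw [← mul_assoc, div_mul_eq_mul_div, mul_inv_cancel, one_div]
    · intro h a ha'
      rw [hAgen] at ha'
      induction ha' using Subgroup.closure_induction with
      | mem a ha' =>
        obtain ⟨i, rfl⟩ := ha'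
        intro u
        have h1 := h (ζ (𝒟.l i) * u) i
        rw [inv_mul_cancel_left] at h1
        rw [h1]
        simp only [ζ, div_eq_inv_mul, mul_assoc]
      | one => simp
      | mul a a' _ _ ha' ha'' =>
        intro u
        rw [mul_assoc, ha', ha'']
      | inv a _ ha' =>
        intro u
        rw [← ha' (a⁻¹ * u), mul_inv_cancel_left]

end DifferenceSystem
end

/-! ### The orbit of the first basis vector under θ -/

noncomputable section


namespace PAdicSpaceGroup

open scoped Matrix

variable (p x : ℕ) [Fact p.Prime]

/-- The automorphism `θ` as a linear endomorphism. -/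
def thetaLin : Module.End ℤ_[p] (T p x) where
  toFun := theta p x
  map_add' := map_add _
  map_smul' c t := by
    funext j
    by_cases h : j = 0
    · simp [theta, companionAut, h, Matrix.mulVec_smul]
    · simp [theta, h]

theorem thetaLin_apply (t : T p x) : thetaLin p x t = theta p x t := rfl

variable {p x}

/-- The vectors of the standard basis of `T`. -/
def unitVec (i : Fin (p ^ (x - 1)) × Fin (p - 1)) : T p x := Pi.single i.1 (Pi.single i.2 1)

theorem unitVec_apply (i : Fin (p ^ (x - 1)) × Fin (p - 1)) (j : Fin (p ^ (x - 1)))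
    (s : Fin (p - 1)) : unitVec i j s = (if (j, s) = i then 1 else 0 : ℤ_[p]) := by
  obtain ⟨a, b⟩ := i
  by_cases h : j = a
  · subst h
    simp [unitVec, Pi.single_apply]
  · simp [unitVec, h]

theorem sum_smul_unitVec (t : T p x) : ∑ i, t i.1 i.2 • unitVec i = t := by
  funext j s
  simp [Finset.sum_apply, unitVec_apply]

theorem thetaLin_single (j : Fin (p ^ (x - 1))) (v : K p) :
    thetaLin p x (Pi.single j v) = Pi.single (j + 1) (if j + 1 = 0 then companion p *ᵥ v else v) := by
  funext i
  rw [thetaLin_apply]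
  simp only [theta, AddEquiv.coe_mk, Equiv.coe_fn_mk, companionAut]
  by_cases h : i = j + 1
  · subst h
    simp
  · have h' : i - 1 ≠ j := fun h' => h (by rw [← h', sub_add_cancel])
    simp [h, h']

theorem thetaLin_pow_single_zero (j : ℕ) (hj : j < p ^ (x - 1)) (v : K p) :
    (thetaLin p x ^ j) (Pi.single 0 v) = Pi.single ⟨j, hj⟩ v := by
  induction j with
  | zero => rfl
  | succ j ih =>
    rw [pow_succ', Module.End.mul_apply, ih (by omega), thetaLin_single]
    have h1 : (⟨j, by omega⟩ : Fin (p ^ (x - 1))) + 1 = ⟨j + 1, hj⟩ := by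
      apply Fin.ext
      rw [Fin.val_add]
      have : ((1 : Fin (p ^ (x - 1))) : ℕ) = 1 := by
        rw [Fin.coe_ofNat_eq_mod]
        exact Nat.mod_eq_of_lt (by omega)
      rw [this]
      exact Nat.mod_eq_of_lt hj
    rw [h1, if_neg]
    intro h
    simpa using congrArg Fin.val h

theorem thetaLin_pow_card_single_zero (v : K p) :
    (thetaLin p x ^ p ^ (x - 1)) (Pi.single 0 v) = Pi.single 0 (companion p *ᵥ v) := by
  obtain ⟨n, hn⟩ : ∃ n, p ^ (x - 1) = n + 1 :=
    Nat.exists_eq_add_one.2 (pow_pos (Fact.out : p.Prime).pos _)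
  have e : (thetaLin p x ^ p ^ (x - 1)) = thetaLin p x * thetaLin p x ^ n := by
    rw [← pow_succ']
    exact congrArg _ hn
  rw [e, Module.End.mul_apply, thetaLin_pow_single_zero n (by omega), thetaLin_single]
  have h1 : (⟨n, by omega⟩ : Fin (p ^ (x - 1))) + 1 = 0 := by
    apply Fin.ext
    rw [Fin.val_add, Fin.coe_ofNat_eq_mod, Nat.add_mod_mod]
    change (n + 1) % _ = 0
    rw [← hn, Nat.mod_self]
  rw [h1, if_pos rfl]

theorem companion_mulVec_single (s : Fin (p - 1)) (i : Fin (p - 1)) :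
    (companion p *ᵥ Pi.single s 1) i =
      if (s : ℕ) + 1 = p - 1 then -1 else if (i : ℕ) = s + 1 then 1 else 0 := by
  simp [companion]

theorem companion_mulVec_single_of_lt (s : ℕ) (hs : s + 1 < p - 1) :
    companion p *ᵥ Pi.single ⟨s, by omega⟩ 1 = Pi.single ⟨s + 1, hs⟩ 1 := by
  funext i
  rw [companion_mulVec_single, if_neg (by simpa using hs.ne)]
  simp [Pi.single_apply, Fin.ext_iff]

theorem companion_mulVec_single_last :
    companion p *ᵥ Pi.single ⟨p - 2, by have := (Fact.out : p.Prime).two_le; omega⟩ 1 =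
      fun _ => -1 := by
  funext i
  rw [companion_mulVec_single, if_pos]
  have := (Fact.out : p.Prime).two_le
  simp only
  omega

variable (p x) in
/-- The first vector of the standard basis. -/
def origin : T p x :=
  unitVec (0, ⟨0, by have := (Fact.out : p.Prime).two_le; omega⟩)

theorem pow_card_mul_origin (s : ℕ) (hs : s < p - 1) :
    (thetaLin p x ^ (p ^ (x - 1) * s)) (origin p x) = unitVec (0, ⟨s, hs⟩) := by
  induction s with
  | zero => rfl
  | succ s ih =>
    rw [Nat.mul_succ, add_comm, pow_add, Module.End.mul_apply, ih (by omega)]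
    simp only [unitVec]
    rw [thetaLin_pow_card_single_zero, companion_mulVec_single_of_lt s hs]

theorem pow_origin (j s : ℕ) (hj : j < p ^ (x - 1)) (hs : s < p - 1) :
    (thetaLin p x ^ (j + p ^ (x - 1) * s)) (origin p x) = unitVec (⟨j, hj⟩, ⟨s, hs⟩) := by
  rw [pow_add, Module.End.mul_apply, pow_card_mul_origin s hs]
  simp only [unitVec]
  rw [thetaLin_pow_single_zero j hj]

theorem pow_last_origin (j : ℕ) (hj : j < p ^ (x - 1)) :
    (thetaLin p x ^ (j + p ^ (x - 1) * (p - 1))) (origin p x) =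
      Pi.single ⟨j, hj⟩ (fun _ => -1) := by
  have h2 := (Fact.out : p.Prime).two_le
  -- The exponent s = p-2 is the last one that gives a basis vector; one further application of the
  -- companion matrix yields minus the sum of the basis of that copy of K.
  have e : p ^ (x - 1) * (p - 1) = p ^ (x - 1) + p ^ (x - 1) * (p - 2) := by
    rw [show p - 1 = p - 2 + 1 by omega, Nat.mul_succ, add_comm]
  rw [e, pow_add, pow_add, Module.End.mul_apply, Module.End.mul_apply,
    pow_card_mul_origin (p - 2) (by omega)]
  simp only [unitVec]
  rw [thetaLin_pow_card_single_zero, companion_mulVec_single_last, thetaLin_pow_single_zero j hj]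

/-- An endomorphism which commutes with `θ` is determined by its value at `origin`. -/
theorem eq_zero_of_apply_origin {α : Module.End ℤ_[p] (T p x)} (hα : Commute α (thetaLin p x))
    (h : α (origin p x) = 0) : α = 0 := by
  refine LinearMap.ext fun t => ?_
  rw [← sum_smul_unitVec t, map_sum, LinearMap.zero_apply]
  refine Finset.sum_eq_zero fun i _ => ?_
  obtain ⟨⟨j, hj⟩, ⟨s, hs⟩⟩ := i
  rw [map_smul, ← pow_origin j s hj hs, ← Module.End.mul_apply, (hα.pow_right _).eq,
    Module.End.mul_apply, h, map_zero, smul_zero]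

/-- It suffices to evaluate at `origin`: the first p-1 terms give the basis of the first copy of K,
and the last gives minus their sum. -/
theorem sum_pow_thetaLin : ∑ s ∈ Finset.range p, (thetaLin p x ^ p ^ (x - 1)) ^ s = 0 := by
  have h2 := (Fact.out : p.Prime).two_le
  refine eq_zero_of_apply_origin ?_ ?_
  · exact Commute.sum_left _ _ _ fun s _ => ((Commute.refl _).pow_left _).pow_left _
  · obtain ⟨n, hn⟩ : ∃ n, p = n + 1 := ⟨p - 1, by omega⟩
    rw [show Finset.range p = Finset.range (p - 1 + 1) by congr; omega, Finset.sum_range_succ,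
      LinearMap.add_apply, LinearMap.sum_apply, ← pow_mul]
    have h1 := pow_last_origin (p := p) (x := x) 0 (pow_pos (Fact.out : p.Prime).pos _)
    rw [zero_add] at h1
    rw [h1, Finset.sum_range]
    simp only [← pow_mul]
    rw [Finset.sum_congr rfl fun (s : Fin (p - 1)) _ => pow_card_mul_origin s.1 s.2]
    funext j i
    have h0 : (⟨0, pow_pos (Fact.out : p.Prime).pos _⟩ : Fin (p ^ (x - 1))) = 0 := rfl
    rw [h0]
    by_cases hj : j = 0
    · subst hj
      simp [Finset.sum_apply, unitVec_apply]
    · simp [Finset.sum_apply, unitVec_apply, hj]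

theorem thetaLin_pow_card : thetaLin p x ^ (p ^ (x - 1) * p) = 1 := by
  have h := geom_sum_mul (thetaLin p x ^ p ^ (x - 1)) p
  rw [sum_pow_thetaLin, zero_mul, ← pow_mul] at h
  exact (sub_eq_zero.1 h.symm)

end PAdicSpaceGroup
end

/-! ### Invariant subgroups are the images of powers of θ - 1 -/

noncomputable section


namespace PAdicSpaceGroup

variable (p x : ℕ) [Fact p.Prime]

/-- The ring of endomorphisms of `T` generated by `θ`. -/
abbrev thetaRing : Subalgebra ℤ (Module.End ℤ_[p] (T p x)) := Algebra.adjoin ℤ {thetaLin p x}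

variable {p x}

theorem thetaLin_mem : thetaLin p x ∈ thetaRing p x := Algebra.subset_adjoin rfl

theorem commute_of_mem_thetaRing {α β : Module.End ℤ_[p] (T p x)} (hα : α ∈ thetaRing p x)
    (hβ : β ∈ thetaRing p x) : Commute α β :=
  Algebra.commute_of_mem_adjoin_singleton_of_commute hβ
    (Algebra.commute_of_mem_adjoin_self hα).symm

theorem sub_one_mem : thetaLin p x - 1 ∈ thetaRing p x :=
  sub_mem thetaLin_mem (one_mem _)

theorem pow_sub_one_mem : thetaLin p x ^ p ^ (x - 1) - 1 ∈ thetaRing p x :=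
  sub_mem (pow_mem thetaLin_mem _) (one_mem _)

/-- The prime `p` is a multiple of `ψ - 1`, where `ψ = θ ^ (p ^ (x - 1))`. -/
theorem exists_pow_sub_one_mul_eq :
    ∃ κ ∈ thetaRing p x, (thetaLin p x ^ p ^ (x - 1) - 1) * κ = p := by
  set ω := thetaLin p x ^ p ^ (x - 1) with hω
  have hm : ω ∈ thetaRing p x := pow_mem thetaLin_mem _
  -- From Σ_{s<p} ω^s = 0 it follows that p = -Σ_{s<p} (ω^s - 1), and each ω^s - 1 is divisible by ω
  -- - 1.
  refine ⟨0 - ∑ s ∈ Finset.range p, ∑ r ∈ Finset.range s, ω ^ r,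
    sub_mem (zero_mem _) (sum_mem fun s _ => sum_mem fun r _ => pow_mem hm r), ?_⟩
  rw [mul_sub, mul_zero, Finset.mul_sum]
  simp only [mul_geom_sum]
  rw [Finset.sum_sub_distrib, sum_pow_thetaLin]
  simp

theorem exists_sub_one_mul_eq : ∃ κ ∈ thetaRing p x, (thetaLin p x - 1) * κ = p := by
  obtain ⟨κ, hκ, h⟩ := exists_pow_sub_one_mul_eq (p := p) (x := x)
  refine ⟨(∑ r ∈ Finset.range (p ^ (x - 1)), thetaLin p x ^ r) * κ,
    mul_mem (sum_mem fun r _ => pow_mem thetaLin_mem r) hκ, ?_⟩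
  rw [← mul_assoc, mul_geom_sum, h]

theorem natCast_pow_apply (n : ℕ) (t : T p x) :
    ((p : Module.End ℤ_[p] (T p x)) ^ n) t = (p ^ n : ℤ_[p]) • t := by
  rw [← Nat.cast_pow, Module.End.natCast_apply, ← Nat.cast_pow, Nat.cast_smul_eq_nsmul]

theorem injective_of_mul_eq {α β : Module.End ℤ_[p] (T p x)} {n : ℕ} (h : β * α = p ^ n) :
    Function.Injective α := by
  refine (injective_iff_map_eq_zero α).2 fun t ht => ?_
  have h1 := LinearMap.congr_fun h t
  rw [Module.End.mul_apply, ht, map_zero, natCast_pow_apply] at h1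
  refine (smul_eq_zero.1 h1.symm).resolve_left (pow_ne_zero _ ?_)
  exact Nat.cast_ne_zero.2 (Fact.out : p.Prime).ne_zero

theorem sub_one_injective : Function.Injective ⇑(thetaLin p x - 1 : Module.End ℤ_[p] (T p x)) := by
  obtain ⟨κ, hκ, h⟩ := exists_sub_one_mul_eq (p := p) (x := x)
  refine injective_of_mul_eq (β := κ) (n := 1) ?_
  rw [(commute_of_mem_thetaRing hκ sub_one_mem).eq, h, pow_one]

variable (p x) in
/-- The sum of the coordinates modulo `p`. -/
def coordSum : T p x →+ ZMod p where
  toFun t := ∑ i : Fin (p ^ (x - 1)) × Fin (p - 1), PadicInt.toZMod (t i.1 i.2)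
  map_zero' := by simp
  map_add' := by simp [Finset.sum_add_distrib]

theorem coordSum_apply (t : T p x) : coordSum p x t = ∑ i : Fin (p ^ (x - 1)) × Fin (p - 1),
    PadicInt.toZMod (t i.1 i.2) := rfl

theorem coordSum_smul (c : ℤ_[p]) (t : T p x) :
    coordSum p x (c • t) = PadicInt.toZMod c * coordSum p x t := by
  simp [coordSum_apply, Finset.mul_sum]

theorem coordSum_unitVec (i) : coordSum p x (unitVec i) = 1 := by
  rw [coordSum_apply, Finset.sum_eq_single i]
  · simp [unitVec_apply]
  · intro j _ hj
    simp [unitVec_apply, hj]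
  · simp

theorem coordSum_pow_origin (n : ℕ) (hn : n < p ^ (x - 1) * p) :
    coordSum p x ((thetaLin p x ^ n) (origin p x)) = 1 := by
  have hq : 0 < p ^ (x - 1) := pow_pos (Fact.out : p.Prime).pos _
  have hp := (Fact.out : p.Prime).two_le
  rw [← Nat.mod_add_div n (p ^ (x - 1))]
  have h1 : n % p ^ (x - 1) < p ^ (x - 1) := Nat.mod_lt _ hq
  have h2 : n / p ^ (x - 1) < p := Nat.div_lt_of_lt_mul hn
  rcases lt_or_eq_of_le (Nat.le_sub_one_of_lt h2) with h | h
  · rw [pow_origin _ _ h1 h, coordSum_unitVec]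
  · rw [h, pow_last_origin _ h1, coordSum_apply, Fintype.sum_prod_type,
      Finset.sum_eq_single ⟨_, h1⟩]
    · simp [Nat.cast_sub (by omega : 1 ≤ p)]
    · intro j _ hj
      simp [hj]
    · simp

/-- Each vector in the orbit of `origin` has coordinate sum 1 modulo p, because -(p-1) = 1 there; θ
sends basis vectors to members of this orbit. -/
theorem coordSum_thetaLin (t : T p x) : coordSum p x (thetaLin p x t) = coordSum p x t := by
  have hp := (Fact.out : p.Prime).two_le
  conv_lhs => rw [← sum_smul_unitVec t]
  conv_rhs => rw [← sum_smul_unitVec t]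
  simp only [map_sum, map_smul, coordSum_smul]
  refine Finset.sum_congr rfl fun i _ => ?_
  obtain ⟨⟨j, hj⟩, ⟨s, hs⟩⟩ := i
  have hlt : j + p ^ (x - 1) * s + 1 < p ^ (x - 1) * p := by
    have h1 : p ^ (x - 1) * (s + 1 + 1) ≤ p ^ (x - 1) * p := Nat.mul_le_mul_left _ (by omega)
    have h2 : p ^ (x - 1) * (s + 1 + 1) = p ^ (x - 1) * s + p ^ (x - 1) + p ^ (x - 1) := by ring
    omega
  rw [← pow_origin j s hj hs, ← Module.End.mul_apply, ← pow_succ', coordSum_pow_origin _ hlt,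
    coordSum_pow_origin _ (by omega)]

variable (p x) in
/-- The image of `(θ - 1) ^ m`. -/
def piPow (m : ℕ) : AddSubgroup (T p x) :=
  (LinearMap.range ((thetaLin p x - 1) ^ m)).toAddSubgroup

theorem mem_piPow {m : ℕ} {t : T p x} :
    t ∈ piPow p x m ↔ ∃ s, ((thetaLin p x - 1) ^ m) s = t := Iff.rfl

theorem piPow_zero : piPow p x 0 = ⊤ := by
  ext t
  simp [mem_piPow]

theorem piPow_succ (m : ℕ) :
    piPow p x (m + 1) = (piPow p x m).map (thetaLin p x - 1).toAddMonoidHom := by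
  ext t
  simp only [mem_piPow, AddSubgroup.mem_map, pow_succ', Module.End.mul_apply]
  simp

/-- Modulo θ - 1 all basis vectors agree with `origin`, so t is congruent to its coordinate sum
times `origin`. If that sum is divisible by p, the remainder is a multiple of θ - 1 too, since p is.
-/
theorem ker_coordSum : (coordSum p x).ker = piPow p x 1 := by
  ext t
  rw [AddMonoidHom.mem_ker, mem_piPow, pow_one]
  constructor
  · intro h
    have key : ∀ n : ℕ, ∃ s, (thetaLin p x - 1) s = (thetaLin p x ^ n) (origin p x) - origin p x := by
      intro n
      refine ⟨(∑ r ∈ Finset.range n, thetaLin p x ^ r) (origin p x), ?_⟩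
      rw [← Module.End.mul_apply, mul_geom_sum]
      rfl
    have key' : ∀ i, ∃ s, (thetaLin p x - 1) s = unitVec i - origin p x := by
      rintro ⟨⟨j, hj⟩, ⟨s, hs⟩⟩
      rw [← pow_origin j s hj hs]
      exact key _
    choose s hs using key'
    obtain ⟨c, hc⟩ : ∃ c : ℤ_[p], ∑ i : Fin (p ^ (x - 1)) × Fin (p - 1), t i.1 i.2 = c * p := by
      have h1 : ∑ i : Fin (p ^ (x - 1)) × Fin (p - 1), t i.1 i.2 ∈
          RingHom.ker (PadicInt.toZMod (p := p)) := by
        rw [RingHom.mem_ker, map_sum, ← coordSum_apply, h]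
      rw [PadicInt.ker_toZMod, PadicInt.maximalIdeal_eq_span_p, Ideal.mem_span_singleton'] at h1
      obtain ⟨c, hc⟩ := h1
      exact ⟨c, hc.symm⟩
    obtain ⟨κ, -, hκ⟩ := exists_sub_one_mul_eq (p := p) (x := x)
    refine ⟨∑ i, t i.1 i.2 • s i + c • κ (origin p x), ?_⟩
    have hκ' := LinearMap.congr_fun hκ (origin p x)
    rw [Module.End.mul_apply, ← pow_one (p : Module.End ℤ_[p] (T p x)), natCast_pow_apply,
      pow_one] at hκ'
    rw [map_add, map_sum, map_smul, hκ']
    simp only [map_smul, hs, smul_sub]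
    rw [Finset.sum_sub_distrib, sum_smul_unitVec, ← Finset.sum_smul, hc, mul_smul, sub_add_cancel]
  · rintro ⟨s, rfl⟩
    rw [LinearMap.sub_apply, map_sub, coordSum_thetaLin, Module.End.one_apply, sub_self]

theorem index_piPow_one : (piPow p x 1).index = p := by
  rw [← ker_coordSum, AddSubgroup.index_ker]
  have : (coordSum p x).range = ⊤ := by
    rw [AddMonoidHom.range_eq_top]
    intro c
    refine ⟨c.val • origin p x, ?_⟩
    rw [map_nsmul, origin, coordSum_unitVec]
    simp
  rw [this]
  simp

theorem index_map_sub_one (N : AddSubgroup (T p x)) :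
    (N.map (thetaLin p x - 1).toAddMonoidHom).index = N.index * p := by
  rw [AddSubgroup.index_map]
  have h1 : (thetaLin p x - 1).toAddMonoidHom.ker = ⊥ :=
    (AddMonoidHom.ker_eq_bot_iff _).2 sub_one_injective
  have h2 : (thetaLin p x - 1).toAddMonoidHom.range = piPow p x 1 := by
    ext t
    rw [mem_piPow, pow_one]
    rfl
  rw [h1, h2, sup_bot_eq, index_piPow_one]

theorem index_piPow (m : ℕ) : (piPow p x m).index = p ^ m := by
  induction m with
  | zero => rw [piPow_zero, AddSubgroup.index_top, pow_zero]
  | succ m ih => rw [piPow_succ, index_map_sub_one, ih, pow_succ]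

/-- Powers of `θ - 1` are divisible by powers of `p`. -/
theorem exists_sub_one_pow_eq (hx : 1 ≤ x) :
    ∃ β : Module.End ℤ_[p] (T p x), (thetaLin p x - 1) ^ p ^ x = p * β := by
  obtain ⟨r, hr⟩ := (Commute.one_right (thetaLin p x - 1)).exists_add_pow_prime_pow_eq
    (Fact.out : p.Prime) x
  have h1 : thetaLin p x ^ p ^ x = 1 := by
    have := thetaLin_pow_card (p := p) (x := x)
    rwa [← pow_succ, Nat.sub_add_cancel hx] at this
  rw [sub_add_cancel, h1, one_pow, mul_one] at hr
  refine ⟨0 - (thetaLin p x - 1) * r, ?_⟩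
  rw [mul_sub, mul_zero, ← mul_assoc, zero_sub, eq_neg_iff_add_eq_zero]
  have h2 : (thetaLin p x - 1) ^ p ^ x + 1 + p * (thetaLin p x - 1) * r = 1 := hr.symm
  have h3 : (thetaLin p x - 1) ^ p ^ x + p * (thetaLin p x - 1) * r =
      (thetaLin p x - 1) ^ p ^ x + 1 + p * (thetaLin p x - 1) * r - 1 := by abel
  rw [h3, h2, sub_self]

/-- A Nakayama argument. Otherwise N + (θ-1)T = T because (θ-1)T has prime index, hence N + (θ-1)^j
T = T for all j, and for large j the second summand lies in N. -/
theorem le_piPow_one (hx : 1 ≤ x) {N : AddSubgroup (T p x)} (hN : ∀ t ∈ N, thetaLin p x t ∈ N)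
    {m : ℕ} (hi : N.index = p ^ (m + 1)) : N ≤ piPow p x 1 := by
  have hp := (Fact.out : p.Prime)
  have hπ : ∀ t ∈ N, (thetaLin p x - 1) t ∈ N := fun t ht => N.sub_mem (hN t ht) ht
  by_contra hle
  have h1 : ∀ t, ∃ n ∈ N, ∃ s, t = n + (thetaLin p x - 1) s := by
    have hlt : piPow p x 1 < N ⊔ piPow p x 1 :=
      lt_of_le_of_ne le_sup_right fun h => hle (h ▸ le_sup_left)
    have h2 : (N ⊔ piPow p x 1).index ∣ p := by
      have := AddSubgroup.index_dvd_of_le hlt.le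
      rwa [index_piPow_one] at this
    have h3 : N ⊔ piPow p x 1 = ⊤ := by
      rcases (Nat.dvd_prime hp).1 h2 with h | h
      · exact AddSubgroup.index_eq_one.1 h
      · exfalso
        have h4 := AddSubgroup.relIndex_mul_index hlt.le
        rw [h, index_piPow_one] at h4
        have h5 : (piPow p x 1).relIndex (N ⊔ piPow p x 1) = 1 :=
          Nat.eq_of_mul_eq_mul_right hp.pos (h4.trans (one_mul p).symm)
        exact hlt.not_ge (AddSubgroup.relIndex_eq_one.1 h5)
    intro t
    obtain ⟨n, hn, s, hs, hns⟩ := AddSubgroup.mem_sup.1 (h3 ▸ AddSubgroup.mem_top t)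
    obtain ⟨s, rfl⟩ := mem_piPow.1 hs
    exact ⟨n, hn, s, by rw [← hns, pow_one]⟩
  have h2 : ∀ (j : ℕ) (t : T p x), ∃ n ∈ N, ∃ s, t = n + ((thetaLin p x - 1) ^ j) s := by
    intro j
    induction j with
    | zero => exact fun t => ⟨0, N.zero_mem, t, by simp⟩
    | succ j ih =>
      intro t
      obtain ⟨n, hn, s, hs⟩ := ih t
      obtain ⟨n', hn', s', rfl⟩ := h1 s
      have hn'' : ∀ j : ℕ, ((thetaLin p x - 1) ^ j) n' ∈ N := by
        intro j
        induction j with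
        | zero => exact hn'
        | succ j ih =>
          rw [pow_succ', Module.End.mul_apply]
          exact hπ _ ih
      refine ⟨n + ((thetaLin p x - 1) ^ j) n', N.add_mem hn (hn'' j), s', ?_⟩
      rw [hs, map_add, pow_succ, Module.End.mul_apply, add_assoc]
  obtain ⟨β, hβ⟩ := exists_sub_one_pow_eq (p := p) hx
  have h3 : N = ⊤ := by
    refine (AddSubgroup.eq_top_iff' N).2 fun t => ?_
    -- As (θ-1)^(p^x) is divisible by p, this power is divisible by p^(m+1), the index of N, and
    -- index multiples lie in N.
    obtain ⟨n, hn, s, rfl⟩ := h2 (p ^ x * (m + 1)) t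
    refine N.add_mem hn ?_
    have hc : Commute (p : Module.End ℤ_[p] (T p x)) β := Nat.cast_commute p β
    rw [pow_mul, hβ, hc.mul_pow, Module.End.mul_apply, ← Nat.cast_pow, Module.End.natCast_apply,
      ← hi]
    exact N.nsmul_index_mem _
  rw [h3, AddSubgroup.index_top] at hi
  exact absurd hi.symm (Nat.one_lt_pow (by omega) hp.one_lt).ne'

/-- A subgroup of index `p ^ m` which is stable under `θ` is the image of `(θ - 1) ^ m`. -/
theorem eq_piPow (hx : 1 ≤ x) (m : ℕ) : ∀ N : AddSubgroup (T p x),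
    (∀ t ∈ N, thetaLin p x t ∈ N) → N.index = p ^ m → N = piPow p x m := by
  induction m with
  | zero =>
    intro N _ hi
    rw [pow_zero, AddSubgroup.index_eq_one] at hi
    rw [hi, piPow_zero]
  | succ m ih =>
    intro N hN hi
    have hle := le_piPow_one hx hN hi
    -- Since N ⊆ (θ-1)T and θ-1 is injective with image of index p, dividing N by θ-1 lowers the
    -- exponent of the index by one.
    let N₁ := N.comap (thetaLin p x - 1).toAddMonoidHom
    have h1 : N₁.map (thetaLin p x - 1).toAddMonoidHom = N := by
      refine le_antisymm (AddSubgroup.map_comap_le _ _) fun t ht => ?_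
      obtain ⟨s, rfl⟩ := mem_piPow.1 (hle ht)
      rw [pow_one] at ht ⊢
      exact ⟨s, ht, rfl⟩
    have h2 : N₁.index = p ^ m := by
      have h3 := index_map_sub_one N₁
      rw [h1, hi, pow_succ] at h3
      exact (Nat.eq_of_mul_eq_mul_right (Fact.out : p.Prime).pos h3).symm
    rw [piPow_succ, ← ih N₁ (fun t ht => ?_) h2, h1]
    have h4 := hN _ ht
    change (thetaLin p x - 1) (thetaLin p x t) ∈ N
    rw [← Module.End.mul_apply, (commute_of_mem_thetaRing sub_one_mem thetaLin_mem).eq]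
    exact h4

theorem map_theta_eq {N : AddSubgroup (T p x)} :
    N.map (theta p x).toAddMonoidHom = N ↔
      (∀ t ∈ N, thetaLin p x t ∈ N) ∧ ∀ t, thetaLin p x t ∈ N → t ∈ N := by
  constructor
  · intro h
    refine ⟨fun t ht => ?_, fun t ht => ?_⟩
    · rw [← h]
      exact ⟨t, ht, rfl⟩
    · rw [← h] at ht
      obtain ⟨s, hs, hst⟩ := ht
      rwa [← (theta p x).injective hst]
  · rintro ⟨h1, h2⟩
    refine le_antisymm ?_ fun t ht => ?_
    · rintro _ ⟨t, ht, rfl⟩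
      exact h1 t ht
    · refine ⟨(theta p x).symm t, h2 _ ?_, (theta p x).apply_symm_apply t⟩
      rw [thetaLin_apply, AddEquiv.apply_symm_apply]
      exact ht

theorem map_theta_piPow (m : ℕ) :
    (piPow p x m).map (theta p x).toAddMonoidHom = piPow p x m := by
  have hc : ∀ t, thetaLin p x (((thetaLin p x - 1) ^ m) t) =
      ((thetaLin p x - 1) ^ m) (thetaLin p x t) := LinearMap.congr_fun
    (commute_of_mem_thetaRing thetaLin_mem (pow_mem sub_one_mem m)).eq
  refine map_theta_eq.2 ⟨?_, ?_⟩
  · rintro _ ⟨t, rfl⟩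
    exact ⟨thetaLin p x t, (hc t).symm⟩
  · rintro t ⟨s, hs⟩
    refine ⟨(theta p x).symm s, (theta p x).injective ?_⟩
    rw [← thetaLin_apply, hc, thetaLin_apply, AddEquiv.apply_symm_apply, hs]
    rfl

/-- For every `m` there is exactly one invariant subgroup of index `p ^ m`. -/
theorem existsUnique_invariantSubgroup (hx : 1 ≤ x) (m : ℕ) :
    ∃! N : InvariantSubgroup p x, N.1.index = p ^ m := by
  refine ⟨⟨piPow p x m, map_theta_piPow m⟩, index_piPow m, fun N hN => Subtype.ext ?_⟩
  exact eq_piPow hx m N.1 (map_theta_eq.1 N.2).1 hN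

/-- The multiples of `p` form the image of `(θ - 1) ^ d`. -/
theorem piPow_dim (hx : 1 ≤ x) (t : T p x) :
    t ∈ piPow p x (dim p x) ↔ ∃ s, t = (p : ℤ_[p]) • s := by
  let f : T p x →+ (Fin (p ^ (x - 1)) → Fin (p - 1) → ZMod p) :=
    { toFun t j s := PadicInt.toZMod (t j s)
      map_zero' := by ext; simp
      map_add' s t := by ext; simp }
  have hker : ∀ t, t ∈ f.ker ↔ ∃ s, t = (p : ℤ_[p]) • s := by
    intro t
    constructor
    · intro h
      have h1 : ∀ j s, ∃ c, c * (p : ℤ_[p]) = t j s := by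
        intro j s
        rw [← Ideal.mem_span_singleton', ← PadicInt.maximalIdeal_eq_span_p, ← PadicInt.ker_toZMod]
        exact congrFun (congrFun h j) s
      choose c hc using h1
      refine ⟨c, funext fun j => funext fun s => ?_⟩
      rw [← hc, mul_comm]
      rfl
    · rintro ⟨s, rfl⟩
      rw [AddMonoidHom.mem_ker]
      funext j i
      simp [f]
  have hstab : ∀ t ∈ f.ker, thetaLin p x t ∈ f.ker := by
    intro t ht
    obtain ⟨s, rfl⟩ := (hker t).1 ht
    exact (hker _).2 ⟨thetaLin p x s, map_smul _ _ _⟩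
  have hidx : f.ker.index = p ^ dim p x := by
    have hs : Function.Surjective f := fun c =>
      ⟨fun j s => ((c j s).val : ℤ_[p]), by ext; simp [f]⟩
    rw [AddSubgroup.index_ker, AddMonoidHom.range_eq_top.2 hs]
    simp [dim, pow_mul]
  rw [← eq_piPow hx _ f.ker hstab hidx, hker]

end PAdicSpaceGroup
end

/-! ### The point group and its difference system -/

noncomputable section


namespace PAdicSpaceGroup

variable (p x : ℕ) [Fact p.Prime]

instance commGroupPoint : CommGroup (P p x) where
  mul_comm := by
    rintro ⟨_, m, rfl⟩ ⟨_, n, rfl⟩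
    exact Subtype.ext ((Commute.refl (thetaMul p x)).zpow_zpow m n).eq

instance decidableEqPoint : DecidableEq (P p x) := Classical.decEq _

/-- The generator `θ` of the point group. -/
def gen : P p x := ⟨thetaMul p x, Subgroup.mem_zpowers _⟩

variable {p x}

theorem gen_pow_apply (n : ℕ) (t : T p x) :
    Multiplicative.toAdd ((gen p x ^ n).1 (Multiplicative.ofAdd t)) = (thetaLin p x ^ n) t := by
  induction n with
  | zero => rfl
  | succ n ih =>
    rw [pow_succ', pow_succ', Module.End.mul_apply, ← ih]
    rfl

theorem gen_pow_card : gen p x ^ p ^ (x - 1 + 1) = 1 := by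
  refine Subtype.ext (MulEquiv.ext fun t => ?_)
  have h := gen_pow_apply (p := p) (x := x) (p ^ (x - 1 + 1)) (Multiplicative.toAdd t)
  rw [pow_succ, thetaLin_pow_card] at h
  exact h

theorem orderOf_gen : orderOf (gen p x) = p ^ (x - 1 + 1) := by
  have hp := (Fact.out : p.Prime).two_le
  have hq : 0 < p ^ (x - 1) := pow_pos (Fact.out : p.Prime).pos _
  refine orderOf_eq_prime_pow (fun h => ?_) gen_pow_card
  have h1 := gen_pow_apply (p := p) (x := x) (p ^ (x - 1)) (origin p x)
  rw [h] at h1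
  change origin p x = _ at h1
  have h2 := congrFun (congrFun h1 0) ⟨0, by omega⟩
  -- For p = 2 the lattice K has rank one and ψ sends `origin` to its negative; for odd p it sends
  -- it to another basis vector.
  rcases eq_or_lt_of_le hp with rfl | hp
  · have h3 := pow_last_origin (p := 2) (x := x) 0 hq
    simp only [zero_add, Nat.add_one_sub_one, mul_one] at h3
    rw [h3, origin, unitVec_apply] at h2
    have h0 : (⟨0, hq⟩ : Fin (2 ^ (x - 1))) = 0 := rfl
    rw [h0] at h2
    simp only [Pi.single_eq_same] at h2
    norm_num at h2
  · have h3 := pow_origin (p := p) (x := x) 0 1 hq (by omega)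
    rw [zero_add, mul_one] at h3
    rw [h3, origin, unitVec_apply, unitVec_apply] at h2
    simp at h2

instance finite_point : Finite (P p x) := by
  have h : IsOfFinOrder (thetaMul p x) := by
    refine isOfFinOrder_iff_pow_eq_one.2 ⟨p ^ (x - 1 + 1), pow_pos (Fact.out : p.Prime).pos _, ?_⟩
    exact congrArg Subtype.val (gen_pow_card (p := p) (x := x))
  exact (finite_zpowers.2 h).to_subtype

theorem exists_gen_pow (g : P p x) :
    ∃ j s, j < p ^ (x - 1) ∧ s < p ∧ g = gen p x ^ (j + p ^ (x - 1) * s) := by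
  have hq : 0 < p ^ (x - 1) := pow_pos (Fact.out : p.Prime).pos _
  have hpq : 0 < p ^ (x - 1 + 1) := pow_pos (Fact.out : p.Prime).pos _
  have h1 : ∃ m : ℤ, g = gen p x ^ m := by
    obtain ⟨_, m, rfl⟩ := g
    exact ⟨m, Subtype.ext rfl⟩
  obtain ⟨m, rfl⟩ := h1
  obtain ⟨n, hn, h⟩ : ∃ n : ℕ, n < p ^ (x - 1 + 1) ∧ gen p x ^ m = gen p x ^ n := by
    refine ⟨(m % (p ^ (x - 1 + 1) : ℕ)).toNat, ?_, ?_⟩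
    · have := Int.emod_lt_of_pos m (Int.natCast_pos.2 hpq)
      have := Int.emod_nonneg m (Int.natCast_pos.2 hpq).ne'
      omega
    · rw [← zpow_natCast, Int.toNat_of_nonneg (Int.emod_nonneg m (Int.natCast_pos.2 hpq).ne'),
        ← orderOf_gen, zpow_mod_orderOf]
  refine ⟨n % p ^ (x - 1), n / p ^ (x - 1), Nat.mod_lt _ hq, ?_, ?_⟩
  · rw [pow_succ] at hn
    exact Nat.div_lt_of_lt_mul hn
  · rw [Nat.mod_add_div, h]

variable (p x) in
/-- The action of the point group on the translation group. -/
def pointRep : P p x →* Module.End ℤ_[p] (T p x) where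
  toFun g :=
    { toFun := fun t => Multiplicative.toAdd (g.1 (Multiplicative.ofAdd t))
      map_add' := fun s t => map_mul g.1 _ _
      map_smul' := fun c t => by
        obtain ⟨j, s, -, -, rfl⟩ := exists_gen_pow g
        rw [gen_pow_apply, gen_pow_apply]
        exact map_smul _ _ _ }
  map_one' := rfl
  map_mul' _ _ := rfl

theorem pointRep_gen_pow (n : ℕ) : pointRep p x (gen p x ^ n) = thetaLin p x ^ n :=
  LinearMap.ext fun t => gen_pow_apply n t

theorem pointRep_mem (g : P p x) : pointRep p x g ∈ thetaRing p x := by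
  obtain ⟨j, s, -, -, rfl⟩ := exists_gen_pow g
  rw [pointRep_gen_pow]
  exact pow_mem thetaLin_mem _

variable (p x) in
/-- The element of order `p` of the point group. -/
def psi : P p x := gen p x ^ p ^ (x - 1)

variable (p x) in
/-- The index set of the standard basis of `T`. -/
abbrev Idx : Type := Fin (p ^ (x - 1)) ×ₗ Fin (p - 1)

/-- The element of the point group which sends `origin` to a vector of the standard basis. -/
def idxElt (i : Idx p x) : P p x :=
  gen p x ^ ((ofLex i).1.1 + p ^ (x - 1) * (ofLex i).2.1)

theorem pointRep_idxElt (i : Idx p x) :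
    pointRep p x (idxElt i) (origin p x) = unitVec (ofLex i) := by
  rw [idxElt, pointRep_gen_pow, pow_origin _ _ (ofLex i).1.2 (ofLex i).2.2]

/-- The coordinates of `T`, modulo `p`. -/
def coordMod (i : Fin (p ^ (x - 1)) × Fin (p - 1)) : T p x →+ ZMod p where
  toFun t := PadicInt.toZMod (t i.1 i.2)
  map_zero' := by simp
  map_add' := by simp

theorem coordMod_apply (i : Fin (p ^ (x - 1)) × Fin (p - 1)) (t : T p x) :
    coordMod i t = PadicInt.toZMod (t i.1 i.2) := rfl

theorem exists_eq_natCast_add (n : ℕ) (a : ℤ_[p]) : ∃ (m : ℕ) (b : ℤ_[p]), a = m + p ^ n * b := by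
  obtain ⟨b, hb⟩ := Ideal.mem_span_singleton'.1 (PadicInt.appr_spec n a)
  exact ⟨a.appr n, b, by rw [mul_comm, hb]; ring⟩

theorem map_p_smul (f : T p x →+ ZMod p) (t : T p x) : f ((p : ℤ_[p]) • t) = 0 := by
  rw [Nat.cast_smul_eq_nsmul, map_nsmul]
  simp

/-- An additive map to 𝔽_p kills pT, so it is automatically compatible with p-adic scalars, each
being an integer modulo p. -/
theorem map_padic_smul (f : T p x →+ ZMod p) (a : ℤ_[p]) (t : T p x) :
    f (a • t) = PadicInt.toZMod a * f t := by
  obtain ⟨m, b, rfl⟩ := exists_eq_natCast_add 1 a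
  rw [add_smul, map_add, pow_one, mul_smul, map_p_smul, Nat.cast_smul_eq_nsmul, map_nsmul]
  simp

/-- Among the orbit vectors only two have a nonzero first coordinate: `origin` itself and
ψ^(p-1)·`origin` = ψ⁻¹·`origin`, which is minus the sum of the basis of the first copy of K. -/
theorem coordMod_origin (g : P p x) :
    coordMod (0, ⟨0, by have := (Fact.out : p.Prime).two_le; omega⟩)
      (pointRep p x g (origin p x)) =
      (if g = 1 then 1 else 0) - (if g * psi p x = 1 then 1 else 0) := by
  have hp := (Fact.out : p.Prime).two_le
  have hq : 0 < p ^ (x - 1) := pow_pos (Fact.out : p.Prime).pos _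
  obtain ⟨j, s, hj, hs, rfl⟩ := exists_gen_pow g
  have h1 : gen p x ^ (j + p ^ (x - 1) * s) = 1 ↔ j = 0 ∧ s = 0 := by
    rw [← orderOf_dvd_iff_pow_eq_one, orderOf_gen]
    constructor
    · intro h
      have h0 : j + p ^ (x - 1) * s = 0 := by
        refine Nat.eq_zero_of_dvd_of_lt h ?_
        have : p ^ (x - 1) * (s + 1) ≤ p ^ (x - 1) * p := Nat.mul_le_mul_left _ hs
        rw [pow_succ]
        rw [Nat.mul_succ] at this
        omega
      have h2 : p ^ (x - 1) * s = 0 := by omega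
      exact ⟨by omega, (Nat.mul_eq_zero.1 h2).resolve_left hq.ne'⟩
    · rintro ⟨rfl, rfl⟩
      simp
  have h2 : gen p x ^ (j + p ^ (x - 1) * s) * psi p x = 1 ↔ j = 0 ∧ s = p - 1 := by
    rw [psi, ← pow_add, ← orderOf_dvd_iff_pow_eq_one, orderOf_gen, pow_succ]
    constructor
    · intro h
      have h3 : p ^ (x - 1) ∣ j := by
        have h4 : p ^ (x - 1) ∣ j + p ^ (x - 1) * (s + 1) := by
          rw [Nat.mul_succ, ← add_assoc]
          exact (dvd_mul_right _ _).trans h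
        exact (Nat.dvd_add_left (dvd_mul_right _ _)).1 h4
      obtain rfl := Nat.eq_zero_of_dvd_of_lt h3 hj
      rw [zero_add, ← Nat.mul_succ] at h
      have h5 := Nat.le_of_dvd (by omega) (Nat.dvd_of_mul_dvd_mul_left hq h)
      exact ⟨rfl, by omega⟩
    · rintro ⟨rfl, rfl⟩
      rw [zero_add, ← Nat.mul_succ]
      simp [show p - 1 + 1 = p by omega]
  rw [pointRep_gen_pow, coordMod_apply]
  simp only [h1, h2]
  rcases lt_or_eq_of_le (Nat.le_sub_one_of_lt hs) with h | rfl
  · rw [pow_origin j s hj h, unitVec_apply]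
    by_cases hj0 : j = 0
    · subst hj0
      by_cases hs0 : s = 0
      · subst hs0
        rw [if_pos (by rfl)]
        simp [show ¬ 0 = p - 1 by omega]
      · have : ¬ ((0 : Fin (p ^ (x - 1))), (⟨0, by omega⟩ : Fin (p - 1))) = (⟨0, hj⟩, ⟨s, h⟩) := by
          simp only [Prod.mk.injEq, Fin.mk.injEq, not_and]
          omega
        simp [Ne.symm hs0, hs0, h.ne]
    · have : ¬ ((0 : Fin (p ^ (x - 1))), (⟨0, by omega⟩ : Fin (p - 1))) = (⟨j, hj⟩, ⟨s, h⟩) := by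
        simp only [Prod.mk.injEq, Fin.ext_iff, Fin.val_zero]
        omega
      simp [this, hj0]
  · rw [pow_last_origin j hj]
    by_cases hj0 : j = 0
    · subst hj0
      have h0 : (⟨0, hj⟩ : Fin (p ^ (x - 1))) = 0 := rfl
      rw [h0]
      simp [show ¬ p - 1 = 0 by omega]
    · have : (0 : Fin (p ^ (x - 1))) ≠ ⟨j, hj⟩ := by
        simp only [ne_eq, Fin.ext_iff, Fin.val_zero]
        omega
      simp [this, hj0]

variable (p x) in
/-- The action of the point group on the characters of `T` modulo `p`. -/
def dualRep : Representation (ZMod p) (P p x) (T p x →+ ZMod p) where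
  toFun g :=
    { toFun := fun f => f.comp (pointRep p x g⁻¹).toAddMonoidHom
      map_add' := fun _ _ => rfl
      map_smul' := fun _ _ => rfl }
  map_one' := by
    ext f t
    simp
  map_mul' g h := by
    refine LinearMap.ext fun f => AddMonoidHom.ext fun t => ?_
    change f (pointRep p x (g * h)⁻¹ t) = f (pointRep p x h⁻¹ (pointRep p x g⁻¹ t))
    rw [mul_inv_rev, map_mul, Module.End.mul_apply]

variable (p x) in
/-- A homomorphism from `T` to `𝔽_p` is given by its values at the standard basis. -/
def dualEquiv : (T p x →+ ZMod p) ≃ₗ[ZMod p] (Idx p x → ZMod p) where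
  toFun f i := f (unitVec (ofLex i))
  map_add' _ _ := rfl
  map_smul' _ _ := rfl
  invFun c := ∑ i : Idx p x, c i • coordMod (ofLex i)
  left_inv f := by
    refine AddMonoidHom.ext fun t => ?_
    conv_rhs => rw [← sum_smul_unitVec t]
    rw [map_sum, AddMonoidHom.finsetSum_apply]
    refine Fintype.sum_equiv ofLex _ _ fun i => ?_
    rw [map_padic_smul, mul_comm]
    rfl
  right_inv c := by
    funext i
    change (∑ i : Idx p x, c i • coordMod (ofLex i)) (unitVec (ofLex i)) = c i
    rw [AddMonoidHom.finsetSum_apply, Finset.sum_eq_single i]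
    · simp [coordMod_apply, unitVec_apply]
    · intro j _ hj
      have : ¬ ofLex j = ofLex i := fun h => hj (ofLex.injective h)
      simp [coordMod_apply, unitVec_apply, this]
    · simp

variable (p x) in
/-- The characters of `T` modulo `p`, with the orbit of the first coordinate and the evaluations at
the orbit of `origin`. -/
def differenceSystem : DifferenceSystem (ZMod p) (P p x) (T p x →+ ZMod p) (Idx p x) where
  ρ := dualRep p x
  ψ := psi p x
  e h := dualRep p x h
    (coordMod (0, ⟨0, by have := (Fact.out : p.Prime).two_le; omega⟩))
  ev h :=
    { toFun := fun f => f (pointRep p x h (origin p x))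
      map_add' := fun _ _ => rfl
      map_smul' := fun _ _ => rfl }
  l := idxElt
  basis := Module.Basis.ofEquivFun (dualEquiv p x)
  ρ_e g h := by rw [map_mul, Module.End.mul_apply]
  ev_ρ g h := by
    ext f
    change f (pointRep p x g⁻¹ (pointRep p x (g * h) (origin p x))) =
      f (pointRep p x h (origin p x))
    rw [← Module.End.mul_apply, ← map_mul, inv_mul_cancel_left]
  ev_e y h := by
    change coordMod _ (pointRep p x h⁻¹ (pointRep p x y (origin p x))) = _
    rw [← Module.End.mul_apply, ← map_mul, coordMod_origin, mul_assoc]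
    simp only [inv_mul_eq_one]
  basis_repr i f := by
    change f (unitVec (ofLex i)) = f (pointRep p x (idxElt i) (origin p x))
    rw [pointRep_idxElt]

end PAdicSpaceGroup
end

/-! ### Group ring relations and their linearization -/

noncomputable section


/-- The action by automorphisms given by an action of a group by endomorphisms. -/
def MonoidHom.toMulAut {G M : Type} [Group G] [AddCommGroup M] (f : G →* AddMonoid.End M) :
    G →* MulAut (Multiplicative M) where
  toFun g :=
    { toFun := fun m => Multiplicative.ofAdd (f g (Multiplicative.toAdd m))
      invFun := fun m => Multiplicative.ofAdd (f g⁻¹ (Multiplicative.toAdd m))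
      left_inv := fun m => by
        change Multiplicative.ofAdd ((f g⁻¹ * f g) (Multiplicative.toAdd m)) = m
        rw [← map_mul, inv_mul_cancel, map_one]
        rfl
      right_inv := fun m => by
        change Multiplicative.ofAdd ((f g * f g⁻¹) (Multiplicative.toAdd m)) = m
        rw [← map_mul, mul_inv_cancel, map_one]
        rfl
      map_mul' := fun a b => map_add (f g) _ _ }
  map_one' := by
    ext m
    simp
  map_mul' g h := by
    ext m
    exact DFunLike.congr_fun (map_mul f g h) (Multiplicative.toAdd m)

theorem MonoidAlgebra.exists_sum_mul_eq_single_sub_one {k L ι : Type} [CommRing k] [CommGroup L]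
    [Fintype ι] (a b : ι → L) {w : L}
    (hw : w ∈ Subgroup.closure (Set.range fun i => a i / b i)) :
    ∃ c : ι → MonoidAlgebra k L,
      ∑ i, c i * (single (a i) 1 - single (b i) 1) = single w 1 - 1 := by
  rw [← Ideal.mem_span_range_iff_exists_fun]
  induction hw using Subgroup.closure_induction with
  | mem w hw =>
    obtain ⟨i, rfl⟩ := hw
    have h : (single (a i / b i) 1 - 1 : MonoidAlgebra k L) =
        single (b i)⁻¹ 1 * (single (a i) 1 - single (b i) 1) := by
      rw [mul_sub, single_mul_single, single_mul_single, mul_one, inv_mul_cancel, one_def,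
        div_eq_inv_mul]
    dsimp only
    rw [h]
    exact Ideal.mul_mem_left _ _ (Ideal.subset_span ⟨i, rfl⟩)
  | one => rw [one_def, sub_self]; exact zero_mem _
  | mul u v _ _ hu hv =>
    have h : (single (u * v) 1 - 1 : MonoidAlgebra k L) =
        single u 1 * (single v 1 - 1) + (single u 1 - 1) := by
      rw [mul_sub, single_mul_single, mul_one, mul_one]
      abel
    rw [h]
    exact add_mem (Ideal.mul_mem_left _ _ hv) hu
  | inv u _ hu =>
    have h : (single u⁻¹ 1 - 1 : MonoidAlgebra k L) = -single u⁻¹ 1 * (single u 1 - 1) := by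
      rw [neg_mul, mul_sub, single_mul_single, mul_one, mul_one, inv_mul_cancel, one_def]
      abel
    rw [h]
    exact Ideal.mul_mem_left _ _ hu

/-- A relation between differences of group elements gives a relation between the values of a
homomorphism to the additive group of the coefficients. -/
theorem MonoidAlgebra.sum_augmentation_mul_eq {k L ι : Type} [Field k] [CommGroup L]
    [Fintype ι] (a b : ι → L) {w : L} (c : ι → MonoidAlgebra k L)
    (hc : ∑ i, c i * (single (a i) 1 - single (b i) 1) = single w 1 - 1)
    (f : Additive L →+ k) :
    ∑ i, augmentation k L (c i) * (f (Additive.ofMul (a i)) - f (Additive.ofMul (b i))) =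
      f (Additive.ofMul w) := by
  -- The homomorphism l ↦ 1 + ε f(l) extends to the group ring. The ε-part of the relation is the
  -- claim, since both factors a_i - b_i and w - 1 have no constant part.
  let F : L →* DualNumber k :=
    { toFun := fun l => 1 + TrivSqZeroExt.inr (f (Additive.ofMul l))
      map_one' := by simp
      map_mul' := fun u v => by
        rw [ofMul_mul, map_add, TrivSqZeroExt.inr_add, mul_add, add_mul, add_mul,
          TrivSqZeroExt.inr_mul_inr]
        simp
        abel }
  let D := lift k (DualNumber k) L F
  have hD : ∀ l, D (single l 1) = 1 + TrivSqZeroExt.inr (f (Additive.ofMul l)) := fun l => by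
    simp [D, F]
  have hfst : ∀ y, (D y).fst = augmentation k L y := by
    have : (TrivSqZeroExt.fstHom k k k).comp D = augmentation k L := by
      refine MonoidAlgebra.algHom_ext (fun l => ?_) (Subsingleton.elim _ _)
      rw [AlgHom.comp_apply, hD]
      simp [augmentation_single]
    exact fun y => DFunLike.congr_fun this y
  have h := congrArg (fun y => (D y).snd) hc
  simp only [map_sum, map_mul, map_sub, hD, map_one, add_sub_cancel_left,
    add_sub_add_left_eq_sub] at h
  have h2 : ∀ y : DualNumber k, y.snd = TrivSqZeroExt.sndHom k k y := fun _ => rfl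
  rw [h2, map_sum] at h
  simpa [hfst] using h
end

/-! ### The lattice of integer vectors -/

noncomputable section


namespace PAdicSpaceGroup

variable {p x : ℕ} [Fact p.Prime]

variable (p x) in
/-- The vectors with integer coordinates. -/
def intLattice : AddSubgroup (T p x) where
  carrier := {t | ∀ j s, ∃ m : ℤ, t j s = m}
  zero_mem' _ _ := ⟨0, by simp⟩
  add_mem' ha hb j s := by
    obtain ⟨m, hm⟩ := ha j s
    obtain ⟨n, hn⟩ := hb j s
    exact ⟨m + n, by simp [hm, hn]⟩
  neg_mem' ha j s := by
    obtain ⟨m, hm⟩ := ha j s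
    exact ⟨-m, by simp [hm]⟩

theorem unitVec_mem_intLattice (i) : unitVec i ∈ intLattice p x := fun j s => by
  rw [unitVec_apply]
  split_ifs
  exacts [⟨1, by simp⟩, ⟨0, by simp⟩]

theorem exists_sum_zsmul_unitVec {t : T p x} (ht : t ∈ intLattice p x) :
    ∃ m : Fin (p ^ (x - 1)) × Fin (p - 1) → ℤ, t = ∑ i, m i • unitVec i := by
  choose m hm using ht
  refine ⟨fun i => m i.1 i.2, ?_⟩
  conv_lhs => rw [← sum_smul_unitVec t]
  simp only [hm, Int.cast_smul_eq_zsmul]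

theorem pow_origin_mem_intLattice (n : ℕ) (hn : n < p ^ (x - 1) * p) :
    (thetaLin p x ^ n) (origin p x) ∈ intLattice p x := by
  have hq : 0 < p ^ (x - 1) := pow_pos (Fact.out : p.Prime).pos _
  rw [← Nat.mod_add_div n (p ^ (x - 1))]
  have h1 : n % p ^ (x - 1) < p ^ (x - 1) := Nat.mod_lt _ hq
  have h2 : n / p ^ (x - 1) < p := Nat.div_lt_of_lt_mul hn
  rcases lt_or_eq_of_le (Nat.le_sub_one_of_lt h2) with h | h
  · rw [pow_origin _ _ h1 h]
    exact unitVec_mem_intLattice _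
  · rw [h, pow_last_origin _ h1]
    intro j s
    by_cases hj : j = ⟨n % p ^ (x - 1), h1⟩
    · subst hj
      exact ⟨-1, by simp⟩
    · exact ⟨0, by simp [hj]⟩

theorem thetaLin_mem_intLattice {t : T p x} (ht : t ∈ intLattice p x) :
    thetaLin p x t ∈ intLattice p x := by
  have hp := (Fact.out : p.Prime).two_le
  obtain ⟨m, rfl⟩ := exists_sum_zsmul_unitVec ht
  rw [map_sum]
  refine sum_mem fun i _ => ?_
  rw [map_zsmul]
  refine zsmul_mem ?_ _
  obtain ⟨⟨j, hj⟩, ⟨s, hs⟩⟩ := i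
  have hlt : j + p ^ (x - 1) * s + 1 < p ^ (x - 1) * p := by
    have h1 : p ^ (x - 1) * (s + 1 + 1) ≤ p ^ (x - 1) * p := Nat.mul_le_mul_left _ (by omega)
    have h2 : p ^ (x - 1) * (s + 1 + 1) = p ^ (x - 1) * s + p ^ (x - 1) + p ^ (x - 1) := by ring
    omega
  rw [← pow_origin j s hj hs, ← Module.End.mul_apply, ← pow_succ']
  exact pow_origin_mem_intLattice _ hlt

/-- This is why `thetaRing` is generated over ℤ rather than over ℤ_p. -/
theorem apply_mem_intLattice {α : Module.End ℤ_[p] (T p x)} (hα : α ∈ thetaRing p x) :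
    ∀ {t : T p x}, t ∈ intLattice p x → α t ∈ intLattice p x := by
  induction hα using Algebra.adjoin_induction with
  | mem α hα =>
    obtain rfl := hα
    exact thetaLin_mem_intLattice
  | algebraMap m =>
    intro t ht
    have : algebraMap ℤ (Module.End ℤ_[p] (T p x)) m t = m • t := by simp
    rw [this]
    exact zsmul_mem ht m
  | add α β _ _ hα hβ => exact fun ht => add_mem (hα ht) (hβ ht)
  | mul α β _ _ hα hβ => exact fun ht => hα (hβ ht)

variable (p x) in
/-- The group of vectors with integer coordinates, written multiplicatively. -/
abbrev Lat : Type := Multiplicative (intLattice p x)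

/-- The action of an element of the ring generated by `θ` on the vectors with integer
coordinates. -/
def latEnd (α : thetaRing p x) : AddMonoid.End (intLattice p x) :=
  (α.1.toAddMonoidHom.comp (intLattice p x).subtype).codRestrict _
    fun t => apply_mem_intLattice α.2 t.2

variable (p x) in
/-- The action of the point group on the vectors with integer coordinates. -/
def latAut : P p x →* MulAut (Lat p x) := MonoidHom.toMulAut
  { toFun := fun g => latEnd ⟨pointRep p x g, pointRep_mem g⟩
    map_one' := by
      refine AddMonoidHom.ext fun t => Subtype.ext ?_
      exact LinearMap.congr_fun (map_one (pointRep p x)) t.1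
    map_mul' := fun g h => by
      refine AddMonoidHom.ext fun t => Subtype.ext ?_
      exact LinearMap.congr_fun (map_mul (pointRep p x) g h) t.1 }

/-- The underlying vector. -/
def Lat.vec (t : Lat p x) : T p x := (Multiplicative.toAdd t : intLattice p x)

theorem Lat.vec_injective : Function.Injective (Lat.vec (p := p) (x := x)) :=
  fun _ _ h => Subtype.ext h

theorem Lat.vec_div (s t : Lat p x) : (s / t).vec = s.vec - t.vec := rfl

/-- The action of an element of the ring generated by `θ`, written multiplicatively. -/
def latHom (α : thetaRing p x) : Lat p x →* Lat p x := AddMonoidHom.toMultiplicative (latEnd α)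

theorem vec_latHom (α : thetaRing p x) (t : Lat p x) : (latHom α t).vec = α.1 t.vec := rfl

theorem vec_latAut (g : P p x) (t : Lat p x) : (latAut p x g t).vec = pointRep p x g t.vec := rfl

/-- The standard basis. -/
def latVec (i : Idx p x) : Lat p x :=
  Multiplicative.ofAdd ⟨unitVec (ofLex i), unitVec_mem_intLattice _⟩

theorem closure_latVec : Subgroup.closure (Set.range (latVec (p := p) (x := x))) = ⊤ := by
  refine (Subgroup.eq_top_iff' _).2 fun t => ?_
  obtain ⟨m, hm⟩ := exists_sum_zsmul_unitVec (Multiplicative.toAdd t).2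
  have h : t = ∏ i : Idx p x, latVec i ^ m (ofLex i) := by
    apply Multiplicative.toAdd.injective
    apply Subtype.ext
    rw [hm, toAdd_prod, AddSubgroup.val_finsetSum]
    exact (Fintype.sum_equiv ofLex _ _ fun i => rfl).symm
  rw [h]
  exact Subgroup.prod_mem _ fun i _ =>
    zpow_mem (Subgroup.subset_closure (Set.mem_range_self i)) _

theorem range_eq_closure {G : Type} [CommGroup G] (F : Lat p x →* G) (a : Idx p x → G)
    (ha : ∀ i, a i = (F (latVec i))⁻¹) : F.range = Subgroup.closure (Set.range a) := by
  have h : a = fun i => (F (latVec i))⁻¹ := funext ha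
  rw [MonoidHom.range_eq_map, ← closure_latVec, MonoidHom.map_closure, h, ← Subgroup.closure_inv,
    ← Set.range_comp]
  congr 1
  ext y
  simp [inv_eq_iff_eq_inv, eq_comm]

end PAdicSpaceGroup
end

/-! ### Isogenies and the finite quotients of T -/

noncomputable section


namespace PAdicSpaceGroup

variable {p x : ℕ} [Fact p.Prime]

/-- An element of the ring generated by `θ` is an isogeny if it divides a power of `p`. -/
def IsIsogeny (α : thetaRing p x) : Prop :=
  ∃ (β : thetaRing p x) (n : ℕ), α.1 * β.1 = (p : Module.End ℤ_[p] (T p x)) ^ n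

theorem thetaRing_commute (α β : thetaRing p x) : Commute α.1 β.1 :=
  commute_of_mem_thetaRing α.2 β.2

theorem IsIsogeny.one : IsIsogeny (1 : thetaRing p x) :=
  ⟨1, 0, by simp⟩

theorem IsIsogeny.mul {α β : thetaRing p x} (hα : IsIsogeny α) (hβ : IsIsogeny β) :
    IsIsogeny (α * β) := by
  obtain ⟨α', m, hm⟩ := hα
  obtain ⟨β', n, hn⟩ := hβ
  refine ⟨β' * α', n + m, ?_⟩
  have hc : Commute (p : Module.End ℤ_[p] (T p x)) α.1 := Nat.cast_commute p _
  calc α.1 * β.1 * (β'.1 * α'.1) = α.1 * (β.1 * β'.1) * α'.1 := by simp only [mul_assoc]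
    _ = _ := by rw [hn, ← (hc.pow_left n).eq, mul_assoc, hm, pow_add]

theorem IsIsogeny.pow {α : thetaRing p x} (hα : IsIsogeny α) (n : ℕ) : IsIsogeny (α ^ n) := by
  induction n with
  | zero => rw [pow_zero]; exact .one
  | succ n ih => rw [pow_succ]; exact ih.mul hα

theorem IsIsogeny.injective {α : thetaRing p x} (hα : IsIsogeny α) : Function.Injective α.1 := by
  obtain ⟨β, n, h⟩ := hα
  exact injective_of_mul_eq ((thetaRing_commute β α).eq.trans h)

theorem IsIsogeny.natCast : IsIsogeny (p : thetaRing p x) :=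
  ⟨1, 1, by simp⟩

variable (p x) in
/-- The element `θ - 1`. -/
def piElt : thetaRing p x := ⟨thetaLin p x - 1, sub_one_mem⟩

variable (p x) in
/-- The element `ψ - 1`. -/
def psiElt : thetaRing p x := ⟨thetaLin p x ^ p ^ (x - 1) - 1, pow_sub_one_mem⟩

theorem isIsogeny_piElt : IsIsogeny (piElt p x) := by
  obtain ⟨κ, hκ, h⟩ := exists_sub_one_mul_eq (p := p) (x := x)
  exact ⟨⟨κ, hκ⟩, 1, by rw [pow_one]; exact h⟩

theorem isIsogeny_psiElt : IsIsogeny (psiElt p x) := by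
  obtain ⟨κ, hκ, h⟩ := exists_pow_sub_one_mul_eq (p := p) (x := x)
  exact ⟨⟨κ, hκ⟩, 1, by rw [pow_one]; exact h⟩

theorem natCast_apply (t : T p x) : ((p : thetaRing p x) : Module.End ℤ_[p] (T p x)) t =
    (p : ℤ_[p]) • t := by
  have h := natCast_pow_apply 1 t
  rw [pow_one, pow_one] at h
  exact h

theorem pointRep_psi : pointRep p x (psi p x) = (psiElt p x).1 + 1 := by
  rw [psi, pointRep_gen_pow, psiElt, sub_add_cancel]

/-- The image of `T` under an element of the ring generated by `θ`. -/
def image (α : thetaRing p x) : AddSubgroup (T p x) := (LinearMap.range α.1).toAddSubgroup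

theorem mem_image {α : thetaRing p x} {t : T p x} : t ∈ image α ↔ ∃ s, α.1 s = t := Iff.rfl

theorem apply_mem_image {α : thetaRing p x} (β : thetaRing p x) {t : T p x} (ht : t ∈ image α) :
    β.1 t ∈ image α := by
  obtain ⟨s, rfl⟩ := ht
  exact ⟨β.1 s, LinearMap.congr_fun (thetaRing_commute α β).eq s⟩

theorem IsIsogeny.exists_pow_smul_mem {α : thetaRing p x} (hα : IsIsogeny α) :
    ∃ n : ℕ, ∀ t : T p x, (p ^ n : ℤ_[p]) • t ∈ image α := by
  obtain ⟨β, n, h⟩ := hα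
  refine ⟨n, fun t => ⟨β.1 t, ?_⟩⟩
  rw [← natCast_pow_apply, ← h]
  rfl

theorem IsIsogeny.finite_quotient (hx : 1 ≤ x) {α : thetaRing p x} (hα : IsIsogeny α) :
    Finite (T p x ⧸ image α) := by
  obtain ⟨n, hn⟩ := hα.exists_pow_smul_mem
  obtain ⟨β, hβ⟩ := exists_sub_one_pow_eq (p := p) hx
  have hle : piPow p x (p ^ x * n) ≤ image α := by
    rintro _ ⟨s, rfl⟩
    have hc : Commute (p : Module.End ℤ_[p] (T p x)) β := Nat.cast_commute p β
    rw [pow_mul, hβ, hc.mul_pow, Module.End.mul_apply, natCast_pow_apply]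
    exact hn _
  have : (image α).FiniteIndex := by
    have h : (piPow p x (p ^ x * n)).FiniteIndex :=
      ⟨by rw [index_piPow]; exact pow_ne_zero _ (Fact.out : p.Prime).ne_zero⟩
    exact AddSubgroup.finiteIndex_of_le hle
  exact AddSubgroup.finite_quotient_of_finiteIndex

theorem IsIsogeny.exists_intLattice_add {α : thetaRing p x} (hα : IsIsogeny α) (t : T p x) :
    ∃ a ∈ intLattice p x, ∃ b ∈ image α, t = a + b := by
  obtain ⟨n, hn⟩ := hα.exists_pow_smul_mem
  have h : ∀ j s, ∃ (m : ℕ) (b : ℤ_[p]), t j s = m + p ^ n * b :=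
    fun j s => exists_eq_natCast_add n (t j s)
  choose m b hb using h
  refine ⟨fun j s => m j s, fun j s => ⟨m j s, by simp⟩, (p ^ n : ℤ_[p]) • b, hn _, ?_⟩
  funext j s
  exact hb j s

/-- A vector has integer coordinates if its multiple by a power of `p` does. -/
theorem mem_intLattice_of_pow_smul {n : ℕ} {t : T p x}
    (h : (p ^ n : ℤ_[p]) • t ∈ intLattice p x) : t ∈ intLattice p x := by
  intro j s
  obtain ⟨m, hm⟩ := h j s
  have h1 : (p ^ n : ℤ_[p]) * t j s = m := hm
  have hp : (p ^ n : ℤ_[p]) ≠ 0 := pow_ne_zero _ (Nat.cast_ne_zero.2 (Fact.out : p.Prime).ne_zero)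
  have h2 : ((p : ℤ) ^ n) ∣ m := by
    have h3 : ‖(m : ℤ_[p])‖ ≤ (p : ℝ) ^ (-n : ℤ) := by
      rw [PadicInt.norm_le_pow_iff_mem_span_pow, ← h1]
      exact Ideal.mul_mem_right _ _ (Ideal.mem_span_singleton_self _)
    exact_mod_cast (PadicInt.norm_int_le_pow_iff_dvd).1 h3
  obtain ⟨c, rfl⟩ := h2
  exact ⟨c, mul_left_cancel₀ hp (by rw [h1]; push_cast; rfl)⟩

variable (p x) in
/-- The vector `origin`, as a vector with integer coordinates. -/
def latOrigin : Lat p x := Multiplicative.ofAdd ⟨origin p x, unitVec_mem_intLattice _⟩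

theorem vec_latOrigin : (latOrigin p x).vec = origin p x := rfl

theorem pointRep_idxElt_mul_psi (i : Idx p x) :
    pointRep p x (idxElt i * psi p x) (origin p x) =
      (psiElt p x).1 (unitVec (ofLex i)) + unitVec (ofLex i) := by
  rw [mul_comm, map_mul, Module.End.mul_apply, pointRep_idxElt, pointRep_psi]
  rfl

/-- Elements of ℤ[θ] commute with the point group, and v - ψv = -(ψ-1)v. -/
theorem latAut_div (α : thetaRing p x) (i : Idx p x) :
    latAut p x (idxElt i) (latHom α (latOrigin p x)) /
      latAut p x (idxElt i * psi p x) (latHom α (latOrigin p x)) =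
      (latHom (α * psiElt p x) (latVec i))⁻¹ := by
  have hc : ∀ (g : P p x) t, pointRep p x g (α.1 t) = α.1 (pointRep p x g t) := fun g =>
    LinearMap.congr_fun (commute_of_mem_thetaRing (pointRep_mem g) α.2).eq
  apply Lat.vec_injective
  rw [Lat.vec_div, vec_latAut, vec_latAut, vec_latHom, vec_latOrigin, hc, hc, pointRep_idxElt,
    pointRep_idxElt_mul_psi, map_add, sub_add_cancel_right]
  rfl

theorem latHom_one (t : Lat p x) : latHom (1 : thetaRing p x) t = t := rfl

theorem latAut_origin_div (i : Idx p x) :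
    latAut p x (idxElt i) (latOrigin p x) / latAut p x (idxElt i * psi p x) (latOrigin p x) =
      (latHom (psiElt p x) (latVec i))⁻¹ := by
  have h := latAut_div 1 i
  rwa [one_mul, latHom_one] at h

/-- A multiple of `p` times `origin` is a product of differences of vectors in the orbit of
`origin`. -/
theorem latHom_natCast_mul_mem_closure (δ : thetaRing p x) :
    latHom ((p : thetaRing p x) * δ) (latOrigin p x) ∈ Subgroup.closure (Set.range fun g : P p x =>
      latAut p x g (latOrigin p x) / latAut p x (g * psi p x) (latOrigin p x)) := by
  -- As p = (ψ-1)κ, the vector pδ·`origin` lies in (ψ-1)L, and (ψ-1)L is generated by the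
  -- differences along the standard basis.
  obtain ⟨κ, hκ, h⟩ := exists_pow_sub_one_mul_eq (p := p) (x := x)
  have h1 : latHom ((p : thetaRing p x) * δ) (latOrigin p x) =
      latHom (psiElt p x) (latHom (⟨κ, hκ⟩ * δ) (latOrigin p x)) := by
    apply Lat.vec_injective
    change (p * δ.1) (origin p x) = ((thetaLin p x ^ p ^ (x - 1) - 1) * (κ * δ.1)) (origin p x)
    rw [← mul_assoc, h]
  have h2 := range_eq_closure (latHom (psiElt p x)) _ latAut_origin_div
  have h3 : latHom ((p : thetaRing p x) * δ) (latOrigin p x) ∈ (latHom (psiElt p x)).range := by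
    rw [h1]
    exact ⟨_, rfl⟩
  rw [h2] at h3
  refine Subgroup.closure_mono ?_ h3
  rintro _ ⟨i, rfl⟩
  exact ⟨idxElt i, rfl⟩

/-- The quotient of `T` by the image of `α`, written multiplicatively. -/
abbrev TQuot (α : thetaRing p x) : Type := Multiplicative (T p x ⧸ image α)

/-- The action of the point group on the quotient of `T` by the image of `α`. -/
def quotAut (α : thetaRing p x) : P p x →* MulAut (TQuot α) := MonoidHom.toMulAut
  { toFun := fun g => QuotientAddGroup.map _ _ (pointRep p x g).toAddMonoidHom
      fun _ ht => apply_mem_image ⟨pointRep p x g, pointRep_mem g⟩ ht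
    map_one' := by
      refine AddMonoidHom.ext fun t => ?_
      induction t using QuotientAddGroup.induction_on
      rfl
    map_mul' := fun g h => by
      refine AddMonoidHom.ext fun t => ?_
      induction t using QuotientAddGroup.induction_on
      rfl }

/-- The class of a vector. -/
def quotMk (α : thetaRing p x) : Multiplicative (T p x) →* TQuot α :=
  AddMonoidHom.toMultiplicative (QuotientAddGroup.mk' (image α))

theorem quotMk_eq_one {α : thetaRing p x} {t : T p x} :
    quotMk α (Multiplicative.ofAdd t) = 1 ↔ t ∈ image α :=
  QuotientAddGroup.eq_zero_iff t

variable (p x) in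
/-- The inclusion of the vectors with integer coordinates. -/
def latIncl : Lat p x →* Multiplicative (T p x) :=
  AddMonoidHom.toMultiplicative (intLattice p x).subtype

theorem latIncl_apply (t : Lat p x) : latIncl p x t = Multiplicative.ofAdd t.vec := rfl

/-- The class of `β t`. -/
def quotHom (α β : thetaRing p x) : Multiplicative (T p x) →* TQuot α :=
  (quotMk α).comp (AddMonoidHom.toMultiplicative β.1.toAddMonoidHom)

theorem quotHom_apply (α β : thetaRing p x) (t : T p x) :
    quotHom α β (Multiplicative.ofAdd t) = quotMk α (Multiplicative.ofAdd (β.1 t)) := rfl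

/-- Every vector is an integer vector plus an element of p^n T ⊆ αT, so T and L have the same image
in T/αT. -/
theorem IsIsogeny.range_quotHom {α : thetaRing p x} (hα : IsIsogeny α) (β : thetaRing p x) :
    ((quotHom α β).comp (latIncl p x)).range = (quotHom α β).range := by
  refine le_antisymm ?_ ?_
  · rintro _ ⟨t, rfl⟩
    exact ⟨_, rfl⟩
  · rintro _ ⟨t, rfl⟩
    obtain ⟨a, ha, b, hb, hab⟩ := hα.exists_intLattice_add (Multiplicative.toAdd t)
    refine ⟨Multiplicative.ofAdd ⟨a, ha⟩, ?_⟩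
    have h1 : t = Multiplicative.ofAdd a * Multiplicative.ofAdd b := hab
    have h2 : quotHom α β (Multiplicative.ofAdd b) = 1 :=
      quotMk_eq_one.2 (apply_mem_image β hb)
    rw [h1, map_mul, h2, mul_one]
    rfl

theorem IsIsogeny.latIncl_surjective {α : thetaRing p x} (hα : IsIsogeny α) :
    Function.Surjective ((quotMk α).comp (latIncl p x)) := by
  have h := hα.range_quotHom 1
  have h1 : quotHom α 1 = quotMk α := rfl
  rw [h1] at h
  rw [← MonoidHom.range_eq_top, h, MonoidHom.range_eq_top]
  intro y
  obtain ⟨t, ht⟩ := QuotientAddGroup.mk_surjective (Multiplicative.toAdd y)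
  exact ⟨Multiplicative.ofAdd t, ht⟩

/-- The point is L ∩ αT = αL: if αs is integral, then so is p^n s = βαs, and an integer divisible by
p^n in ℤ_p is divisible by it in ℤ. -/
theorem IsIsogeny.ker_latIncl {α : thetaRing p x} (hα : IsIsogeny α) :
    ((quotMk α).comp (latIncl p x)).ker = (latHom α).range := by
  ext t
  rw [MonoidHom.mem_ker, MonoidHom.comp_apply, latIncl_apply, quotMk_eq_one]
  constructor
  · rintro ⟨s, hs⟩
    obtain ⟨β, n, h⟩ := hα
    have h1 : s ∈ intLattice p x := by
      refine mem_intLattice_of_pow_smul (n := n) ?_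
      rw [← natCast_pow_apply, ← h, (thetaRing_commute α β).eq, Module.End.mul_apply, hs]
      exact apply_mem_intLattice β.2 (Multiplicative.toAdd t).2
    exact ⟨Multiplicative.ofAdd ⟨s, h1⟩, Lat.vec_injective hs⟩
  · rintro ⟨s, rfl⟩
    exact ⟨s.vec, rfl⟩

/-- The images of the standard basis under an isogeny are independent. -/
theorem IsIsogeny.eq_zero_of_zpow_mem {α : thetaRing p x} (hα : IsIsogeny α) (s : Finset (Idx p x))
    (i : Idx p x) (hi : i ∉ s) (m : ℤ) (hm : (latHom α (latVec i))⁻¹ ^ m ∈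
      Subgroup.closure ((fun i => (latHom α (latVec i))⁻¹) '' (s : Set (Idx p x)))) : m = 0 := by
  obtain ⟨β, n, h⟩ := hα
  have hβ : ∀ j : Idx p x, β.1 (α.1 (unitVec (ofLex j))) = (p ^ n : ℤ_[p]) • unitVec (ofLex j) := by
    intro j
    rw [← natCast_pow_apply, ← h, (thetaRing_commute α β).eq]
    rfl
  -- As βα = p^n, the i-th coordinate of β is p^n on the image of the i-th basis vector and 0 on the
  -- images of the others.
  let F : Lat p x →* Multiplicative ℤ_[p] :=
    { toFun := fun t => Multiplicative.ofAdd (β.1 t.vec (ofLex i).1 (ofLex i).2)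
      map_one' := congrFun (congrFun (map_zero β.1) _) _
      map_mul' := fun a b => congrFun (congrFun (map_add β.1 _ _) _) _ }
  have hF : ∀ j : Idx p x, F (latHom α (latVec j)) =
      Multiplicative.ofAdd (if j = i then (p : ℤ_[p]) ^ n else 0) := by
    intro j
    change Multiplicative.ofAdd (β.1 (α.1 (unitVec (ofLex j))) (ofLex i).1 (ofLex i).2) = _
    rw [hβ]
    congr 1
    simp only [Pi.smul_apply, unitVec_apply, Prod.mk.eta, ofLex_inj, smul_eq_mul, mul_ite, mul_one,
      mul_zero, eq_comm (a := i)]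
  have h1 : Subgroup.closure ((fun i => (latHom α (latVec i))⁻¹) '' (s : Set (Idx p x))) ≤
      F.ker := by
    rw [Subgroup.closure_le]
    rintro _ ⟨j, hj, rfl⟩
    have : j ≠ i := fun h => hi (h ▸ hj)
    change F _ = 1
    rw [map_inv, hF, if_neg this]
    simp
  have h2 : F _ = 1 := h1 hm
  rw [map_zpow, map_inv, hF, if_pos rfl, ← ofAdd_neg, ← ofAdd_zsmul] at h2
  have h3 : m • -((p : ℤ_[p]) ^ n) = 0 := h2
  have hp : ((p : ℤ_[p]) ^ n) ≠ 0 := pow_ne_zero _ (Nat.cast_ne_zero.2 (Fact.out : p.Prime).ne_zero)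
  exact (smul_eq_zero.1 h3).resolve_right (neg_ne_zero.2 hp)

end PAdicSpaceGroup
end

/-! ### The quotients of the space group -/

noncomputable section

open CategoryTheory

namespace PAdicSpaceGroup

open MonoidAlgebra SemidirectProduct

variable {p x : ℕ} [Fact p.Prime]

theorem quotHom_stable (α β : thetaRing p x) (g : P p x) :
    ∀ a ∈ (quotHom α β).range, quotAut α g a ∈ (quotHom α β).range := by
  rintro _ ⟨t, rfl⟩
  refine ⟨Multiplicative.ofAdd (pointRep p x g (Multiplicative.toAdd t)), ?_⟩
  have hc := LinearMap.congr_fun (commute_of_mem_thetaRing β.2 (pointRep_mem g)).eq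
    (Multiplicative.toAdd t)
  rw [quotHom_apply]
  exact congrArg (fun s => quotMk α (Multiplicative.ofAdd s)) hc

/-- Here z₀ = `origin` and w₀ = pδ·`origin`: the differences of the orbit of w₀ generate αL, and
those of the orbit of z₀ generate (ψ-1)L, whose image in T/αT is A. -/
theorem finrank_groupCohomology_quotient (hx : 1 ≤ x) {δ : thetaRing p x} (hδ : IsIsogeny δ)
    (n : ℕ) :
    Module.finrank (ZMod p) (groupCohomology (Rep.trivial (ZMod p)
      (subgroupLeft (quotAut ((p : thetaRing p x) * δ * psiElt p x))
        (quotHom ((p : thetaRing p x) * δ * psiElt p x) (psiElt p x)).range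
        fun g => quotHom_stable _ _ g) (ZMod p)) n) =
      groupCohomology.diagonalDim (fun n m =>
        Module.finrank (ZMod p) (groupCohomology ((differenceSystem p x).gradedRep m) n)) n 0 := by
  set α := (p : thetaRing p x) * δ * psiElt p x
  have hα : IsIsogeny α := (IsIsogeny.natCast.mul hδ).mul isIsogeny_psiElt
  have := hα.finite_quotient hx
  have : Fintype (TQuot α) := Fintype.ofFinite _
  have : Fintype (P p x) := Fintype.ofFinite _
  obtain ⟨c, hc⟩ := exists_sum_mul_eq_single_sub_one (k := ZMod p)
    (fun g : P p x => latAut p x g (latOrigin p x))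
    (fun g : P p x => latAut p x (g * psi p x) (latOrigin p x))
    (latHom_natCast_mul_mem_closure δ)
  refine (differenceSystem p x).finrank_groupCohomology_subgroupLeft (quotAut α) (latAut p x)
    ((quotMk α).comp (latIncl p x)) hα.latIncl_surjective (fun g a => rfl) (latOrigin p x)
    (latHom ((p : thetaRing p x) * δ) (latOrigin p x)) c hc ?_ ?_ ?_ _ _ ?_ n
  · intro h
    refine LinearMap.ext fun f => ?_
    let f' : Additive (Lat p x) →+ ZMod p :=
      (f.comp (pointRep p x h).toAddMonoidHom).comp
        ((intLattice p x).subtype.comp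
          (AddEquiv.additiveMultiplicative (intLattice p x)).toAddMonoidHom)
    have key := sum_augmentation_mul_eq _ _ c hc f'
    -- The factor p enters here: characters modulo p vanish on w₀, so the augmentations of `c`
    -- satisfy the relation that makes the differential kill constants.
    have h0 : f' (Additive.ofMul (latHom ((p : thetaRing p x) * δ) (latOrigin p x))) = 0 := by
      change f (pointRep p x h (((p : thetaRing p x) : Module.End ℤ_[p] (T p x))
        (δ.1 (origin p x)))) = 0
      rw [natCast_apply, map_smul, map_p_smul]
    rw [h0] at key
    simp only [mul_sub, Finset.sum_sub_distrib, sub_eq_zero] at key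
    have e1 : ∀ g : P p x, f' (Additive.ofMul (latAut p x g (latOrigin p x))) =
        (differenceSystem p x).ev (h * g) f := fun g => by
      change f (pointRep p x h (pointRep p x g (origin p x))) =
        f (pointRep p x (h * g) (origin p x))
      rw [map_mul, Module.End.mul_apply]
    simp only [e1] at key
    rw [LinearMap.sum_apply, LinearMap.sum_apply]
    simp only [LinearMap.smul_apply, smul_eq_mul]
    refine key.trans (Finset.sum_congr rfl fun g _ => ?_)
    rw [mul_comm g, ← mul_assoc]
    rfl
  · rw [hα.ker_latIncl]
    exact range_eq_closure _ _ fun i => latAut_div _ i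
  · intro s i hi m hm
    refine hα.eq_zero_of_zpow_mem s i hi m ?_
    have e : ∀ i, (latHom α (latVec i))⁻¹ =
        latAut p x (idxElt i) (latHom ((p : thetaRing p x) * δ) (latOrigin p x)) /
          latAut p x (idxElt i * psi p x) (latHom ((p : thetaRing p x) * δ) (latOrigin p x)) :=
      fun i => (latAut_div _ i).symm
    simp only [e]
    exact hm
  · rw [← hα.range_quotHom]
    refine range_eq_closure _ _ fun i => ?_
    rw [← map_div]
    refine (congrArg _ (latAut_origin_div i)).trans ?_
    rw [map_inv]
    rfl

/-- The homomorphism from the space group induced by `t ↦ β t`. -/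
def spaceHom (α β : thetaRing p x) : R p x →* TQuot α ⋊[quotAut α] P p x :=
  SemidirectProduct.map (quotHom α β) (MonoidHom.id _) fun g => by
    refine MonoidHom.ext fun t => ?_
    have hc := LinearMap.congr_fun (commute_of_mem_thetaRing β.2 (pointRep_mem g)).eq
      (Multiplicative.toAdd t)
    exact congrArg (fun s => quotMk α (Multiplicative.ofAdd s)) hc

theorem range_spaceHom (α β : thetaRing p x) : (spaceHom α β).range =
    subgroupLeft (quotAut α) (quotHom α β).range (fun g => quotHom_stable _ _ g) := by
  ext y
  constructor
  · rintro ⟨r, rfl⟩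
    exact ⟨r.left, rfl⟩
  · rintro ⟨t, ht⟩
    exact ⟨⟨t, y.right⟩, SemidirectProduct.ext ht rfl⟩

/-- Since ψ-1 is injective and commutes with pδ, one has (ψ-1)t ∈ pδ(ψ-1)T exactly when t ∈ pδT. -/
theorem ker_spaceHom {δ : thetaRing p x} {N : InvariantSubgroup p x}
    (hN : N.1 = image ((p : thetaRing p x) * δ)) :
    N.inSpaceGroup = (spaceHom ((p : thetaRing p x) * δ * psiElt p x) (psiElt p x)).ker := by
  ext y
  have h1 : ∀ t, t ∈ N.1 ↔
      (psiElt p x).1 t ∈ image ((p : thetaRing p x) * δ * psiElt p x) := by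
    intro t
    rw [hN, mem_image, mem_image]
    refine exists_congr fun s => ?_
    have hc : ((p : thetaRing p x) * δ * psiElt p x).1 s =
        (psiElt p x).1 (((p : thetaRing p x) * δ).1 s) :=
      LinearMap.congr_fun (thetaRing_commute ((p : thetaRing p x) * δ) (psiElt p x)).eq s
    rw [hc]
    exact isIsogeny_psiElt.injective.eq_iff.symm
  constructor
  · rintro ⟨t, ht, rfl⟩
    exact SemidirectProduct.ext (quotMk_eq_one.2 ((h1 _).1 ht)) rfl
  · intro hy
    have hl : quotHom _ _ y.left = 1 := congrArg SemidirectProduct.left hy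
    have hr : y.right = 1 := congrArg SemidirectProduct.right hy
    exact ⟨y.left, (h1 _).2 (quotMk_eq_one.1 hl), SemidirectProduct.ext rfl hr.symm⟩

/-- The quotient of the space group as a subgroup of a semidirect product. -/
def quotientEquiv {δ : thetaRing p x} {N : InvariantSubgroup p x}
    (hN : N.1 = image ((p : thetaRing p x) * δ)) :
    N.Quotient ≃* subgroupLeft (quotAut ((p : thetaRing p x) * δ * psiElt p x))
        (quotHom ((p : thetaRing p x) * δ * psiElt p x) (psiElt p x)).range
        fun g => quotHom_stable _ _ g :=
  (QuotientGroup.quotientMulEquivOfEq (ker_spaceHom hN)).trans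
    ((QuotientGroup.quotientKerEquivRange _).trans (MulEquiv.subgroupCongr (range_spaceHom _ _)))

/-- Isomorphic groups have isomorphic cohomology. -/
def cohomologyEquiv {G G' : Type} [Group G] [Group G'] (e : G ≃* G') (n : ℕ) :
    H p G n ≃ₗ[ZMod p] H p G' n :=
  (groupCohomology.mapIso (A := Rep.trivial (ZMod p) G' (ZMod p))
    (B := Rep.trivial (ZMod p) G (ZMod p)) e (LinearEquiv.refl (ZMod p) (ZMod p))
    (fun _ => rfl) n).toLinearEquiv

theorem finite_quotient (hx : 1 ≤ x) {δ : thetaRing p x} (hδ : IsIsogeny δ)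
    {N : InvariantSubgroup p x} (hN : N.1 = image ((p : thetaRing p x) * δ)) :
    Finite N.Quotient := by
  have := ((IsIsogeny.natCast.mul hδ).mul isIsogeny_psiElt).finite_quotient hx
  have : Finite (TQuot ((p : thetaRing p x) * δ * psiElt p x) ⋊[quotAut _] P p x) :=
    Finite.of_equiv (TQuot ((p : thetaRing p x) * δ * psiElt p x) × P p x)
      SemidirectProduct.equivProd.symm
  exact Finite.of_equiv _ (quotientEquiv hN).symm.toEquiv

theorem finrank_H_quotient (hx : 1 ≤ x) {δ : thetaRing p x} (hδ : IsIsogeny δ)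
    {N : InvariantSubgroup p x} (hN : N.1 = image ((p : thetaRing p x) * δ)) (n : ℕ) :
    Module.finrank (ZMod p) (H p N.Quotient n) = groupCohomology.diagonalDim (fun n m =>
        Module.finrank (ZMod p) (groupCohomology ((differenceSystem p x).gradedRep m) n)) n 0 := by
  rw [← finrank_groupCohomology_quotient hx hδ n]
  exact (cohomologyEquiv (quotientEquiv hN) n).finrank_eq

/-- The invariant subgroup of index `p ^ (i + d)` is the image of `p (θ - 1) ^ i`. -/
theorem eq_image (hx : 1 ≤ x) {i : ℕ} {N : InvariantSubgroup p x}
    (hN : N.1.index = p ^ (i + dim p x)) :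
    N.1 = image ((p : thetaRing p x) * piElt p x ^ i) := by
  rw [eq_piPow hx _ N.1 (map_theta_eq.1 N.2).1 hN]
  have hpi : (piElt p x ^ i).1 = (thetaLin p x - 1) ^ i := rfl
  have hc := LinearMap.congr_fun (thetaRing_commute (p : thetaRing p x) (piElt p x ^ i)).eq
  ext t
  rw [mem_piPow, mem_image, pow_add]
  constructor
  · rintro ⟨s, rfl⟩
    obtain ⟨s', hs'⟩ := (piPow_dim hx _).1 ⟨s, rfl⟩
    refine ⟨s', (hc s').trans ?_⟩
    rw [Module.End.mul_apply, Module.End.mul_apply, natCast_apply, hpi, hs']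
  · rintro ⟨s, rfl⟩
    obtain ⟨s', hs'⟩ := (piPow_dim hx _).2 ⟨s, rfl⟩
    refine ⟨s', ?_⟩
    refine Eq.trans ?_ (hc s).symm
    rw [Module.End.mul_apply, Module.End.mul_apply, natCast_apply, hpi, ← hs']

end PAdicSpaceGroup
end

/-- For every `i` there is exactly one `θ`-invariant subgroup `N_i` of `T` of index
`p ^ (i + d_x)`, and `H^*(R / N_i; 𝔽_p)` and `H^*(R / N_0; 𝔽_p)` are isomorphic as graded
`𝔽_p`-modules. -/
theorem theorem1 (p x : ℕ) [Fact p.Prime] (hx : 1 ≤ x) :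
    (∀ i : ℕ, ∃! N : PAdicSpaceGroup.InvariantSubgroup p x,
      N.1.index = p ^ (i + PAdicSpaceGroup.dim p x)) ∧
    ∀ (i : ℕ) (N₀ Nᵢ : PAdicSpaceGroup.InvariantSubgroup p x),
      N₀.1.index = p ^ PAdicSpaceGroup.dim p x →
      Nᵢ.1.index = p ^ (i + PAdicSpaceGroup.dim p x) →
      Nonempty (∀ n : ℕ,
        PAdicSpaceGroup.H p Nᵢ.Quotient n ≃ₗ[ZMod p] PAdicSpaceGroup.H p N₀.Quotient n) := by
  refine ⟨fun i => PAdicSpaceGroup.existsUnique_invariantSubgroup hx _, fun i N₀ Nᵢ h₀ hᵢ => ?_⟩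
  have h₀' : N₀.1.index = p ^ (0 + PAdicSpaceGroup.dim p x) := by rw [h₀, zero_add]
  -- The dimension formula is used with δ = (θ-1)^i and with δ = (θ-1)^0 = 1; its value is the same,
  -- and finiteness turns equal dimensions into an isomorphism.
  have hδ := PAdicSpaceGroup.isIsogeny_piElt (p := p) (x := x)
  have e₀ := PAdicSpaceGroup.eq_image hx h₀'
  have eᵢ := PAdicSpaceGroup.eq_image hx hᵢ
  have := PAdicSpaceGroup.finite_quotient hx (hδ.pow 0) e₀
  have := PAdicSpaceGroup.finite_quotient hx (hδ.pow i) eᵢ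
  refine ⟨fun n => ?_⟩
  have : Module.Finite (ZMod p) (Rep.trivial (ZMod p) N₀.Quotient (ZMod p)) :=
    inferInstanceAs (Module.Finite (ZMod p) (ZMod p))
  have : Module.Finite (ZMod p) (Rep.trivial (ZMod p) Nᵢ.Quotient (ZMod p)) :=
    inferInstanceAs (Module.Finite (ZMod p) (ZMod p))
  have := groupCohomology.finite_of_finite (Rep.trivial (ZMod p) N₀.Quotient (ZMod p)) n
  have := groupCohomology.finite_of_finite (Rep.trivial (ZMod p) Nᵢ.Quotient (ZMod p)) n
  refine LinearEquiv.ofFinrankEq _ _ ?_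
  rw [PAdicSpaceGroup.finrank_H_quotient hx (hδ.pow i) eᵢ n,
    PAdicSpaceGroup.finrank_H_quotient hx (hδ.pow 0) e₀ n]
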